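/- **Corollary 2.4.** Let $p_1\ge 1$ and let $\{x_t\}_{t\in\mathbb Z}$ be a stationary process satisfying $$x_{t+1}=\sum_{i=1}^{p_1}a_i x_{t+1-i}+\varepsilon_{t+1},\qquad a_{p_1}\neq 0,$$ where $A(z)=1-a_1z-\cdots-a_{p_1}z^{p_1}$ has no zeros in $\{|z|\le 1\}$ and the $\varepsilon_t$ are i.i.d. with mean $0$ and variance $\sigma^2>0$. Assume that the distribution function $F$ of $\varepsilon_1$ satisfies, for some positive numbers $\alpha,\eta,M$, $|F(x)-F(y)|\le M|x-y|^{\alpha}$ whenever $|x-y|<\eta$, and that $E|\varepsilon_1|^{8+\delta}<\infty$ for some $\delta>0$. Write $1/A(z)=\sum_{i\ge 0}b_iz^i$, $\mathbf x_j(k)=(x_j,\dots,x_{j-k+1})'$, $\Gamma(k)=E(\mathbf x_1(k)\mathbf x_1(k)')$ and $\sigma_h^2=\sigma^2\sum_{j=0}^{h-1}b_j^2$. For $h\ge 1$ let $p_h$ be the order of the $h$-step prediction model, that is, the number $q\ge1$ such that the best (minimum mean-squared error) linear predictor of $x_{t+h}$ based on the infinite past $x_t,x_{t-1},\dots$ is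 $\sum_{j=1}^{q}c_jx_{t+1-j}$ with $c_q\ne 0$. Let $\check x_{n+h}(k)=\mathbf x_n(k)'\check{\mathbf a}_n(h,k)$ be the direct predictor, where $\check{\mathbf a}_n(h,k)$ is a least-squares coefficient vector, i.e. satisfies $$\Big(\sum_{j=k}^{n-h}\mathbf x_j(k)\mathbf x_j(k)'\Big)\check{\mathbf a}_n(h,k)=\sum_{j=k}^{n-h}\mathbf x_j(k)\,x_{j+h}\quad\text{a.s.},$$ and let $\mathrm{MSPE}\,D_{n,h}(k)=E(x_{n+h}-\check x_{n+h}(k))^2$. Then, for every $h\ge 1$ and every $k\ge p_h$, $\mathrm{MSPE}\,D_{n,h}(k)$ is finite for all large $n$ and, as $n\to\infty$, $$n\big(\mathrm{MSPE}\,D_{n,h}(k)-\sigma_h^2\big)=f_{2,h}(k)+O(n^{-1/2}),\qquad f_{2,h}(k)=\sigma^2\,\mathrm{tr}\Big\{\Gamma(k)^{-1}\,\mathrm{cov}\Big(\sum_{j=0}^{h-1}b_j\mathbf x_j(k)\Big)\Big\},$$ where $\mathrm{cov}(\mathbf y)=E\{(\mathbf y-E\mathbf y)(\mathbf y-E\mathbf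 y)'\}$. -/

import Mathlib

open MeasureTheory ProbabilityTheory Filter
open scoped Matrix Asymptotics

noncomputable section

namespace MultistepAR

variable {Ω : Type*} [MeasurableSpace Ω]

/-- The noises `ε t`, `t ∈ ℤ`, are i.i.d. with mean `0` and variance `σ ^ 2`. -/
structure IsIIDNoise (μ : Measure Ω) (ε : ℤ → Ω → ℝ) (σ : ℝ) : Prop where
  measurable : ∀ t, Measurable (ε t)
  indep : iIndepFun ε μ
  identDistrib : ∀ t, IdentDistrib (ε t) (ε 1) μ μ
  integrable : Integrable (ε 1) μ
  mean_eq_zero : ∫ ω, ε 1 ω ∂μ = 0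
  variance_eq : Var[ε 1; μ] = σ ^ 2

/-- The local Hölder condition on a distribution function `F`: for some positive `α`, `η`, `M`,
`|F x - F y| ≤ M |x - y| ^ α` whenever `|x - y| < η`. -/
def HolderDistribution (F : ℝ → ℝ) : Prop :=
  ∃ α η M : ℝ, 0 < α ∧ 0 < η ∧ 0 < M ∧
    ∀ x y : ℝ, |x - y| < η → |F x - F y| ≤ M * |x - y| ^ α

/-- The characteristic polynomial `A(z) = 1 - a₁ z - ⋯ - a_p z ^ p`. -/
def arPoly (p : ℕ) (a : ℕ → ℝ) : Polynomial ℝ :=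
  1 - ∑ i ∈ Finset.Icc 1 p, Polynomial.C (a i) * Polynomial.X ^ i

/-- The moving-average coefficients `b_i`: the Taylor coefficients at `0` of `1 / A(z)`. -/
def maCoeff (p : ℕ) (a : ℕ → ℝ) (i : ℕ) : ℝ :=
  PowerSeries.coeff i ((arPoly p a : PowerSeries ℝ)⁻¹)

/-- `x` is a (weakly) stationary process that solves the autoregression of exact order `p ≥ 1`,
`x_{t+1} = ∑_{i=1}^p a_i x_{t+1-i} + ε_{t+1}`, whose characteristic polynomial has no zeros
in the closed unit disc. -/
structure IsStationaryAR (μ : Measure Ω) (p : ℕ) (a : ℕ → ℝ) (ε x : ℤ → Ω → ℝ) : Prop where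
  one_le_order : 1 ≤ p
  coeff_ne_zero : a p ≠ 0
  no_zeros : ∀ z : ℂ, ‖z‖ ≤ 1 → Polynomial.aeval z (arPoly p a) ≠ 0
  memLp : ∀ t, MemLp (x t) 2 μ
  mean_stationary : ∀ t, ∫ ω, x t ω ∂μ = ∫ ω, x 0 ω ∂μ
  cov_stationary : ∀ t j : ℤ, ∫ ω, x t ω * x (t - j) ω ∂μ = ∫ ω, x 0 ω * x (0 - j) ω ∂μ
  equation : ∀ t : ℤ, ∀ᵐ ω ∂μ,
    x (t + 1) ω = ∑ i ∈ Finset.Icc 1 p, a i * x (t + 1 - (i : ℤ)) ω + ε (t + 1) ω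

/-- `Y` is a linear predictor based on the infinite past `x_t, x_{t-1}, …`: it is square
integrable and a mean-square limit of finite linear combinations of these variables. -/
def IsLinearInPast (μ : Measure Ω) (x : ℤ → Ω → ℝ) (t : ℤ) (Y : Ω → ℝ) : Prop :=
  MemLp Y 2 μ ∧ ∀ r : ℝ, 0 < r → ∃ (m : ℕ) (c : ℕ → ℝ),
    ∫ ω, (Y ω - ∑ j ∈ Finset.range m, c j * x (t - (j : ℤ)) ω) ^ 2 ∂μ < r

/-- `Y` is the best linear predictor of `x_{t+h}` based on the infinite past
`x_t, x_{t-1}, …`: it has the smallest mean-squared prediction error. -/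
def IsBestLinearPredictor (μ : Measure Ω) (x : ℤ → Ω → ℝ) (h : ℕ) (t : ℤ) (Y : Ω → ℝ) : Prop :=
  IsLinearInPast μ x t Y ∧ ∀ Z : Ω → ℝ, IsLinearInPast μ x t Z →
    ∫ ω, (x (t + h) ω - Y ω) ^ 2 ∂μ ≤ ∫ ω, (x (t + h) ω - Z ω) ^ 2 ∂μ

/-- The order `p_h` of the `h`-step prediction model: the number `q ≥ 1` such that the best
linear predictor of `x_{t+h}` from the infinite past is `∑_{j=1}^q c_j x_{t+1-j}` with
`c_q ≠ 0`. (Such a `q` exists and is unique for the processes considered here.) -/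
def predictionOrder (μ : Measure Ω) (x : ℤ → Ω → ℝ) (h : ℕ) : ℕ :=
  sInf {q : ℕ | 1 ≤ q ∧ ∃ c : ℕ → ℝ, c q ≠ 0 ∧ ∀ t : ℤ,
    IsBestLinearPredictor μ x h t
      (fun ω => ∑ j ∈ Finset.Icc 1 q, c j * x (t + 1 - (j : ℤ)) ω)}

/-- The regressor `𝐱_j(k) = (x_j, …, x_{j-k+1})'`. -/
def lagVec (x : ℤ → Ω → ℝ) (k : ℕ) (j : ℤ) (ω : Ω) : Fin k → ℝ :=
  fun i => x (j - ((i : ℕ) : ℤ)) ω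

/-- `Γ(k) = E(𝐱_1(k) 𝐱_1(k)')`. -/
def Gam (μ : Measure Ω) (x : ℤ → Ω → ℝ) (k : ℕ) : Matrix (Fin k) (Fin k) ℝ :=
  Matrix.of fun i j => ∫ ω, lagVec x k 1 ω i * lagVec x k 1 ω j ∂μ

/-- The covariance matrix `E((y - E y)(y - E y)')` of a random vector `y`. -/
def covMatrix (μ : Measure Ω) {k : ℕ} (y : Ω → Fin k → ℝ) : Matrix (Fin k) (Fin k) ℝ :=
  Matrix.of fun i j => cov[fun ω => y ω i, fun ω => y ω j; μ]

/-- `Γ̂_n(h,k) = (n-h-k+1)⁻¹ ∑_{j=k}^{n-h} 𝐱_j(k) 𝐱_j(k)'`. -/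
def sampleGam (x : ℤ → Ω → ℝ) (h k n : ℕ) (ω : Ω) : Matrix (Fin k) (Fin k) ℝ :=
  ((n : ℝ) - h - k + 1)⁻¹ •
    ∑ j ∈ Finset.Icc k (n - h), Matrix.vecMulVec (lagVec x k j ω) (lagVec x k j ω)

/-- `(n-h-k+1)⁻¹ ∑_{j=k}^{n-h} 𝐱_j(k) x_{j+h}`. -/
def sampleCross (x : ℤ → Ω → ℝ) (h k n : ℕ) (ω : Ω) : Fin k → ℝ :=
  ((n : ℝ) - h - k + 1)⁻¹ •
    ∑ j ∈ Finset.Icc k (n - h), x ((j : ℤ) + h) ω • lagVec x k j ω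

/-- `θ n` is, for every `n`, a direct least-squares coefficient vector: almost surely it solves
the normal equations of the regression of `x_{j+h}` on `𝐱_j(k)`, `k ≤ j ≤ n - h`. -/
def IsDirectEstimator (μ : Measure Ω) (x : ℤ → Ω → ℝ) (h k : ℕ)
    (θ : ℕ → Ω → Fin k → ℝ) : Prop :=
  ∀ n : ℕ, ∀ᵐ ω ∂μ, sampleGam x h k n ω *ᵥ θ n ω = sampleCross x h k n ω

/-- The error `x_{n+h} - 𝐱_n(k)' θ_n` of the direct predictor. -/
def directError (x : ℤ → Ω → ℝ) (h k : ℕ) (θ : ℕ → Ω → Fin k → ℝ) (n : ℕ) (ω : Ω) : ℝ :=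
  x ((n : ℤ) + h) ω - lagVec x k n ω ⬝ᵥ θ n ω

/-- The mean-squared prediction error of the direct predictor. -/
def mspeDirect (μ : Measure Ω) (x : ℤ → Ω → ℝ) (h k : ℕ) (θ : ℕ → Ω → Fin k → ℝ) (n : ℕ) : ℝ :=
  ∫ ω, directError x h k θ n ω ^ 2 ∂μ

/-- `σ_h² = σ² ∑_{j=0}^{h-1} b_j²`. -/
def sigmaSq (p : ℕ) (a : ℕ → ℝ) (σ : ℝ) (h : ℕ) : ℝ :=
  σ ^ 2 * ∑ j ∈ Finset.range h, maCoeff p a j ^ 2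

/-- `f_{2,h}(k) = tr(Γ(k)⁻¹ cov(∑_{j=0}^{h-1} b_j 𝐱_j(k))) σ²`. -/
def f₂ (μ : Measure Ω) (x : ℤ → Ω → ℝ) (p : ℕ) (a : ℕ → ℝ) (σ : ℝ) (h k : ℕ) : ℝ :=
  Matrix.trace ((Gam μ x k)⁻¹ *
    covMatrix μ (fun ω => ∑ j ∈ Finset.range h, maCoeff p a j • lagVec x k j ω)) * σ ^ 2

end MultistepAR

end

/-! Write `b` for the Taylor coefficients of `1 / A`. The zeros of `A` lie outside the closed disc,
so `b` decays geometrically (`exists_maCoeff_decay`), and the stationary solution is a.s. the causal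
series `∑ b_j ε_{t-j}` (`ae_eq_maProcess`). For `k ≥ p_h` the best predictor uses at most `k` lags,
so `x_{t+h} = c'𝐱_t(k) + η_t` with `η_t = ∑_{j<h} b_j ε_{t+h-j}` (`exists_direct_coeff`).

Put `N = n - h - k + 1`. Solving the normal equations shows that the prediction error is `η_n -
W_n`, with `W_n = N⁻¹ 𝐱_n' Γ̂⁻¹ S`, where `S = ∑ 𝐱_j η_j` is the score and `Γ̂` the sample
covariance matrix. The score ends at `j = n - h`, so `W_n` is a function of the noises up to time
`n`, whereas `η_n` involves only later ones. Hence `MSPE - σ_h² = E W_n²` exactly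
(`integral_sq_directError_maProcess`), and it remains to show `N · E W_n² = f + O(N^{-1/2})`.

Replacing `Γ̂⁻¹` by `Γ⁻¹` is controlled by Hölder's inequality (`abs_quadratic_inv_sub_le`): `Γ̂ -
Γ` is `O(N^{-1/2})` and `S` is `O(N^{1/2})` in `L⁴`, because centered products of two values of the
process behave like sums of independent terms (`lpBound_maProcess_pair_sum`). The inverse least
eigenvalue of `Γ̂` must have high moments (`exists_sampleGam_lower_bound`). For these, the Hölder
condition gives a small negative moment of `ε + c` uniformly in `c`, Laplace expansion carries it
over to determinants of matrices of distinct noises, and spreading a power over many independent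
blocks makes the exponent arbitrary.

With `Γ⁻¹` in place, `E (𝐱_n' Γ⁻¹ S)²` is a finite sum of fourfold expectations. Up to a
geometrically small error `𝐱_n` depends on the last `√N` noises, and the score without its last `√N`
terms is independent of these; so each expectation is asymptotically `N` times an entry of `Γ` times
an entry of the long-run covariance of the score (`exists_abs_integral_score_sub_le`). The quadruple
sum collapses to the trace (`sum_quadratic_eq_trace`). -/

noncomputable section
namespace MultistepAR

/-! ### Decay of the moving-average coefficients -/

/-- Power series whose coefficients are summable with the weights `r ^ j`. -/
def WeightedSummable (r : ℝ) (f : PowerSeries ℂ) : Prop :=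
  Summable fun j => ‖PowerSeries.coeff j f‖ * r ^ j

lemma WeightedSummable.mul {r : ℝ} (hr : 0 ≤ r) {f g : PowerSeries ℂ}
    (hf : WeightedSummable r f) (hg : WeightedSummable r g) : WeightedSummable r (f * g) := by
  have key := summable_norm_sum_mul_antidiagonal_of_summable_norm
    (f := fun j => PowerSeries.coeff j f * (r : ℂ) ^ j)
    (g := fun j => PowerSeries.coeff j g * (r : ℂ) ^ j)
    (by simpa [WeightedSummable, abs_of_nonneg hr] using hf)
    (by simpa [WeightedSummable, abs_of_nonneg hr] using hg)
  refine key.congr fun n => ?_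
  rw [PowerSeries.coeff_mul]
  have : ∑ kl ∈ Finset.HasAntidiagonal.antidiagonal n, PowerSeries.coeff kl.1 f * (r : ℂ) ^ kl.1 *
      (PowerSeries.coeff kl.2 g * (r : ℂ) ^ kl.2) =
      (∑ kl ∈ Finset.HasAntidiagonal.antidiagonal n, PowerSeries.coeff kl.1 f * PowerSeries.coeff kl.2 g) *
        (r : ℂ) ^ n := by
    rw [Finset.sum_mul]
    refine Finset.sum_congr rfl fun kl hkl => ?_
    rw [← Finset.HasAntidiagonal.mem_antidiagonal.1 hkl, pow_add]
    ring
  rw [this, norm_mul, norm_pow, Complex.norm_real, Real.norm_of_nonneg hr]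

lemma inv_X_sub_C_eq_mk {z : ℂ} (hz : z ≠ 0) :
    ((Polynomial.X - Polynomial.C z : Polynomial ℂ) : PowerSeries ℂ)⁻¹ =
      PowerSeries.mk fun j => -(z⁻¹) ^ (j + 1) := by
  symm
  rw [PowerSeries.eq_inv_iff_mul_eq_one]
  · ext n
    rw [Polynomial.coe_sub, mul_sub, map_sub, Polynomial.coe_X, Polynomial.coe_C]
    cases n with
    | zero => simp [hz]
    | succ n =>
      rw [PowerSeries.coeff_succ_mul_X, PowerSeries.coeff_mul_C, PowerSeries.coeff_mk,
        PowerSeries.coeff_mk, PowerSeries.coeff_one, pow_succ (z⁻¹) (n + 1)]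
      simp
      field_simp
      simp
  · simpa using hz

lemma WeightedSummable.inv_X_sub_C {z : ℂ} {r : ℝ} (hr : 0 < r) (hz : r < ‖z‖) :
    WeightedSummable r ((Polynomial.X - Polynomial.C z : Polynomial ℂ) : PowerSeries ℂ)⁻¹ := by
  have hz0 : z ≠ 0 := by rintro rfl; simp at hz; linarith
  rw [inv_X_sub_C_eq_mk hz0]
  have : Summable fun j : ℕ => ‖z‖⁻¹ * (r / ‖z‖) ^ j :=
    (summable_geometric_of_lt_one (by positivity) ((div_lt_one (hr.trans hz)).2 hz)).mul_left _
  refine this.congr fun j => ?_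
  simp [PowerSeries.coeff_mk, pow_succ, div_pow]
  field_simp

/-- Over `ℂ` the polynomial splits into linear factors. The inverse of each factor is geometric with
ratio `1 / z`, and weighted summability survives Cauchy products. -/
lemma WeightedSummable.inv_of_roots {r : ℝ} (hr : 0 < r) (P : Polynomial ℂ) (hP : P ≠ 0)
    (hroots : ∀ z ∈ P.roots, r < ‖z‖) :
    WeightedSummable r (P : PowerSeries ℂ)⁻¹ := by
  have hsplit := (IsAlgClosed.splits P).eq_prod_roots
  have key : ∀ s : Multiset ℂ, (∀ z ∈ s, r < ‖z‖) →
      WeightedSummable r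
        (((s.map fun z => Polynomial.X - Polynomial.C z).prod : Polynomial ℂ) : PowerSeries ℂ)⁻¹ := by
    intro s
    induction s using Multiset.induction_on with
    | empty =>
      intro _
      simp only [Multiset.map_zero, Multiset.prod_zero, Polynomial.coe_one]
      have : (1 : PowerSeries ℂ)⁻¹ = 1 := by
        rw [PowerSeries.inv_eq_iff_mul_eq_one] <;> simp
      rw [this]
      refine summable_of_ne_finset_zero (s := {0}) fun j hj => ?_
      have : j ≠ 0 := by simpa using hj
      simp [PowerSeries.coeff_one, this]
    | cons z s ih =>
      intro hs
      rw [Multiset.map_cons, Multiset.prod_cons, Polynomial.coe_mul, PowerSeries.mul_inv_rev]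
      exact (ih fun w hw => hs w (Multiset.mem_cons_of_mem hw)).mul hr.le
        (.inv_X_sub_C hr (hs z (Multiset.mem_cons_self z s)))
  rw [hsplit, Polynomial.coe_mul, PowerSeries.mul_inv_rev]
  refine (key _ hroots).mul hr.le ?_
  have hlc : P.leadingCoeff ≠ 0 := Polynomial.leadingCoeff_ne_zero.2 hP
  have hCinv : (PowerSeries.C P.leadingCoeff)⁻¹ = PowerSeries.C P.leadingCoeff⁻¹ := by
    rw [PowerSeries.inv_eq_iff_mul_eq_one (by simpa using hlc), ← map_mul, inv_mul_cancel₀ hlc,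
      map_one]
  rw [Polynomial.coe_C, hCinv]
  refine summable_of_ne_finset_zero (s := {0}) fun j hj => ?_
  have : j ≠ 0 := by simpa using hj
  simp [PowerSeries.coeff_C, this]

lemma arPoly_coeff_zero (p : ℕ) (a : ℕ → ℝ) : (arPoly p a).coeff 0 = 1 := by
  simp only [arPoly, Polynomial.coeff_sub, Polynomial.finsetSum_coeff, Polynomial.coeff_one_zero]
  rw [Finset.sum_eq_zero, sub_zero]
  intro i hi
  have : i ≠ 0 := by have := (Finset.mem_Icc.1 hi).1; omega
  simp [Polynomial.coeff_X_pow, this.symm]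

lemma arPoly_natDegree_le (p : ℕ) (a : ℕ → ℝ) : (arPoly p a).natDegree ≤ p := by
  refine (Polynomial.natDegree_sub_le _ _).trans (max_le (by simp) ?_)
  refine Polynomial.natDegree_sum_le_of_forall_le _ _ fun i hi => ?_
  exact (Polynomial.natDegree_C_mul_X_pow_le _ _).trans (Finset.mem_Icc.1 hi).2

/-- There are finitely many zeros, so some `r > 1` lies below all their moduli. The sum of `|b_j| r
^ j` then dominates each of its terms, which gives decay with `ρ = 1 / r`. -/
lemma exists_maCoeff_decay (p : ℕ) (a : ℕ → ℝ)
    (h0 : ∀ z : ℂ, ‖z‖ ≤ 1 → Polynomial.aeval z (arPoly p a) ≠ 0) :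
    ∃ C ρ : ℝ, 0 < C ∧ 0 < ρ ∧ ρ < 1 ∧ ∀ j, |maCoeff p a j| ≤ C * ρ ^ j := by
  set P : Polynomial ℂ := (arPoly p a).map (algebraMap ℝ ℂ) with hPdef
  have hA0 : arPoly p a ≠ 0 := by
    intro h; have := arPoly_coeff_zero p a; simp [h] at this
  have hP0 : P ≠ 0 := by
    rw [hPdef, Ne, Polynomial.map_eq_zero]; exact hA0
  have hroots : ∀ z ∈ P.roots, 1 < ‖z‖ := by
    intro z hz
    by_contra hle
    apply h0 z (not_lt.1 hle)
    have := (Polynomial.mem_roots hP0).1 hz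
    rwa [Polynomial.IsRoot, Polynomial.eval_map_algebraMap] at this
  obtain ⟨r, hr1, hr⟩ : ∃ r : ℝ, 1 < r ∧ ∀ z ∈ P.roots, r < ‖z‖ := by
    by_cases hne : P.roots.toFinset.Nonempty
    · obtain ⟨w, hw, hmin⟩ := Finset.exists_min_image P.roots.toFinset (fun z => ‖z‖) hne
      have hw1 := hroots w (by simpa using hw)
      refine ⟨(1 + ‖w‖) / 2, by linarith, fun z hz => ?_⟩
      have := hmin z (by simpa using hz)
      linarith
    · refine ⟨2, by norm_num, fun z hz => ?_⟩
      exact absurd ⟨z, by simpa using hz⟩ hne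
  have hr0 : 0 < r := by linarith
  have hsum := WeightedSummable.inv_of_roots hr0 P hP0 hr
  have hcoeff : ∀ j, PowerSeries.coeff j (P : PowerSeries ℂ)⁻¹ = (maCoeff p a j : ℂ) := by
    intro j
    have : (P : PowerSeries ℂ)⁻¹ =
        PowerSeries.map (algebraMap ℝ ℂ) ((arPoly p a : PowerSeries ℝ)⁻¹) := by
      symm
      have hc0 : PowerSeries.constantCoeff (arPoly p a : PowerSeries ℝ) ≠ 0 := by
        simp [arPoly_coeff_zero]
      have hPm : (P : PowerSeries ℂ) =
          PowerSeries.map (algebraMap ℝ ℂ) (arPoly p a : PowerSeries ℝ) := by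
        ext n; simp [hPdef]
      rw [PowerSeries.eq_inv_iff_mul_eq_one, hPm, ← map_mul, PowerSeries.inv_mul_cancel _ hc0,
        map_one]
      rw [← PowerSeries.coeff_zero_eq_constantCoeff_apply, hPm, PowerSeries.coeff_map]
      simp [arPoly_coeff_zero]
    rw [this, PowerSeries.coeff_map]
    rfl
  have hS : Summable fun j => |maCoeff p a j| * r ^ j := by
    refine hsum.congr fun j => ?_
    rw [hcoeff]; simp
  refine ⟨∑' j, |maCoeff p a j| * r ^ j + 1, r⁻¹, ?_, by positivity, inv_lt_one_of_one_lt₀ hr1,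
    fun j => ?_⟩
  · have : 0 ≤ ∑' j, |maCoeff p a j| * r ^ j := tsum_nonneg fun j => by positivity
    linarith
  · have hle := hS.le_tsum j fun i _ => by positivity
    have hp : 0 < r ^ j := by positivity
    rw [inv_pow, ← div_eq_mul_inv, le_div_iff₀ hp]
    linarith

/-! ### The backshift operator -/

/-- The backshift operator on sequences. -/
def backshift : (ℤ → ℝ) →ₗ[ℝ] (ℤ → ℝ) where
  toFun y t := y (t - 1)
  map_add' _ _ := rfl
  map_smul' _ _ := rfl

lemma backshift_pow_apply (m : ℕ) (y : ℤ → ℝ) (t : ℤ) : (backshift ^ m) y t = y (t - m) := by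
  induction m generalizing t with
  | zero => simp
  | succ m ih =>
    rw [pow_succ', Module.End.mul_apply]
    change (backshift ^ m) y (t - 1) = _
    rw [ih]
    congr 1
    push_cast
    ring

lemma aeval_backshift_apply (P : Polynomial ℝ) (y : ℤ → ℝ) (t : ℤ) {m : ℕ}
    (hm : P.natDegree < m) :
    Polynomial.aeval backshift P y t = ∑ j ∈ Finset.range m, P.coeff j * y (t - (j : ℤ)) := by
  rw [Polynomial.aeval_eq_sum_range' hm, LinearMap.sum_apply, Finset.sum_apply]
  refine Finset.sum_congr rfl fun j _ => ?_
  rw [LinearMap.smul_apply, Pi.smul_apply, backshift_pow_apply, smul_eq_mul]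

lemma arPoly_coeff_succ (p : ℕ) (a : ℕ → ℝ) {j : ℕ} (hj : j < p) :
    (arPoly p a).coeff (j + 1) = -a (j + 1) := by
  simp only [arPoly, Polynomial.coeff_sub, Polynomial.finsetSum_coeff, Polynomial.coeff_one,
    Polynomial.coeff_C_mul, Polynomial.coeff_X_pow]
  rw [Finset.sum_eq_single (j + 1)]
  · simp
  · intro i _ hi; simp [hi.symm]
  · intro h; exact absurd (Finset.mem_Icc.2 ⟨by omega, by omega⟩) h

lemma aeval_backshift_arPoly (p : ℕ) (a : ℕ → ℝ) (y : ℤ → ℝ) (t : ℤ) :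
    Polynomial.aeval backshift (arPoly p a) y t =
      y t - ∑ i ∈ Finset.Icc 1 p, a i * y (t - (i : ℤ)) := by
  rw [aeval_backshift_apply _ _ _ (Nat.lt_succ_of_le (arPoly_natDegree_le p a)),
    Finset.sum_range_succ', arPoly_coeff_zero, Finset.range_eq_Ico,
    Finset.sum_Ico_add' (fun j => (arPoly p a).coeff j * y (t - (j : ℤ))) 0 p 1]
  have : ∑ x ∈ Finset.Ico (0 + 1) (p + 1), (arPoly p a).coeff x * y (t - (x : ℤ)) =
      -∑ i ∈ Finset.Icc 1 p, a i * y (t - (i : ℤ)) := by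
    rw [← Finset.sum_neg_distrib]
    refine Finset.sum_congr (by ext; simp) fun i hi => ?_
    obtain ⟨h1, h2⟩ := Finset.mem_Ico.1 hi
    obtain ⟨j, rfl⟩ : ∃ j, i = j + 1 := ⟨i - 1, by omega⟩
    rw [arPoly_coeff_succ p a (by omega), neg_mul]
  rw [this]
  simp [sub_eq_neg_add]
-- The polynomials of the multi-step predictors.
/-- The polynomial `C_m` with `A B_m = 1 - X ^ m C_m`, where `B_m` is the truncation of `1 / A`:
its coefficients are those of the `m`-step predictor. -/
lemma exists_predictor_poly (p : ℕ) (a : ℕ → ℝ) (hp : 1 ≤ p) (m : ℕ) :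
    ∃ C : Polynomial ℝ, C.natDegree < p ∧
      arPoly p a * PowerSeries.trunc m ((arPoly p a : PowerSeries ℝ)⁻¹) = 1 - Polynomial.X ^ m * C ∧
      ∀ i, C.coeff i = ∑ j ∈ Finset.range (i + 1), (arPoly p a).coeff j * maCoeff p a (m + i - j) := by
  set A := arPoly p a with hA
  set F : PowerSeries ℝ := (A : PowerSeries ℝ)⁻¹ with hF
  have hAF : (A : PowerSeries ℝ) * F = 1 :=
    PowerSeries.mul_inv_cancel _ (by simp [hA, arPoly_coeff_zero])
  set B := PowerSeries.trunc m F with hB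
  have hD : ∀ n, (1 - A * B).coeff n = ∑ u ∈ Finset.range (n + 1),
      A.coeff u * PowerSeries.coeff (n - u) (F - (B : PowerSeries ℝ)) := by
    intro n
    have h1 : ((1 - A * B : Polynomial ℝ) : PowerSeries ℝ) = A * (F - (B : PowerSeries ℝ)) := by
      rw [mul_sub, hAF]; simp
    rw [← Polynomial.coeff_coe, h1, PowerSeries.coeff_mul,
      Finset.Nat.sum_antidiagonal_eq_sum_range_succ_mk]
    simp
  have hFB : ∀ v, PowerSeries.coeff v (F - (B : PowerSeries ℝ)) =
      if v < m then 0 else maCoeff p a v := by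
    intro v
    rw [map_sub, Polynomial.coeff_coe, hB, PowerSeries.coeff_trunc]
    split_ifs with hv
    · simp
    · rw [sub_zero]; rfl
  -- `1 - A B = A (F - B)`, and `F - B` begins at degree `m`.
  obtain ⟨C, hC⟩ := Polynomial.X_pow_dvd_iff (n := m) (f := 1 - A * B) |>.2 (by
    intro d hd
    rw [hD]
    refine Finset.sum_eq_zero fun u _ => ?_
    rw [hFB, if_pos (by omega), mul_zero])
  have hCc : ∀ i, C.coeff i = (1 - A * B).coeff (m + i) := by
    intro i
    rw [hC, add_comm, Polynomial.coeff_X_pow_mul]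
  refine ⟨C, ?_, ?_, fun i => ?_⟩
  -- `A B` has degree at most `p + m - 1` for `m ≥ 1`; removing `X ^ m` leaves degree at most `p -
  -- 1`. For `m = 0` the truncation `B` vanishes.
  · refine lt_of_le_of_lt ((Polynomial.natDegree_le_iff_coeff_eq_zero (n := p - 1)).2 ?_)
      (Nat.sub_lt hp one_pos)
    intro i hi
    rw [hCc, Polynomial.coeff_sub, Polynomial.coeff_eq_zero_of_natDegree_lt (p := A * B), sub_zero]
    · rw [Polynomial.coeff_one, if_neg (by omega)]
    · rcases Nat.eq_zero_or_pos m with rfl | hm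
      · have : B = 0 := by rw [hB]; simp
        rw [this]; simp; omega
      · have h1 : B.natDegree < m := by
          obtain ⟨m', rfl⟩ : ∃ m', m = m' + 1 := ⟨m - 1, by omega⟩
          exact PowerSeries.natDegree_trunc_lt F m'
        have h2 := Polynomial.natDegree_mul_le (p := A) (q := B)
        have h3 : A.natDegree ≤ p := arPoly_natDegree_le p a
        omega
  · rw [← hC]; ring
  · rw [hCc, hD, ← Finset.sum_subset (Finset.range_mono (show i + 1 ≤ m + i + 1 by omega))]
    · refine Finset.sum_congr rfl fun u hu => ?_
      have := Finset.mem_range.1 hu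
      rw [hFB, if_neg (by omega)]
    · intro u hu1 hu2
      rw [Finset.mem_range] at hu1 hu2
      rw [hFB, if_pos (by omega), mul_zero]

/-- Iterating the autoregression: the `m`-step decomposition into the last `m` noises and a
linear combination of the past. -/
lemma eq_sum_noise_add_predictor {p : ℕ} {a : ℕ → ℝ} {m : ℕ} {C : Polynomial ℝ}
    (hC : C.natDegree < p)
    (hAC : arPoly p a * PowerSeries.trunc m ((arPoly p a : PowerSeries ℝ)⁻¹) =
      1 - Polynomial.X ^ m * C)
    {y e : ℤ → ℝ} (hy : ∀ t, y t - ∑ i ∈ Finset.Icc 1 p, a i * y (t - (i : ℤ)) = e t) (t : ℤ) :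
    y t = ∑ j ∈ Finset.range m, maCoeff p a j * e (t - (j : ℤ)) +
      ∑ i ∈ Finset.range p, C.coeff i * y (t - (m : ℤ) - (i : ℤ)) := by
  set B := PowerSeries.trunc m ((arPoly p a : PowerSeries ℝ)⁻¹) with hB
  have h1 : Polynomial.aeval backshift (arPoly p a) y = e := by
    ext t; rw [aeval_backshift_arPoly, hy]
  have h2 : Polynomial.aeval backshift B e t =
      ∑ j ∈ Finset.range m, maCoeff p a j * e (t - (j : ℤ)) := by
    rcases Nat.eq_zero_or_pos m with rfl | hm
    · have : B = 0 := by rw [hB]; simp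
      simp [this]
    · have h1 : B.natDegree < m := by
        obtain ⟨m', rfl⟩ : ∃ m', m = m' + 1 := ⟨m - 1, by omega⟩
        exact PowerSeries.natDegree_trunc_lt _ m'
      rw [aeval_backshift_apply _ _ _ h1]
      refine Finset.sum_congr rfl fun j hj => ?_
      rw [hB, PowerSeries.coeff_trunc, if_pos (Finset.mem_range.1 hj)]
      rfl
  have h3 : Polynomial.aeval backshift B e =
      y - Polynomial.aeval backshift (Polynomial.X ^ m * C) y := by
    rw [← h1, ← Module.End.mul_apply, ← map_mul, mul_comm, hAC, map_sub]
    simp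
  have h4 : Polynomial.aeval backshift (Polynomial.X ^ m * C) y t =
      ∑ i ∈ Finset.range p, C.coeff i * y (t - (m : ℤ) - (i : ℤ)) := by
    rw [map_mul, map_pow, Polynomial.aeval_X, Module.End.mul_apply, backshift_pow_apply,
      aeval_backshift_apply _ _ _ hC]
  rw [← h2, h3, Pi.sub_apply, h4]
  ring

/-- With `C = 0` the polynomial `A` would be a unit, hence constant, against `a p ≠ 0`. A nonzero
`C` has a leading coefficient, which shows that the prediction order exists. -/
lemma predictor_poly_ne_zero {p : ℕ} {a : ℕ → ℝ} (hp : 1 ≤ p) (ha : a p ≠ 0) {m : ℕ}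
    {C : Polynomial ℝ}
    (hAC : arPoly p a * PowerSeries.trunc m ((arPoly p a : PowerSeries ℝ)⁻¹) =
      1 - Polynomial.X ^ m * C) : C ≠ 0 := by
  rintro rfl
  have hu : IsUnit (arPoly p a) := IsUnit.of_mul_eq_one _ (by simpa using hAC)
  have h0 := Polynomial.natDegree_eq_zero_of_isUnit hu
  have h1 : (arPoly p a).coeff p = 0 := Polynomial.coeff_eq_zero_of_natDegree_lt (by omega)
  obtain ⟨q, rfl⟩ : ∃ q, p = q + 1 := ⟨p - 1, by omega⟩
  rw [arPoly_coeff_succ _ _ (by omega)] at h1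
  exact ha (by linarith)

/-- The coefficients of the `m`-step predictor tend to `0` with `m`. -/
lemma abs_predictor_coeff_le {p : ℕ} {a : ℕ → ℝ} {m : ℕ} {C : Polynomial ℝ}
    (hC : ∀ i, C.coeff i = ∑ j ∈ Finset.range (i + 1),
      (arPoly p a).coeff j * maCoeff p a (m + i - j))
    {K ρ : ℝ} (hK : 0 < K) (hρ : 0 < ρ) (hρ1 : ρ < 1) (hb : ∀ j, |maCoeff p a j| ≤ K * ρ ^ j)
    (i : ℕ) :
    |C.coeff i| ≤ (∑ j ∈ Finset.range (i + 1), |(arPoly p a).coeff j|) * K * ρ ^ m := by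
  rw [hC, Finset.sum_mul, Finset.sum_mul]
  refine (Finset.abs_sum_le_sum_abs _ _).trans (Finset.sum_le_sum fun j hj => ?_)
  have hj := Finset.mem_range.1 hj
  rw [abs_mul, mul_assoc]
  refine mul_le_mul_of_nonneg_left ((hb _).trans ?_) (abs_nonneg _)
  exact mul_le_mul_of_nonneg_left (pow_le_pow_of_le_one hρ.le hρ1.le (by omega)) hK.le

end MultistepAR
end

noncomputable section
namespace MultistepAR

/-! ### Bounds for `L^q` norms -/

/-- The exponent chain of the moment counting: noises and process in `L⁸`, their products in `L⁴`,
products of four in `L²`. -/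
instance holderTriple_eight : ENNReal.HolderTriple 8 8 4 where
  inv_add_inv_eq_inv := by
    rw [← two_mul, show (8 : ENNReal) = 2 * 4 by norm_num, ENNReal.mul_inv (by simp) (by simp),
      ← mul_assoc, ENNReal.mul_inv_cancel (by simp) (by simp), one_mul]

instance holderTriple_four : ENNReal.HolderTriple 4 4 2 where
  inv_add_inv_eq_inv := by
    rw [← two_mul, show (4 : ENNReal) = 2 * 2 by norm_num, ENNReal.mul_inv (by simp) (by simp),
      ← mul_assoc, ENNReal.mul_inv_cancel (by simp) (by simp), one_mul]

variable {Ω : Type*} [mΩ : MeasurableSpace Ω] {μ : Measure Ω}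

/-- `f` has `L^q` norm at most `C`. -/
structure LpBound (μ : Measure Ω) (q : ENNReal) (f : Ω → ℝ) (C : ℝ) : Prop where
  aesm : AEStronglyMeasurable f μ
  nonneg : 0 ≤ C
  le : eLpNorm f q μ ≤ ENNReal.ofReal C

namespace LpBound

variable {q q₁ q₂ : ENNReal} {f g : Ω → ℝ} {C D : ℝ}

lemma memLp (h : LpBound μ q f C) : MemLp f q μ := ⟨h.aesm, h.le.trans_lt ENNReal.ofReal_lt_top⟩

lemma of_memLp (h : MemLp f q μ) : LpBound μ q f (eLpNorm f q μ).toReal :=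
  ⟨h.1, ENNReal.toReal_nonneg, (ENNReal.ofReal_toReal h.2.ne).ge⟩

lemma mono (h : LpBound μ q f C) (hCD : C ≤ D) : LpBound μ q f D :=
  ⟨h.aesm, h.nonneg.trans hCD, h.le.trans (ENNReal.ofReal_le_ofReal hCD)⟩

lemma congr (h : LpBound μ q f C) (hfg : f =ᵐ[μ] g) : LpBound μ q g C :=
  ⟨h.aesm.congr hfg, h.nonneg, (eLpNorm_congr_ae hfg) ▸ h.le⟩

lemma add (hq : 1 ≤ q) (hf : LpBound μ q f C) (hg : LpBound μ q g D) :
    LpBound μ q (fun ω => f ω + g ω) (C + D) := by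
  refine ⟨hf.aesm.add hg.aesm, add_nonneg hf.nonneg hg.nonneg, ?_⟩
  refine (eLpNorm_add_le hf.aesm hg.aesm hq).trans ?_
  rw [ENNReal.ofReal_add hf.nonneg hg.nonneg]
  exact add_le_add hf.le hg.le

lemma neg (hf : LpBound μ q f C) : LpBound μ q (fun ω => -f ω) C :=
  ⟨hf.aesm.neg, hf.nonneg, (eLpNorm_neg f q μ).le.trans hf.le⟩

lemma sub (hq : 1 ≤ q) (hf : LpBound μ q f C) (hg : LpBound μ q g D) :
    LpBound μ q (fun ω => f ω - g ω) (C + D) := by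
  simpa only [sub_eq_add_neg] using hf.add hq hg.neg

lemma const_mul (hf : LpBound μ q f C) (c : ℝ) : LpBound μ q (fun ω => c * f ω) (|c| * C) := by
  refine ⟨hf.aesm.const_mul c, mul_nonneg (abs_nonneg c) hf.nonneg, ?_⟩
  have := eLpNorm_const_smul c f q μ
  rw [show (fun ω => c * f ω) = c • f from rfl, this, ENNReal.ofReal_mul (abs_nonneg c)]
  refine mul_le_mul' (le_of_eq ?_) hf.le
  rw [← Real.norm_eq_abs, ofReal_norm]

lemma zero : LpBound μ q (fun _ => 0) 0 :=
  ⟨aestronglyMeasurable_const, le_rfl, by simp⟩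

lemma sum (hq : 1 ≤ q) {ι : Type*} (s : Finset ι) {F : ι → Ω → ℝ} {B : ι → ℝ}
    (h : ∀ i ∈ s, LpBound μ q (F i) (B i)) :
    LpBound μ q (fun ω => ∑ i ∈ s, F i ω) (∑ i ∈ s, B i) := by
  classical
  induction s using Finset.induction_on with
  | empty => simpa using zero
  | insert i s hi ih =>
    simp only [Finset.sum_insert hi]
    exact (h i (Finset.mem_insert_self i s)).add hq
      (ih fun j hj => h j (Finset.mem_insert_of_mem hj))

lemma mul {r : ENNReal} [ENNReal.HolderTriple q₁ q₂ r] (hf : LpBound μ q₁ f C)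
    (hg : LpBound μ q₂ g D) : LpBound μ r (fun ω => f ω * g ω) (C * D) := by
  refine ⟨hf.aesm.mul hg.aesm, mul_nonneg hf.nonneg hg.nonneg, ?_⟩
  refine (eLpNorm_smul_le_mul_eLpNorm (p := q₁) (q := q₂) hg.aesm hf.aesm).trans ?_
  rw [ENNReal.ofReal_mul hf.nonneg]
  exact mul_le_mul' hf.le hg.le

lemma mono_exponent [IsProbabilityMeasure μ] (hf : LpBound μ q₂ f C) (h : q₁ ≤ q₂) :
    LpBound μ q₁ f C :=
  ⟨hf.aesm, hf.nonneg, (eLpNorm_le_eLpNorm_of_exponent_le h hf.aesm).trans hf.le⟩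

/-- Fatou's lemma. Bounds for truncated moving averages pass to the infinite series in this way. -/
lemma of_tendsto {F : ℕ → Ω → ℝ} (hF : ∀ n, LpBound μ q (F n) C)
    (hlim : ∀ᵐ ω ∂μ, Tendsto (fun n => F n ω) atTop (nhds (f ω))) : LpBound μ q f C := by
  refine ⟨aestronglyMeasurable_of_tendsto_ae atTop (fun n => (hF n).aesm) hlim, (hF 0).nonneg, ?_⟩
  refine (Lp.eLpNorm_lim_le_liminf_eLpNorm (fun n => (hF n).aesm) f hlim).trans ?_
  exact liminf_le_of_le (by isBoundedDefault) fun b hb => by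
    obtain ⟨n, hn⟩ := hb.exists
    exact hn.trans (hF n).le

lemma integrable (hf : LpBound μ 1 f C) : Integrable f μ := memLp_one_iff_integrable.1 hf.memLp

lemma integral_abs_le (hf : LpBound μ 1 f C) : ∫ ω, |f ω| ∂μ ≤ C := by
  have h := hf.le
  rw [eLpNorm_one_eq_lintegral_enorm, ← ofReal_integral_norm_eq_lintegral_enorm hf.integrable] at h
  exact (ENNReal.ofReal_le_ofReal_iff hf.nonneg).1 h

lemma abs_integral_le (hf : LpBound μ 1 f C) : |∫ ω, f ω ∂μ| ≤ C :=
  (abs_integral_le_integral_abs).trans hf.integral_abs_le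

lemma const [IsProbabilityMeasure μ] (hq : q ≠ 0) (c : ℝ) : LpBound μ q (fun _ => c) |c| := by
  refine ⟨aestronglyMeasurable_const, abs_nonneg c, ?_⟩
  rw [eLpNorm_const c hq (IsProbabilityMeasure.ne_zero μ)]
  simp [← ofReal_norm, Real.norm_eq_abs]

lemma centered [IsProbabilityMeasure μ] (hq : 1 ≤ q) (hf : LpBound μ q f C) :
    LpBound μ q (fun ω => f ω - ∫ ω', f ω' ∂μ) (2 * C) := by
  rw [two_mul]
  exact hf.sub hq ((const (by positivity) _).mono (hf.mono_exponent hq).abs_integral_le)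

lemma integral_pow_le {m : ℕ} (hm : m ≠ 0) (hf : LpBound μ m f C) :
    ∫ ω, |f ω| ^ m ∂μ ≤ C ^ m := by
  have h := hf.le
  rw [hf.memLp.eLpNorm_eq_integral_rpow_norm (by exact_mod_cast hm) (by simp),
    ENNReal.ofReal_le_ofReal_iff hf.nonneg] at h
  simp only [ENNReal.toReal_natCast, Real.rpow_natCast, Real.norm_eq_abs] at h
  have h0 : 0 ≤ ∫ ω, |f ω| ^ m ∂μ := integral_nonneg fun ω => by positivity
  calc _ = ((∫ ω, |f ω| ^ m ∂μ) ^ (m : ℝ)⁻¹) ^ m := (Real.rpow_inv_natCast_pow h0 hm).symm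
    _ ≤ _ := by gcongr

lemma of_integral_pow_le {m : ℕ} (hm : m ≠ 0) (hC : 0 ≤ C) (hf : MemLp f m μ)
    (h : ∫ ω, |f ω| ^ m ∂μ ≤ C ^ m) : LpBound μ m f C := by
  refine ⟨hf.1, hC, ?_⟩
  rw [hf.eLpNorm_eq_integral_rpow_norm (by exact_mod_cast hm) (by simp)]
  refine ENNReal.ofReal_le_ofReal ?_
  simp only [ENNReal.toReal_natCast, Real.rpow_natCast, Real.norm_eq_abs]
  have h0 : 0 ≤ ∫ ω, |f ω| ^ m ∂μ := integral_nonneg fun ω => by positivity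
  calc _ ≤ (C ^ m) ^ (m : ℝ)⁻¹ := by gcongr
    _ = C := Real.pow_rpow_inv_natCast hC hm

end LpBound

/-! ### The σ-algebras generated by the noises -/

/-- The σ-algebra generated by the noises with times in `S`. -/
abbrev noiseSigma (ε : ℤ → Ω → ℝ) (S : Set ℤ) : MeasurableSpace Ω :=
  ⨆ i ∈ S, MeasurableSpace.comap (ε i) inferInstance

variable {ε : ℤ → Ω → ℝ} {σ : ℝ}

lemma noiseSigma_mono {S T : Set ℤ} (h : S ⊆ T) : noiseSigma ε S ≤ noiseSigma ε T :=
  biSup_mono h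

lemma noiseSigma_le (hε : ∀ t, Measurable (ε t)) (S : Set ℤ) : noiseSigma ε S ≤ mΩ :=
  iSup₂_le fun i _ => (hε i).comap_le

lemma measurable_noise {S : Set ℤ} {i : ℤ} (hi : i ∈ S) : Measurable[noiseSigma ε S] (ε i) := by
  have h : MeasurableSpace.comap (ε i) inferInstance ≤ noiseSigma ε S :=
    le_iSup₂_of_le i hi le_rfl
  exact (comap_measurable (ε i)).mono h le_rfl

lemma measurable_of_noiseSigma {β : Type*} [MeasurableSpace β] (hε : ∀ t, Measurable (ε t))
    {S : Set ℤ} {f : Ω → β} (hf : Measurable[noiseSigma ε S] f) : Measurable f :=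
  hf.mono (noiseSigma_le hε S) le_rfl

lemma indep_noiseSigma (hε : ∀ t, Measurable (ε t)) (hi : iIndepFun ε μ) {S T : Set ℤ}
    (hST : Disjoint S T) : Indep (noiseSigma ε S) (noiseSigma ε T) μ :=
  indep_iSup_of_disjoint (fun i => (hε i).comap_le) ((iIndepFun_iff_iIndep _ _ _).1 hi) hST

lemma indepFun_of_noiseSigma {β γ : Type*} [MeasurableSpace β] [MeasurableSpace γ]
    (hε : ∀ t, Measurable (ε t)) (hi : iIndepFun ε μ) {S T : Set ℤ}
    (hST : Disjoint S T) {f : Ω → β} {g : Ω → γ} (hf : Measurable[noiseSigma ε S] f)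
    (hg : Measurable[noiseSigma ε T] g) : IndepFun f g μ := by
  rw [IndepFun_iff_Indep]
  exact indep_of_indep_of_le (indep_noiseSigma hε hi hST) hf.comap_le hg.comap_le

lemma integral_mul_of_noiseSigma (hε : ∀ t, Measurable (ε t)) (hi : iIndepFun ε μ) {S T : Set ℤ}
    (hST : Disjoint S T) {f g : Ω → ℝ} (hf : Measurable[noiseSigma ε S] f)
    (hg : Measurable[noiseSigma ε T] g) :
    ∫ ω, f ω * g ω ∂μ = (∫ ω, f ω ∂μ) * ∫ ω, g ω ∂μ :=
  (indepFun_of_noiseSigma hε hi hST hf hg).integral_fun_mul_eq_mul_integral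
    (measurable_of_noiseSigma hε hf).aestronglyMeasurable
    (measurable_of_noiseSigma hε hg).aestronglyMeasurable

/-! ### Fourth moments of sums of independent variables -/

/-- Induction on the number of terms. The new term `X` and the old sum `Z` are independent and
centered, so `E (X + Z)⁴ = E X⁴ + 6 E X² E Z² + E Z⁴`; the second moment is carried along for the
cross term. The constant closes because `1 + 6 m + 3 m² ≤ 3 (m + 1)²`. -/
lemma moments_sum_le [IsProbabilityMeasure μ] (hε : ∀ t, Measurable (ε t)) (hi : iIndepFun ε μ)
    {ι : Type*} (I : Finset ι) {Y : ι → Ω → ℝ} {S : ι → Set ℤ} {B : ℝ}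
    (hmeas : ∀ i ∈ I, Measurable[noiseSigma ε (S i)] (Y i))
    (hdisj : ∀ i ∈ I, ∀ j ∈ I, i ≠ j → Disjoint (S i) (S j))
    (hB : ∀ i ∈ I, LpBound μ 4 (Y i) B) (hmean : ∀ i ∈ I, ∫ ω, Y i ω ∂μ = 0) :
    MemLp (fun ω => ∑ i ∈ I, Y i ω) 4 μ ∧ ∫ ω, ∑ i ∈ I, Y i ω ∂μ = 0 ∧
      ∫ ω, (∑ i ∈ I, Y i ω) ^ 2 ∂μ ≤ I.card * B ^ 2 ∧
      ∫ ω, (∑ i ∈ I, Y i ω) ^ 4 ∂μ ≤ 3 * (I.card : ℝ) ^ 2 * B ^ 4 := by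
  classical
  induction I using Finset.induction_on with
  | empty => simp
  | insert i I hiI ih =>
    obtain ⟨hL, h1, h2, h4⟩ := ih (fun j hj => hmeas j (Finset.mem_insert_of_mem hj))
      (fun j hj l hl => hdisj j (Finset.mem_insert_of_mem hj) l (Finset.mem_insert_of_mem hl))
      (fun j hj => hB j (Finset.mem_insert_of_mem hj))
      (fun j hj => hmean j (Finset.mem_insert_of_mem hj))
    have hii := Finset.mem_insert_self i I
    set X := Y i with hX
    set Z : Ω → ℝ := fun ω => ∑ j ∈ I, Y j ω with hZ
    have hXB := hB i hii
    have hX1 : ∫ ω, X ω ∂μ = 0 := hmean i hii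
    have hZm : Measurable[noiseSigma ε (⋃ j ∈ I, S j)] Z := by
      refine Finset.measurable_sum _ fun j hj => ?_
      exact (hmeas j (Finset.mem_insert_of_mem hj)).mono
        (noiseSigma_mono (Set.subset_biUnion_of_mem (u := fun j => S j) hj)) le_rfl
    have hXm := hmeas i hii
    have hST : Disjoint (S i) (⋃ j ∈ I, S j) := by
      rw [Set.disjoint_iUnion₂_right]
      intro j hj
      exact hdisj i hii j (Finset.mem_insert_of_mem hj) (by rintro rfl; exact hiI hj)
    have hprod : ∀ a b : ℕ, ∫ ω, X ω ^ a * Z ω ^ b ∂μ =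
        (∫ ω, X ω ^ a ∂μ) * ∫ ω, Z ω ^ b ∂μ := fun a b =>
      integral_mul_of_noiseSigma hε hi hST (hXm.pow_const a) (hZm.pow_const b)
    have hintp : ∀ {W : Ω → ℝ}, MemLp W 4 μ → ∀ a : ℕ, a ≤ 4 → Integrable (fun ω => W ω ^ a) μ := by
      intro W hW a ha
      rcases Nat.eq_zero_or_pos a with rfl | ha0
      · simp
      have h1 : MemLp W (a : ENNReal) μ := hW.mono_exponent (by exact_mod_cast ha)
      refine (h1.integrable_norm_pow ha0.ne').mono' (hW.1.pow a) (.of_forall fun ω => ?_)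
      simp
    have hXL : MemLp X 4 μ := hXB.memLp
    have hprodi : ∀ a b : ℕ, a ≤ 4 → b ≤ 4 → Integrable (fun ω => X ω ^ a * Z ω ^ b) μ :=
      fun a b ha hb => (indepFun_of_noiseSigma hε hi hST (hXm.pow_const a)
        (hZm.pow_const b)).integrable_mul (hintp hXL a ha) (hintp hL b hb)
    have hX2 : ∫ ω, X ω ^ 2 ∂μ ≤ B ^ 2 := by
      have := (hXB.mono_exponent (q₁ := (2 : ℕ)) (by norm_num)).integral_pow_le two_ne_zero
      simpa using this
    have hX4 : ∫ ω, X ω ^ 4 ∂μ ≤ B ^ 4 := by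
      have := LpBound.integral_pow_le (m := 4) (by norm_num) hXB
      simpa [Even.pow_abs (show Even 4 by decide)] using this
    have hX20 : 0 ≤ ∫ ω, X ω ^ 2 ∂μ := integral_nonneg fun ω => by positivity
    have hZ20 : 0 ≤ ∫ ω, Z ω ^ 2 ∂μ := integral_nonneg fun ω => by positivity
    simp only [Finset.sum_insert hiI]
    have hcard : ((insert i I).card : ℝ) = I.card + 1 := by
      rw [Finset.card_insert_of_notMem hiI]; push_cast; ring
    rw [hcard]
    refine ⟨hXL.add hL, ?_, ?_, ?_⟩
    · change ∫ ω, X ω + Z ω ∂μ = 0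
      rw [integral_add (by simpa using hintp hXL 1 (by norm_num))
        (by simpa using hintp hL 1 (by norm_num)), hX1, h1, add_zero]
    · change ∫ ω, (X ω + Z ω) ^ 2 ∂μ ≤ _
      have : (fun ω => (X ω + Z ω) ^ 2) =
          fun ω => X ω ^ 2 + (2 * (X ω ^ 1 * Z ω ^ 1) + Z ω ^ 2) := by ext ω; ring
      have i1 : Integrable (fun ω => 2 * (X ω ^ 1 * Z ω ^ 1) + Z ω ^ 2) μ :=
        ((hprodi 1 1 (by norm_num) (by norm_num)).const_mul 2).add (hintp hL 2 (by norm_num))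
      rw [this, integral_add (hintp hXL 2 (by norm_num)) i1,
        integral_add ((hprodi 1 1 (by norm_num) (by norm_num)).const_mul 2)
        (hintp hL 2 (by norm_num)), integral_const_mul, hprod 1 1]
      simp only [pow_one, hX1]
      linarith
    · change ∫ ω, (X ω + Z ω) ^ 4 ∂μ ≤ _
      have : (fun ω => (X ω + Z ω) ^ 4) = fun ω => X ω ^ 4 + (4 * (X ω ^ 3 * Z ω ^ 1) +
          (6 * (X ω ^ 2 * Z ω ^ 2) + (4 * (X ω ^ 1 * Z ω ^ 3) + Z ω ^ 4))) := by ext ω; ring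
      have i4 : Integrable (fun ω => Z ω ^ 4) μ := hintp hL 4 le_rfl
      have i3 : Integrable (fun ω => 4 * (X ω ^ 1 * Z ω ^ 3) + Z ω ^ 4) μ :=
        ((hprodi 1 3 (by norm_num) (by norm_num)).const_mul 4).add i4
      have i2 : Integrable (fun ω => 6 * (X ω ^ 2 * Z ω ^ 2) + (4 * (X ω ^ 1 * Z ω ^ 3) + Z ω ^ 4)) μ :=
        ((hprodi 2 2 (by norm_num) (by norm_num)).const_mul 6).add i3
      have i1 : Integrable (fun ω => 4 * (X ω ^ 3 * Z ω ^ 1) +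
          (6 * (X ω ^ 2 * Z ω ^ 2) + (4 * (X ω ^ 1 * Z ω ^ 3) + Z ω ^ 4))) μ :=
        ((hprodi 3 1 (by norm_num) (by norm_num)).const_mul 4).add i2
      rw [this, integral_add (hintp hXL 4 le_rfl) i1,
        integral_add ((hprodi 3 1 (by norm_num) (by norm_num)).const_mul 4) i2,
        integral_add ((hprodi 2 2 (by norm_num) (by norm_num)).const_mul 6) i3,
        integral_add ((hprodi 1 3 (by norm_num) (by norm_num)).const_mul 4) i4,
        integral_const_mul, integral_const_mul, integral_const_mul, hprod 3 1, hprod 2 2, hprod 1 3]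
      simp only [pow_one, hX1]
      have h1' : ∫ ω, Z ω ∂μ = 0 := h1
      rw [h1']
      have hm : (∫ ω, X ω ^ 2 ∂μ) * ∫ ω, Z ω ^ 2 ∂μ ≤ B ^ 2 * (I.card * B ^ 2) :=
        mul_le_mul hX2 h2 hZ20 (by positivity)
      have hB4 : 0 ≤ B ^ 4 := by positivity
      nlinarith

lemma LpBound.sum_of_disjoint [IsProbabilityMeasure μ] (hε : ∀ t, Measurable (ε t))
    (hi : iIndepFun ε μ)
    {ι : Type*} (I : Finset ι) {Y : ι → Ω → ℝ} {S : ι → Set ℤ} {B : ℝ} (hB0 : 0 ≤ B)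
    (hmeas : ∀ i ∈ I, Measurable[noiseSigma ε (S i)] (Y i))
    (hdisj : ∀ i ∈ I, ∀ j ∈ I, i ≠ j → Disjoint (S i) (S j))
    (hB : ∀ i ∈ I, LpBound μ 4 (Y i) B) (hmean : ∀ i ∈ I, ∫ ω, Y i ω ∂μ = 0) :
    LpBound μ 4 (fun ω => ∑ i ∈ I, Y i ω) (2 * √I.card * B) := by
  obtain ⟨hL, -, -, h4⟩ := moments_sum_le hε hi I hmeas hdisj hB hmean
  refine LpBound.of_integral_pow_le (m := 4) (by norm_num) (by positivity) hL ?_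
  simp only [Even.pow_abs (show Even 4 by decide)]
  refine h4.trans ?_
  have : (√(I.card : ℝ)) ^ 4 = (I.card : ℝ) ^ 2 := by
    rw [show 4 = 2 * 2 by norm_num, pow_mul, Real.sq_sqrt (by positivity)]
  rw [mul_pow, mul_pow, this]
  have : 0 ≤ (I.card : ℝ) ^ 2 * B ^ 4 := by positivity
  nlinarith

end MultistepAR
end

noncomputable section
namespace MultistepAR

variable {Ω : Type*} [mΩ : MeasurableSpace Ω] {μ : Measure Ω} {ε : ℤ → Ω → ℝ} {σ : ℝ}

/-! ### The noises -/

namespace IsIIDNoise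

lemma lpBound (hε : IsIIDNoise μ ε σ) {q : ENNReal} {K : ℝ} (h : LpBound μ q (ε 1) K) (t : ℤ) :
    LpBound μ q (ε t) K :=
  ⟨(hε.measurable t).aestronglyMeasurable, h.nonneg, ((hε.identDistrib t).eLpNorm_eq q).le.trans h.le⟩

lemma integral_eq_zero (hε : IsIIDNoise μ ε σ) (t : ℤ) : ∫ ω, ε t ω ∂μ = 0 :=
  (hε.identDistrib t).integral_eq.trans hε.mean_eq_zero

lemma integral_sq [IsProbabilityMeasure μ] (hε : IsIIDNoise μ ε σ) (t : ℤ) :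
    ∫ ω, ε t ω * ε t ω ∂μ = σ ^ 2 := by
  rw [← hε.variance_eq, variance_eq_integral (hε.measurable 1).aemeasurable, hε.mean_eq_zero]
  have := ((hε.identDistrib t).comp (u := fun y : ℝ => y * y) (by fun_prop)).integral_eq
  simpa [Function.comp_def, sq] using this

lemma integral_mul_of_ne (hε : IsIIDNoise μ ε σ) {s t : ℤ} (hst : s ≠ t) :
    ∫ ω, ε s ω * ε t ω ∂μ = 0 := by
  rw [integral_mul_of_noiseSigma hε.measurable hε.indep (S := {s}) (T := {t}) (by simpa using hst)
    (measurable_noise rfl) (measurable_noise rfl), hε.integral_eq_zero, zero_mul]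

end IsIIDNoise

/-- For `i ≠ j` the pairs can meet only if `i - j = ±(v - u)`, and then the quotients by `|v - u|`
differ by exactly one. For `u = v` the pairs are singletons, and integer division by `0` makes every
quotient `0`. -/
lemma disjoint_pairs_of_parity {u v i j : ℤ} (hij : i ≠ j)
    (hpar : Even (i / |v - u|) ↔ Even (j / |v - u|)) :
    Disjoint ({i + u, i + v} : Set ℤ) {j + u, j + v} := by
  have key : ∀ i j : ℤ, i ≠ j → (Even (i / |v - u|) ↔ Even (j / |v - u|)) → i + u ≠ j + v := by
    intro i j hij hpar h
    have hi : i = j + (v - u) := by linarith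
    have hd : v - u ≠ 0 := fun h0 => hij (by rw [hi, h0, add_zero])
    have : i / |v - u| = j / |v - u| + 1 ∨ i / |v - u| = j / |v - u| - 1 := by
      rcases lt_or_gt_of_ne hd with h1 | h1
      · right
        rw [abs_of_neg h1, hi, show j + (v - u) = j + (-1) * -(v - u) by ring,
          Int.add_mul_ediv_right _ _ (by omega)]
        ring
      · left
        rw [abs_of_pos h1, hi, show j + (v - u) = j + 1 * (v - u) by ring,
          Int.add_mul_ediv_right _ _ (by omega)]
    rcases this with h | h <;> rw [h] at hpar <;> grind
  rw [Set.disjoint_left]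
  rintro x (rfl | rfl) (h | h)
  · exact hij (by linarith)
  · exact key i j hij hpar h
  · exact key j i hij.symm hpar.symm h.symm
  · have : i + v = j + v := h
    exact hij (by linarith)

/-- The products are not independent, but the parity of `i / |v - u|` splits them into two families
over disjoint pairs of times. The constant is `8 = 2 · 2 · 2`: two families, the fourth-moment
bound, the centering. -/
lemma lpBound_noise_pair_sum [IsProbabilityMeasure μ] (hε : IsIIDNoise μ ε σ) {K : ℝ}
    (hK : LpBound μ 8 (ε 1) K) (I : Finset ℤ) (u v : ℤ) :
    LpBound μ 4 (fun ω => ∑ i ∈ I, (ε (i + u) ω * ε (i + v) ω -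
      ∫ ω', ε (i + u) ω' * ε (i + v) ω' ∂μ)) (8 * √I.card * K ^ 2) := by
  classical
  have hgroup : ∀ J : Finset ℤ, J ⊆ I → (∀ i ∈ J, ∀ j ∈ J, i ≠ j →
      Disjoint ({i + u, i + v} : Set ℤ) {j + u, j + v}) →
      LpBound μ 4 (fun ω => ∑ i ∈ J, (ε (i + u) ω * ε (i + v) ω -
        ∫ ω', ε (i + u) ω' * ε (i + v) ω' ∂μ)) (4 * √I.card * K ^ 2) := by
    intro J hJ hdisj
    have hp : ∀ i, LpBound μ 4 (fun ω => ε (i + u) ω * ε (i + v) ω) (K * K) := fun i =>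
      (hε.lpBound hK _).mul (hε.lpBound hK _)
    refine (LpBound.sum_of_disjoint hε.measurable hε.indep J
      (S := fun i => {i + u, i + v}) (B := 2 * (K * K)) (by have := mul_self_nonneg K; linarith)
      (fun i _ => ?_) hdisj
      (fun i _ => (hp i).centered (by norm_num)) fun i _ => ?_).mono ?_
    · exact ((measurable_noise (by simp)).mul (measurable_noise (by simp))).sub_const _
    · rw [integral_sub ((hp i).mono_exponent (by norm_num)).integrable (integrable_const _)]
      simp
    · have : √(J.card : ℝ) ≤ √I.card := Real.sqrt_le_sqrt (by exact_mod_cast Finset.card_le_card hJ)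
      nlinarith [mul_le_mul_of_nonneg_right this (sq_nonneg K)]
  have h1 := hgroup (I.filter fun i => Even (i / |v - u|)) (Finset.filter_subset _ _) (by
    intro i hi j hj hij
    exact disjoint_pairs_of_parity hij (iff_of_true (Finset.mem_filter.1 hi).2
      (Finset.mem_filter.1 hj).2))
  have h2 := hgroup (I.filter fun i => ¬ Even (i / |v - u|)) (Finset.filter_subset _ _) (by
    intro i hi j hj hij
    exact disjoint_pairs_of_parity hij (iff_of_false (Finset.mem_filter.1 hi).2
      (Finset.mem_filter.1 hj).2))
  have h12 := h1.add (by norm_num) h2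
  simp only [Finset.sum_filter_add_sum_filter_not] at h12
  exact h12.mono (by linarith)

/-! ### Causal linear processes -/

/-- The partial sums `∑_{j<m} b_j ε_{t-j}`. -/
def maPartial (b : ℕ → ℝ) (ε : ℤ → Ω → ℝ) (m : ℕ) (t : ℤ) (ω : Ω) : ℝ :=
  ∑ j ∈ Finset.range m, b j * ε (t - (j : ℤ)) ω

/-- The causal linear process `∑_j b_j ε_{t-j}`. -/
def maProcess (b : ℕ → ℝ) (ε : ℤ → Ω → ℝ) (t : ℤ) (ω : Ω) : ℝ :=
  ∑' j : ℕ, b j * ε (t - (j : ℤ)) ω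

/-- The coefficients `b` decay geometrically. -/
structure GeomDecay (b : ℕ → ℝ) (C ρ : ℝ) : Prop where
  C_pos : 0 < C
  ρ_pos : 0 < ρ
  ρ_lt_one : ρ < 1
  le : ∀ j, |b j| ≤ C * ρ ^ j

lemma GeomDecay.sum_abs_Ico_le {b : ℕ → ℝ} {C ρ : ℝ} (hb : GeomDecay b C ρ) (m n : ℕ) :
    ∑ j ∈ Finset.Ico m n, |b j| ≤ C / (1 - ρ) * ρ ^ m := by
  obtain ⟨hC, hρ, hρ1, hle⟩ := hb
  have h1 : ∑ j ∈ Finset.Ico m n, ρ ^ j ≤ ρ ^ m / (1 - ρ) := geom_sum_Ico_le_of_lt_one hρ.le hρ1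
  calc _ ≤ ∑ j ∈ Finset.Ico m n, C * ρ ^ j := Finset.sum_le_sum fun j _ => hle j
    _ = C * ∑ j ∈ Finset.Ico m n, ρ ^ j := by rw [Finset.mul_sum]
    _ ≤ C * (ρ ^ m / (1 - ρ)) := by gcongr
    _ = _ := by ring

lemma GeomDecay.const_nonneg {b : ℕ → ℝ} {C ρ : ℝ} (hb : GeomDecay b C ρ) : 0 ≤ C / (1 - ρ) :=
  div_nonneg hb.C_pos.le (by linarith [hb.ρ_lt_one])

lemma GeomDecay.sum_abs_range_le {b : ℕ → ℝ} {C ρ : ℝ} (hb : GeomDecay b C ρ) (n : ℕ) :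
    ∑ j ∈ Finset.range n, |b j| ≤ C / (1 - ρ) := by
  have := hb.sum_abs_Ico_le 0 n
  rwa [pow_zero, mul_one, ← Finset.range_eq_Ico] at this

variable {b : ℕ → ℝ} {C ρ : ℝ}

lemma lpBound_maPartial_sub (hε : IsIIDNoise μ ε σ) (hb : GeomDecay b C ρ) {q : ENNReal}
    (hq : 1 ≤ q) {K : ℝ} (hK : LpBound μ q (ε 1) K) {m n : ℕ} (hmn : m ≤ n) (t : ℤ) :
    LpBound μ q (fun ω => maPartial b ε n t ω - maPartial b ε m t ω)
      (C / (1 - ρ) * ρ ^ m * K) := by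
  have h := LpBound.sum hq (Finset.Ico m n) fun j _ =>
    (hε.lpBound hK (t - (j : ℤ))).const_mul (b j)
  rw [← Finset.sum_mul] at h
  refine LpBound.congr (h.mono (mul_le_mul_of_nonneg_right (hb.sum_abs_Ico_le m n) hK.nonneg)) ?_
  refine .of_forall fun ω => ?_
  simp only [maPartial]
  rw [Finset.sum_Ico_eq_sub _ hmn]

lemma ae_summable_ma [IsProbabilityMeasure μ] (hε : IsIIDNoise μ ε σ) (hb : GeomDecay b C ρ)
    (t : ℤ) : ∀ᵐ ω ∂μ, Summable fun j : ℕ => b j * ε (t - (j : ℤ)) ω := by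
  have hK := LpBound.of_memLp (memLp_one_iff_integrable.2 hε.integrable)
  set K := (eLpNorm (ε 1) 1 μ).toReal
  have hfin : ∫⁻ ω, ∑' j : ℕ, ‖b j * ε (t - (j : ℤ)) ω‖ₑ ∂μ ≠ ⊤ := by
    rw [lintegral_tsum fun j => ((hε.measurable _).const_mul _).enorm.aemeasurable]
    have hle : ∀ j : ℕ, ∫⁻ ω, ‖b j * ε (t - (j : ℤ)) ω‖ₑ ∂μ ≤ ENNReal.ofReal (C * ρ ^ j * K) := by
      intro j
      rw [← eLpNorm_one_eq_lintegral_enorm]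
      exact (((hε.lpBound hK _).const_mul (b j)).mono
        (mul_le_mul_of_nonneg_right (hb.le j) hK.nonneg)).le
    refine ((ENNReal.tsum_le_tsum hle).trans_lt ?_).ne
    have hs : Summable fun j : ℕ => C * ρ ^ j * K :=
      ((summable_geometric_of_lt_one hb.ρ_pos.le hb.ρ_lt_one).mul_left C).mul_right K
    have hn : ∀ j : ℕ, 0 ≤ C * ρ ^ j * K := fun j =>
      mul_nonneg (mul_nonneg hb.C_pos.le (pow_nonneg hb.ρ_pos.le j)) hK.nonneg
    rw [← ENNReal.ofReal_tsum_of_nonneg hn hs]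
    exact ENNReal.ofReal_lt_top
  have hae := ae_lt_top (Measurable.tsum fun j : ℕ =>
    ((hε.measurable (t - (j : ℤ))).const_mul (b j)).enorm) hfin
  filter_upwards [hae] with ω hω
  refine Summable.of_norm ?_
  have := ENNReal.summable_toReal hω.ne
  simpa [toReal_enorm] using this

lemma ae_tendsto_maPartial [IsProbabilityMeasure μ] (hε : IsIIDNoise μ ε σ)
    (hb : GeomDecay b C ρ) (t : ℤ) :
    ∀ᵐ ω ∂μ, Tendsto (fun m => maPartial b ε m t ω) atTop (nhds (maProcess b ε t ω)) := by
  filter_upwards [ae_summable_ma hε hb t] with ω hω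
  exact hω.hasSum.tendsto_sum_nat

lemma measurable_maPartial (b : ℕ → ℝ) (ε : ℤ → Ω → ℝ) {m : ℕ} {t : ℤ} {S : Set ℤ}
    (hS : ∀ j < m, t - (j : ℤ) ∈ S) : Measurable[noiseSigma ε S] (maPartial b ε m t) :=
  Finset.measurable_sum _ fun j hj =>
    (measurable_noise (hS j (Finset.mem_range.1 hj))).const_mul (b j)

lemma measurable_tsum_real {α : Type*} [MeasurableSpace α] {f : ℕ → α → ℝ}
    (hf : ∀ j, Measurable (f j)) : Measurable fun x => ∑' j, f j x := Measurable.tsum hf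

lemma measurable_maProcess (b : ℕ → ℝ) (ε : ℤ → Ω → ℝ) {t : ℤ} {S : Set ℤ}
    (hS : Set.Iic t ⊆ S) : Measurable[noiseSigma ε S] (maProcess b ε t) :=
  @measurable_tsum_real Ω (noiseSigma ε S) _ fun j =>
    (measurable_noise (hS (by simp))).const_mul (b j)

lemma lpBound_maProcess_sub [IsProbabilityMeasure μ] (hε : IsIIDNoise μ ε σ)
    (hb : GeomDecay b C ρ) {q : ENNReal}
    (hq : 1 ≤ q) {K : ℝ} (hK : LpBound μ q (ε 1) K) (m : ℕ) (t : ℤ) :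
    LpBound μ q (fun ω => maProcess b ε t ω - maPartial b ε m t ω)
      (C / (1 - ρ) * ρ ^ m * K) := by
  refine LpBound.of_tendsto (fun n => lpBound_maPartial_sub hε hb hq hK (m.le_add_right n) t) ?_
  filter_upwards [ae_tendsto_maPartial hε hb t] with ω hω
  refine Tendsto.sub_const ?_ _
  have := (tendsto_add_atTop_iff_nat m).2 hω
  simpa [add_comm] using this

lemma lpBound_maProcess [IsProbabilityMeasure μ] (hε : IsIIDNoise μ ε σ)
    (hb : GeomDecay b C ρ) {q : ENNReal}
    (hq : 1 ≤ q) {K : ℝ} (hK : LpBound μ q (ε 1) K) (t : ℤ) :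
    LpBound μ q (maProcess b ε t) (C / (1 - ρ) * K) := by
  simpa [maPartial] using lpBound_maProcess_sub hε hb hq hK 0 t

lemma lpBound_maPartial [IsProbabilityMeasure μ] (hε : IsIIDNoise μ ε σ)
    (hb : GeomDecay b C ρ) {q : ENNReal}
    (hq : 1 ≤ q) {K : ℝ} (hK : LpBound μ q (ε 1) K) (m : ℕ) (t : ℤ) :
    LpBound μ q (maPartial b ε m t) (C / (1 - ρ) * K) := by
  have h := lpBound_maPartial_sub hε hb hq hK m.zero_le t
  rw [pow_zero, mul_one] at h
  exact h.congr (.of_forall fun ω => by simp [maPartial])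

/-- Needed so that the centering constants converge along with the truncated products when Fatou's
lemma is applied. -/
lemma tendsto_integral_maPartial_mul [IsProbabilityMeasure μ] (hε : IsIIDNoise μ ε σ)
    (hb : GeomDecay b C ρ) {K : ℝ} (hK : LpBound μ 2 (ε 1) K) (u v : ℤ) :
    Tendsto (fun m => ∫ ω, maPartial b ε m u ω * maPartial b ε m v ω ∂μ) atTop
      (nhds (∫ ω, maProcess b ε u ω * maProcess b ε v ω ∂μ)) := by
  have hq : (1 : ENNReal) ≤ 2 := by norm_num
  set D := C / (1 - ρ) * K with hD
  have hbound : ∀ m, ‖(∫ ω, maPartial b ε m u ω * maPartial b ε m v ω ∂μ) -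
      ∫ ω, maProcess b ε u ω * maProcess b ε v ω ∂μ‖ ≤ (2 * D ^ 2) * ρ ^ m := by
    intro m
    have h1 : LpBound μ 1 _ _ := (lpBound_maProcess_sub hε hb hq hK m u).mul
      (lpBound_maPartial hε hb hq hK m v)
    have h2 : LpBound μ 1 _ _ := (lpBound_maProcess hε hb hq hK u).mul
      (lpBound_maProcess_sub hε hb hq hK m v)
    have h3 : LpBound μ 1 _ _ := (lpBound_maPartial hε hb hq hK m u).mul
      (lpBound_maPartial hε hb hq hK m v)
    have h4 : LpBound μ 1 _ _ := (lpBound_maProcess hε hb hq hK u).mul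
      (lpBound_maProcess hε hb hq hK v)
    rw [← integral_sub h3.integrable h4.integrable]
    refine (((h1.add le_rfl h2).neg.congr (.of_forall fun ω => ?_)).abs_integral_le).trans_eq ?_
    · ring
    · rw [hD]; ring
  rw [tendsto_iff_norm_sub_tendsto_zero]
  refine squeeze_zero (fun m => norm_nonneg _) hbound ?_
  simpa using (tendsto_pow_atTop_nhds_zero_of_lt_one hb.ρ_pos.le hb.ρ_lt_one).const_mul (2 * D ^ 2)

lemma integral_maProcess [IsProbabilityMeasure μ] (hε : IsIIDNoise μ ε σ)
    (hb : GeomDecay b C ρ) (t : ℤ) : ∫ ω, maProcess b ε t ω ∂μ = 0 := by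
  have hK := LpBound.of_memLp (memLp_one_iff_integrable.2 hε.integrable)
  set K := (eLpNorm (ε 1) 1 μ).toReal
  have h0 : ∀ m, ∫ ω, maPartial b ε m t ω ∂μ = 0 := by
    intro m
    simp only [maPartial]
    rw [integral_finsetSum _ fun j _ => ((hε.lpBound hK _).integrable).const_mul _]
    simp [integral_const_mul, hε.integral_eq_zero]
  have hbound : ∀ m : ℕ, |∫ ω, maProcess b ε t ω ∂μ| ≤ C / (1 - ρ) * ρ ^ m * K := by
    intro m
    have := (lpBound_maProcess_sub hε hb le_rfl hK m t).abs_integral_le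
    rwa [integral_sub (lpBound_maProcess hε hb le_rfl hK t).integrable
      (lpBound_maPartial hε hb le_rfl hK m t).integrable, h0, sub_zero] at this
  have hlim : Tendsto (fun m : ℕ => C / (1 - ρ) * ρ ^ m * K) atTop (nhds 0) := by
    simpa using ((tendsto_pow_atTop_nhds_zero_of_lt_one hb.ρ_pos.le hb.ρ_lt_one).const_mul
      (C / (1 - ρ))).mul_const K
  exact abs_nonpos_iff.1 (ge_of_tendsto' hlim hbound)

/-- Sums of the centered products `X_{i+u} X_{i+v}` grow like the square root of the number of
terms. -/
lemma lpBound_maProcess_pair_sum [IsProbabilityMeasure μ] (hε : IsIIDNoise μ ε σ)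
    (hb : GeomDecay b C ρ) {K : ℝ} (hK : LpBound μ 8 (ε 1) K) (I : Finset ℤ) (u v : ℤ) :
    LpBound μ 4 (fun ω => ∑ i ∈ I, (maProcess b ε (i + u) ω * maProcess b ε (i + v) ω -
      ∫ ω', maProcess b ε (i + u) ω' * maProcess b ε (i + v) ω' ∂μ))
      ((C / (1 - ρ)) ^ 2 * (8 * √I.card * K ^ 2)) := by
  have hK2 : LpBound μ 2 (ε 1) K := hK.mono_exponent (by norm_num)
  -- For the truncated processes the sum is a double sum over lags `s`, `t` of noise pair sums with
  -- weights `b s * b t`. The bound `(∑ |b|)²` does not depend on the truncation, so Fatou's lemma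
  -- applies.
  refine LpBound.of_tendsto (F := fun m ω => ∑ i ∈ I,
      (maPartial b ε m (i + u) ω * maPartial b ε m (i + v) ω -
      ∫ ω', maPartial b ε m (i + u) ω' * maPartial b ε m (i + v) ω' ∂μ)) (fun m => ?_) ?_
  · have h := LpBound.sum (q := 4) (μ := μ) (by norm_num) (Finset.range m) fun s _ =>
      LpBound.sum (by norm_num) (Finset.range m) fun t _ =>
        (lpBound_noise_pair_sum hε hK I (u - s) (v - t)).const_mul (b s * b t)
    have hsum : ∑ s ∈ Finset.range m, ∑ t ∈ Finset.range m, |b s * b t| * (8 * √I.card * K ^ 2) ≤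
        (C / (1 - ρ)) ^ 2 * (8 * √I.card * K ^ 2) := by
      have : ∑ s ∈ Finset.range m, ∑ t ∈ Finset.range m, |b s * b t| * (8 * √I.card * K ^ 2) =
          (∑ s ∈ Finset.range m, |b s|) ^ 2 * (8 * √I.card * K ^ 2) := by
        rw [sq (∑ s ∈ Finset.range m, |b s|), Finset.sum_mul_sum, Finset.sum_mul]
        refine Finset.sum_congr rfl fun s _ => ?_
        rw [Finset.sum_mul]
        simp only [abs_mul]
      rw [this]
      have h1 := hb.sum_abs_range_le m
      have h2 : 0 ≤ ∑ s ∈ Finset.range m, |b s| := Finset.sum_nonneg fun _ _ => abs_nonneg _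
      gcongr
    refine LpBound.congr (h.mono hsum) (.of_forall fun ω => ?_)
    have hprod : ∀ (i : ℤ) (ω : Ω), maPartial b ε m (i + u) ω * maPartial b ε m (i + v) ω =
        ∑ s ∈ Finset.range m, ∑ t ∈ Finset.range m,
          b s * b t * (ε (i + (u - s)) ω * ε (i + (v - t)) ω) := by
      intro i ω
      simp only [maPartial]
      rw [Finset.sum_mul_sum]
      refine Finset.sum_congr rfl fun s _ => Finset.sum_congr rfl fun t _ => ?_
      rw [add_sub_assoc, add_sub_assoc]
      ring
    have hint : ∀ i : ℤ, ∫ ω', maPartial b ε m (i + u) ω' * maPartial b ε m (i + v) ω' ∂μ =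
        ∑ s ∈ Finset.range m, ∑ t ∈ Finset.range m,
          b s * b t * ∫ ω', ε (i + (u - s)) ω' * ε (i + (v - t)) ω' ∂μ := by
      intro i
      have hi : ∀ s t : ℕ, Integrable (fun ω' => b s * b t *
          (ε (i + (u - s)) ω' * ε (i + (v - t)) ω')) μ := fun s t =>
        (LpBound.integrable ((hε.lpBound hK2 _).mul (hε.lpBound hK2 _))).const_mul _
      simp only [hprod]
      rw [integral_finsetSum _ fun s _ => integrable_finsetSum _ fun t _ => hi s t]
      refine Finset.sum_congr rfl fun s _ => ?_
      rw [integral_finsetSum _ fun t _ => hi s t]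
      exact Finset.sum_congr rfl fun t _ => integral_const_mul _ _
    have hterm : ∀ i : ℤ, maPartial b ε m (i + u) ω * maPartial b ε m (i + v) ω -
        ∫ ω', maPartial b ε m (i + u) ω' * maPartial b ε m (i + v) ω' ∂μ =
        ∑ s ∈ Finset.range m, ∑ t ∈ Finset.range m, b s * b t *
          (ε (i + (u - s)) ω * ε (i + (v - t)) ω -
            ∫ ω', ε (i + (u - s)) ω' * ε (i + (v - t)) ω' ∂μ) := by
      intro i
      rw [hint, hprod]
      simp only [← Finset.sum_sub_distrib, ← mul_sub]
    simp only [hterm]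
    rw [Finset.sum_comm (s := I)]
    refine Finset.sum_congr rfl fun s _ => ?_
    rw [Finset.sum_comm (s := I)]
    simp only [Finset.mul_sum]
  · have hall : ∀ᵐ ω ∂μ, ∀ t : ℤ,
        Tendsto (fun m => maPartial b ε m t ω) atTop (nhds (maProcess b ε t ω)) :=
      ae_all_iff.2 fun t => ae_tendsto_maPartial hε hb t
    filter_upwards [hall] with ω hω
    exact tendsto_finsetSum _ fun i _ => ((hω _).mul (hω _)).sub
      (tendsto_integral_maPartial_mul hε hb hK2 _ _)

end MultistepAR
end

noncomputable section
namespace MultistepAR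

variable {Ω : Type*} [mΩ : MeasurableSpace Ω] {μ : Measure Ω} {ε : ℤ → Ω → ℝ} {σ : ℝ}

/-! ### The stationary solution is the causal linear process -/

namespace IsStationaryAR

variable {p : ℕ} {a : ℕ → ℝ} {x : ℤ → Ω → ℝ} {C ρ : ℝ}

lemma ae_equation (hx : IsStationaryAR μ p a ε x) :
    ∀ᵐ ω ∂μ, ∀ t : ℤ, x t ω - ∑ i ∈ Finset.Icc 1 p, a i * x (t - (i : ℤ)) ω = ε t ω := by
  refine ae_all_iff.2 fun t => ?_
  filter_upwards [hx.equation (t - 1)] with ω hω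
  rw [sub_add_cancel] at hω
  rw [hω]; ring

lemma exists_lpBound_two (hx : IsStationaryAR μ p a ε x) :
    ∃ M, ∀ t, LpBound μ 2 (x t) M := by
  refine ⟨√(∫ ω, x 0 ω * x 0 ω ∂μ), fun t => ?_⟩
  have h := LpBound.of_integral_pow_le (μ := μ) (m := 2) two_ne_zero
    (Real.sqrt_nonneg (∫ ω, x 0 ω * x 0 ω ∂μ)) (f := x t) (by exact_mod_cast hx.memLp t) ?_
  · exact_mod_cast h
  · rw [Real.sq_sqrt (integral_nonneg fun ω => mul_self_nonneg _)]
    have := hx.cov_stationary t 0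
    simp only [sub_zero] at this
    rw [← this]
    simp [sq]

lemma lpBound_sub_maPartial (hx : IsStationaryAR μ p a ε x) {m : ℕ} {P : Polynomial ℝ}
    (hP : P.natDegree < p)
    (hAP : arPoly p a * PowerSeries.trunc m ((arPoly p a : PowerSeries ℝ)⁻¹) =
      1 - Polynomial.X ^ m * P) (t : ℤ) :
    ∀ᵐ ω ∂μ, x t ω = maPartial (maCoeff p a) ε m t ω +
      ∑ i ∈ Finset.range p, P.coeff i * x (t - (m : ℤ) - (i : ℤ)) ω := by
  filter_upwards [hx.ae_equation] with ω hω
  exact eq_sum_noise_add_predictor hP hAP (y := fun t => x t ω) (e := fun t => ε t ω) hω t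

/-- Iterating the recursion `m` times leaves a remainder of `p` lagged values with coefficients `O(ρ
^ m)`. Their `L²` norms do not depend on time by stationarity, so the difference has `L²` norm `O(ρ
^ m)` for every `m`. -/
lemma ae_eq_maProcess [IsProbabilityMeasure μ] (hx : IsStationaryAR μ p a ε x)
    (hε : IsIIDNoise μ ε σ) (hb : GeomDecay (maCoeff p a) C ρ) {K : ℝ}
    (hK : LpBound μ 2 (ε 1) K) (t : ℤ) : x t =ᵐ[μ] maProcess (maCoeff p a) ε t := by
  have hq : (1 : ENNReal) ≤ 2 := by norm_num
  obtain ⟨M, hM⟩ := hx.exists_lpBound_two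
  have hM0 := (hM 0).nonneg
  set A := ∑ j ∈ Finset.range p, |(arPoly p a).coeff j| with hA
  have hbound : ∀ m : ℕ, LpBound μ 2 (fun ω => x t ω - maProcess (maCoeff p a) ε t ω)
      ((p * (A * C * M) + C / (1 - ρ) * K) * ρ ^ m) := by
    intro m
    obtain ⟨P, hP, hAP, hPc⟩ := exists_predictor_poly p a hx.one_le_order m
    have h1 := LpBound.sum hq (Finset.range p) fun i _ =>
      (hM (t - (m : ℤ) - (i : ℤ))).const_mul (P.coeff i)
    have h2 := h1.sub hq (lpBound_maProcess_sub hε hb hq hK m t)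
    refine (h2.congr ?_).mono ?_
    · filter_upwards [hx.lpBound_sub_maPartial hP hAP t] with ω hω
      rw [hω]; ring
    · have : ∑ i ∈ Finset.range p, |P.coeff i| * M ≤ ∑ i ∈ Finset.range p, A * C * ρ ^ m * M := by
        refine Finset.sum_le_sum fun i hi => mul_le_mul_of_nonneg_right ?_ hM0
        refine (abs_predictor_coeff_le hPc hb.C_pos hb.ρ_pos hb.ρ_lt_one hb.le i).trans ?_
        have hC := hb.C_pos
        have hρ := hb.ρ_pos
        have := Finset.mem_range.1 hi
        have hsub : ∑ j ∈ Finset.range (i + 1), |(arPoly p a).coeff j| ≤ A :=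
          Finset.sum_le_sum_of_subset_of_nonneg (Finset.range_mono (by omega))
            fun _ _ _ => abs_nonneg _
        gcongr
      rw [Finset.sum_const, Finset.card_range, nsmul_eq_mul] at this
      linarith
  have hzero : eLpNorm (fun ω => x t ω - maProcess (maCoeff p a) ε t ω) 2 μ = 0 := by
    refine le_antisymm ?_ bot_le
    have hlim : Tendsto (fun m : ℕ => ENNReal.ofReal
        ((p * (A * C * M) + C / (1 - ρ) * K) * ρ ^ m)) atTop (nhds 0) := by
      rw [← ENNReal.ofReal_zero]
      refine (ENNReal.continuous_ofReal.tendsto 0).comp ?_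
      simpa using (tendsto_pow_atTop_nhds_zero_of_lt_one hb.ρ_pos.le hb.ρ_lt_one).const_mul
        (p * (A * C * M) + C / (1 - ρ) * K)
    exact ge_of_tendsto' hlim fun m => (hbound m).le
  have := (eLpNorm_eq_zero_iff (hbound 0).aesm (by norm_num)).1 hzero
  filter_upwards [this] with ω hω
  simpa [sub_eq_zero] using hω

end IsStationaryAR

lemma integrable_mul_of_memLp_two {f g : Ω → ℝ} (hf : MemLp f 2 μ) (hg : MemLp g 2 μ) :
    Integrable (fun ω => f ω * g ω) μ := hf.integrable_mul hg

/-! ### The `h`-step prediction model -/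

section Prediction

variable {p : ℕ} {a : ℕ → ℝ} {x : ℤ → Ω → ℝ} {C ρ : ℝ}

lemma measurable_forecast_error (b : ℕ → ℝ) (ε : ℤ → Ω → ℝ) (h : ℕ) (t : ℤ) :
    Measurable[noiseSigma ε (Set.Ioi t)] (maPartial b ε h (t + h)) :=
  measurable_maPartial b ε fun j hj => by simp only [Set.mem_Ioi]; omega

lemma integral_maPartial [IsProbabilityMeasure μ] (hε : IsIIDNoise μ ε σ) (b : ℕ → ℝ) (m : ℕ)
    (t : ℤ) : ∫ ω, maPartial b ε m t ω ∂μ = 0 := by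
  simp only [maPartial]
  rw [integral_finsetSum _ fun j _ =>
    ((hε.identDistrib _).integrable_iff.2 hε.integrable).const_mul _]
  simp [integral_const_mul, hε.integral_eq_zero]

lemma integral_forecast_error_mul_past [IsProbabilityMeasure μ] (hε : IsIIDNoise μ ε σ)
    (hX : ∀ t, x t =ᵐ[μ] maProcess (maCoeff p a) ε t) (b : ℕ → ℝ) (h : ℕ) {s t : ℤ} (hst : s ≤ t) :
    ∫ ω, maPartial b ε h (t + h) ω * x s ω ∂μ = 0 := by
  have h1 : ∫ ω, maPartial b ε h (t + h) ω * x s ω ∂μ =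
      ∫ ω, maPartial b ε h (t + h) ω * maProcess (maCoeff p a) ε s ω ∂μ := by
    refine integral_congr_ae ?_
    filter_upwards [hX s] with ω hω
    rw [hω]
  rw [h1, integral_mul_of_noiseSigma hε.measurable hε.indep (S := Set.Ioi t) (T := Set.Iic t)
    (by rw [Set.disjoint_left]; intro i hi hi'; simp at hi hi'; omega)
    (measurable_forecast_error b ε h t)
    (measurable_maProcess _ ε (by intro i hi; simp at hi ⊢; omega)), integral_maPartial hε, zero_mul]

/-- Orthogonality to finite combinations of the past holds by independence; it extends to
mean-square limits by the Cauchy-Schwarz inequality. -/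
lemma integral_forecast_error_mul [IsProbabilityMeasure μ] (hε : IsIIDNoise μ ε σ)
    (hX : ∀ t, x t =ᵐ[μ] maProcess (maCoeff p a) ε t) (hxL : ∀ t, MemLp (x t) 2 μ) (b : ℕ → ℝ)
    (h : ℕ) (t : ℤ) (hη : MemLp (maPartial b ε h (t + h)) 2 μ)
    {Y : Ω → ℝ} (hY : IsLinearInPast μ x t Y) :
    ∫ ω, maPartial b ε h (t + h) ω * Y ω ∂μ = 0 := by
  obtain ⟨hYL, happ⟩ := hY
  set η := maPartial b ε h (t + h) with hηdef
  have hηB := LpBound.of_memLp hη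
  set D := (eLpNorm η 2 μ).toReal
  have hle : ∀ r : ℝ, 0 < r → |∫ ω, η ω * Y ω ∂μ| ≤ D * r := by
    intro r hr
    obtain ⟨m, c, hc⟩ := happ (r ^ 2) (by positivity)
    set Z : Ω → ℝ := fun ω => ∑ j ∈ Finset.range m, c j * x (t - (j : ℤ)) ω with hZ
    have hZL : MemLp Z 2 μ := memLp_finsetSum _ fun j _ => (hxL _).const_mul _
    have hZ0 : ∫ ω, η ω * Z ω ∂μ = 0 := by
      simp only [hZ, Finset.mul_sum]
      rw [integral_finsetSum _ fun j _ => integrable_mul_of_memLp_two hη ((hxL _).const_mul _)]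
      refine Finset.sum_eq_zero fun j _ => ?_
      have : (fun ω => η ω * (c j * x (t - (j : ℤ)) ω)) =
          fun ω => c j * (η ω * x (t - (j : ℤ)) ω) := by ext ω; ring
      rw [this, integral_const_mul,
        integral_forecast_error_mul_past hε hX b h (by omega), mul_zero]
    have hB : LpBound μ 2 (fun ω => Y ω - Z ω) r := by
      have := LpBound.of_integral_pow_le (μ := μ) (m := 2) two_ne_zero hr.le
        (f := fun ω => Y ω - Z ω) (by exact_mod_cast hYL.sub hZL) (by simpa using hc.le)
      exact_mod_cast this
    have h1 : LpBound μ 1 _ _ := hηB.mul hB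
    have h2 := h1.abs_integral_le
    simp only [mul_sub] at h2
    rwa [integral_sub (integrable_mul_of_memLp_two hη hYL) (integrable_mul_of_memLp_two hη hZL), hZ0, sub_zero] at h2
  have hD := hηB.nonneg
  have hlim : Tendsto (fun r : ℝ => D * r) (nhdsWithin 0 (Set.Ioi 0)) (nhds 0) := by
    have : Tendsto (fun r : ℝ => D * r) (nhds 0) (nhds (D * 0)) :=
      (continuous_const.mul continuous_id).tendsto 0
    rw [mul_zero] at this
    exact this.mono_left nhdsWithin_le_nhds
  exact abs_nonpos_iff.1 (ge_of_tendsto hlim (eventually_nhdsWithin_of_forall hle))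

lemma isLinearInPast_sum (hxL : ∀ t, MemLp (x t) 2 μ) (t : ℤ) (m : ℕ) (c : ℕ → ℝ) :
    IsLinearInPast μ x t fun ω => ∑ j ∈ Finset.range m, c j * x (t - (j : ℤ)) ω :=
  ⟨memLp_finsetSum _ fun j _ => (hxL _).const_mul _, fun r hr => ⟨m, c, by simpa using hr⟩⟩

/-- Pythagoras: the forecast error is orthogonal to the linear past. This shows that the iterated
predictor is optimal and that every other optimal predictor agrees with it a.s. -/
lemma integral_sq_forecast [IsProbabilityMeasure μ] (hε : IsIIDNoise μ ε σ)
    (hX : ∀ t, x t =ᵐ[μ] maProcess (maCoeff p a) ε t) (hxL : ∀ t, MemLp (x t) 2 μ) {b : ℕ → ℝ}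
    {h : ℕ} {t : ℤ} (hη : MemLp (maPartial b ε h (t + h)) 2 μ) {m : ℕ} {c : ℕ → ℝ}
    (hdec : ∀ᵐ ω ∂μ, x (t + h) ω = maPartial b ε h (t + h) ω +
      ∑ j ∈ Finset.range m, c j * x (t - (j : ℤ)) ω)
    {Y : Ω → ℝ} (hY : IsLinearInPast μ x t Y) :
    ∫ ω, (x (t + h) ω - Y ω) ^ 2 ∂μ = ∫ ω, maPartial b ε h (t + h) ω ^ 2 ∂μ +
      ∫ ω, (∑ j ∈ Finset.range m, c j * x (t - (j : ℤ)) ω - Y ω) ^ 2 ∂μ := by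
  set η := maPartial b ε h (t + h) with hηdef
  set P : Ω → ℝ := fun ω => ∑ j ∈ Finset.range m, c j * x (t - (j : ℤ)) ω with hPdef
  have hP := isLinearInPast_sum hxL t m c
  have hPY : MemLp (fun ω => P ω - Y ω) 2 μ := hP.1.sub hY.1
  have h0 : ∫ ω, η ω * (P ω - Y ω) ∂μ = 0 := by
    simp only [mul_sub]
    rw [integral_sub (integrable_mul_of_memLp_two hη hP.1) (integrable_mul_of_memLp_two hη hY.1),
      integral_forecast_error_mul hε hX hxL b h t hη hP,
      integral_forecast_error_mul hε hX hxL b h t hη hY, sub_zero]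
  have h1 : ∫ ω, (x (t + h) ω - Y ω) ^ 2 ∂μ =
      ∫ ω, (η ω ^ 2 + (2 * (η ω * (P ω - Y ω)) + (P ω - Y ω) ^ 2)) ∂μ := by
    refine integral_congr_ae ?_
    filter_upwards [hdec] with ω hω
    rw [hω]; ring
  have i1 : Integrable (fun ω => 2 * (η ω * (P ω - Y ω))) μ := (integrable_mul_of_memLp_two hη hPY).const_mul 2
  have i2 : Integrable (fun ω => 2 * (η ω * (P ω - Y ω)) + (P ω - Y ω) ^ 2) μ :=
    i1.add hPY.integrable_sq
  rw [h1, integral_add hη.integrable_sq i2, integral_add i1 hPY.integrable_sq, integral_const_mul,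
    h0]
  ring

/-- For `k ≥ p_h` the best linear predictor of `x_{t+h}` is a linear function of `k` lags. -/
lemma exists_direct_coeff [IsProbabilityMeasure μ] (hε : IsIIDNoise μ ε σ)
    (hx : IsStationaryAR μ p a ε x)
    (hX : ∀ t, x t =ᵐ[μ] maProcess (maCoeff p a) ε t) {K : ℝ} (hK : LpBound μ 2 (ε 1) K)
    {h k : ℕ} (hk : predictionOrder μ x h ≤ k) :
    1 ≤ k ∧ ∃ c : ℕ → ℝ, ∀ t : ℤ, ∀ᵐ ω ∂μ, x (t + h) ω =
      ∑ i ∈ Finset.range k, c i * x (t - (i : ℤ)) ω +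
        maPartial (maCoeff p a) ε h (t + h) ω := by
  obtain ⟨P, hP, hAP, -⟩ := exists_predictor_poly p a hx.one_le_order h
  have hP0 := predictor_poly_ne_zero hx.one_le_order hx.coeff_ne_zero hAP
  have hxL := hx.memLp
  have hdec : ∀ t : ℤ, ∀ᵐ ω ∂μ, x (t + h) ω = maPartial (maCoeff p a) ε h (t + h) ω +
      ∑ j ∈ Finset.range p, P.coeff j * x (t - (j : ℤ)) ω := by
    intro t
    filter_upwards [hx.lpBound_sub_maPartial hP hAP (t + h)] with ω hω
    simpa using hω
  have hη : ∀ t : ℤ, MemLp (maPartial (maCoeff p a) ε h (t + h)) 2 μ := fun t =>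
    memLp_finsetSum _ fun j _ => ((hε.lpBound hK _).memLp).const_mul _
  have hshift : ∀ (q : ℕ) (c : ℕ → ℝ) (t : ℤ) (ω : Ω),
      ∑ j ∈ Finset.Icc 1 q, c j * x (t + 1 - (j : ℤ)) ω =
        ∑ j ∈ Finset.range q, c (j + 1) * x (t - (j : ℤ)) ω := by
    intro q c t ω
    rw [Finset.range_eq_Ico, ← Finset.sum_Ico_add' (fun j => c j * x (t + 1 - (j : ℤ)) ω) 0 q 1
      |>.trans (Finset.sum_congr (by ext; simp) fun _ _ => rfl)]
    refine Finset.sum_congr rfl fun j _ => ?_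
    congr 2
    push_cast
    ring
  have hne : {q : ℕ | 1 ≤ q ∧ ∃ c : ℕ → ℝ, c q ≠ 0 ∧ ∀ t : ℤ,
      IsBestLinearPredictor μ x h t
        (fun ω => ∑ j ∈ Finset.Icc 1 q, c j * x (t + 1 - (j : ℤ)) ω)}.Nonempty := by
    -- The coefficient of the furthest lag is the leading coefficient of `P`, hence nonzero. The
    -- shift by one comes from numbering the lags from `1`.
    refine ⟨P.natDegree + 1, by omega, fun j => P.coeff (j - 1), ?_, fun t => ?_⟩
    · simpa using hP0
    have heq : (fun ω => ∑ j ∈ Finset.Icc 1 (P.natDegree + 1),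
        P.coeff (j - 1) * x (t + 1 - (j : ℤ)) ω) =
        fun ω => ∑ j ∈ Finset.range p, P.coeff j * x (t - (j : ℤ)) ω := by
      ext ω
      rw [hshift]
      refine Finset.sum_subset (Finset.range_mono (by omega)) fun j _ hj => ?_
      rw [Nat.add_sub_cancel, Polynomial.coeff_eq_zero_of_natDegree_lt, zero_mul]
      simpa [Nat.lt_succ_iff] using hj
    rw [heq]
    refine ⟨isLinearInPast_sum hxL t p _, fun Z hZ => ?_⟩
    rw [integral_sq_forecast hε hX hxL (hη t) (hdec t) (isLinearInPast_sum hxL t p _),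
      integral_sq_forecast hε hX hxL (hη t) (hdec t) hZ]
    have : 0 ≤ ∫ ω, (∑ j ∈ Finset.range p, P.coeff j * x (t - (j : ℤ)) ω - Z ω) ^ 2 ∂μ :=
      integral_nonneg fun ω => sq_nonneg _
    simpa using this
  -- Nonemptiness ensures that `predictionOrder` is attained and is not the default value `0` of
  -- `sInf`.
  obtain ⟨hq1, c, -, hbest⟩ := Nat.sInf_mem hne
  change predictionOrder μ x h ≤ k at hk
  set q := predictionOrder μ x h with hq
  -- The lags beyond the order receive coefficient zero.
  refine ⟨hq1.trans hk, fun i => if i < q then c (i + 1) else 0, fun t => ?_⟩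
  have hb := hbest t
  change IsBestLinearPredictor μ x h t
    (fun ω => ∑ j ∈ Finset.Icc 1 q, c j * x (t + 1 - (j : ℤ)) ω) at hb
  simp only [hshift] at hb
  -- Both predictors are optimal, so by Pythagoras their mean-square distance is zero.
  have hle := hb.2 _ (isLinearInPast_sum hxL t p P.coeff)
  rw [integral_sq_forecast hε hX hxL (hη t) (hdec t) hb.1,
    integral_sq_forecast hε hX hxL (hη t) (hdec t) (isLinearInPast_sum hxL t p _)] at hle
  simp only [sub_self, ne_eq, OfNat.ofNat_ne_zero, not_false_eq_true, zero_pow, integral_zero,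
    add_zero, add_le_iff_nonpos_right] at hle
  have hi : Integrable (fun ω => (∑ j ∈ Finset.range p, P.coeff j * x (t - (j : ℤ)) ω -
      ∑ j ∈ Finset.range q, c (j + 1) * x (t - (j : ℤ)) ω) ^ 2) μ :=
    ((isLinearInPast_sum hxL t p P.coeff).1.sub hb.1.1).integrable_sq
  have hz := (integral_eq_zero_iff_of_nonneg (fun ω => sq_nonneg _) hi).1
    (le_antisymm hle (integral_nonneg fun ω => sq_nonneg _))
  filter_upwards [hz, hdec t] with ω h1 h2
  have h3 : ∑ j ∈ Finset.range p, P.coeff j * x (t - (j : ℤ)) ω =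
      ∑ j ∈ Finset.range q, c (j + 1) * x (t - (j : ℤ)) ω := by
    simpa [sub_eq_zero] using h1
  rw [h2, h3, add_comm]
  congr 1
  rw [← Finset.sum_subset (Finset.range_mono hk)]
  · refine Finset.sum_congr rfl fun j hj => ?_
    rw [if_pos (Finset.mem_range.1 hj)]
  · intro j _ hj
    rw [if_neg (by simpa using hj), zero_mul]

end Prediction

end MultistepAR
end

noncomputable section
namespace MultistepAR

variable {Ω : Type*} [mΩ : MeasurableSpace Ω] {μ : Measure Ω} {ε : ℤ → Ω → ℝ} {σ : ℝ}

/-! ### Negative moments of one noise -/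

lemma measure_abs_add_le_of_holder [IsProbabilityMeasure μ] {X : Ω → ℝ} (hX : Measurable X)
    {α η M : ℝ}
    (hF : ∀ y z : ℝ, |y - z| < η → |cdf (μ.map X) y - cdf (μ.map X) z| ≤ M * |y - z| ^ α)
    {r : ℝ} (hr : 0 < r) (hrη : 3 * r < η) (c : ℝ) :
    μ {ω | |X ω + c| ≤ r} ≤ ENNReal.ofReal (M * (3 * r) ^ α) := by
  have : IsProbabilityMeasure (μ.map X) := Measure.isProbabilityMeasure_map hX.aemeasurable
  -- The distribution function measures half-open intervals. Moving the left end by a further `r`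
  -- includes the closed endpoint and makes the length `3 * r`.
  have hsub : {ω | |X ω + c| ≤ r} ⊆ X ⁻¹' Set.Ioc (-c - 2 * r) (-c + r) := by
    intro ω hω
    have := abs_le.1 (show |X ω + c| ≤ r from hω)
    constructor <;> linarith [this.1, this.2]
  calc μ {ω | |X ω + c| ≤ r} ≤ μ (X ⁻¹' Set.Ioc (-c - 2 * r) (-c + r)) := measure_mono hsub
    _ = (μ.map X) (Set.Ioc (-c - 2 * r) (-c + r)) := (Measure.map_apply hX measurableSet_Ioc).symm
    _ = ENNReal.ofReal (cdf (μ.map X) (-c + r) - cdf (μ.map X) (-c - 2 * r)) := by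
      conv_lhs => rw [← measure_cdf (μ.map X)]
      rw [StieltjesFunction.measure_Ioc]
    _ ≤ ENNReal.ofReal (M * (3 * r) ^ α) := by
      refine ENNReal.ofReal_le_ofReal ?_
      have h3 : -c + r - (-c - 2 * r) = 3 * r := by ring
      have h3' : |3 * r| = 3 * r := abs_of_pos (by positivity)
      have := hF (-c + r) (-c - 2 * r) (by rw [h3, h3']; exact hrη)
      rw [h3, h3'] at this
      exact (le_abs_self _).trans this

/-- Dyadic layers: if `0 < |y| < r`, then `|y|` lies between `r 2^{-(n+1)}` and `r 2^{-n}` for some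
`n`. At `y = 0` both sides are `⊤`: all the indicators equal one and the weights are bounded below.
-/
lemma enorm_rpow_neg_le_tsum {r τ : ℝ} (hr : 0 < r) (hτ : 0 < τ) (y : ℝ) :
    ‖y‖ₑ ^ (-τ) ≤ ENNReal.ofReal (r ^ (-τ)) +
      ∑' n : ℕ, ENNReal.ofReal ((r * (1 / 2) ^ (n + 1)) ^ (-τ)) *
        Set.indicator {z : ℝ | |z| ≤ r * (1 / 2) ^ n} 1 y := by
  have hrpow : ∀ {s : ℝ}, 0 < s → s ≤ |y| → ‖y‖ₑ ^ (-τ) ≤ ENNReal.ofReal (s ^ (-τ)) := by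
    intro s hs hsy
    rw [← ENNReal.ofReal_rpow_of_pos hs, ENNReal.rpow_neg, ENNReal.rpow_neg]
    refine ENNReal.inv_le_inv.2 (ENNReal.rpow_le_rpow ?_ hτ.le)
    rw [Real.enorm_eq_ofReal_abs]
    exact ENNReal.ofReal_le_ofReal hsy
  rcases le_or_gt r |y| with h | h
  · exact (hrpow hr h).trans le_self_add
  rcases eq_or_ne y 0 with rfl | hy
  · refine le_of_le_of_eq le_top (Eq.symm ?_)
    rw [ENNReal.add_eq_top]
    right
    refine top_le_iff.1 ((ENNReal.tsum_const_eq_top_of_ne_zero (α := ℕ)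
      (c := ENNReal.ofReal (r ^ (-τ))) ?_).symm.le.trans (ENNReal.tsum_le_tsum fun n => ?_))
    · rw [Ne, ENNReal.ofReal_eq_zero, not_le]; positivity
    · rw [Set.indicator_of_mem (by simp; positivity), Pi.one_apply, mul_one]
      refine ENNReal.ofReal_le_ofReal (Real.rpow_le_rpow_of_nonpos (by positivity) ?_ (by linarith))
      have : ((1 : ℝ) / 2) ^ (n + 1) ≤ 1 := pow_le_one₀ (by norm_num) (by norm_num)
      nlinarith
  · obtain ⟨n, hn1, hn2⟩ := exists_nat_pow_near_of_lt_one (x := |y| / r) (y := 1 / 2)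
      (by positivity) ((div_lt_one hr).2 h).le (by norm_num) (by norm_num)
    refine le_trans ?_ (le_add_left (ENNReal.le_tsum n))
    rw [Set.indicator_of_mem, Pi.one_apply, mul_one]
    · refine hrpow (by positivity) ?_
      rw [lt_div_iff₀ hr] at hn1
      linarith
    · change |y| ≤ _
      rw [div_le_iff₀ hr] at hn2
      linarith

/-- Under the Hölder condition some negative power of `|X + c|` has an expectation bounded
uniformly in `c`. -/
lemma exists_lintegral_rpow_neg_le [IsProbabilityMeasure μ] {X : Ω → ℝ} (hX : Measurable X)
    (hF : HolderDistribution fun u => cdf (μ.map X) u) :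
    ∃ τ₀ : ℝ, 0 < τ₀ ∧ ∃ D : ENNReal, D ≠ ⊤ ∧ ∀ c : ℝ, ∫⁻ ω, ‖X ω + c‖ₑ ^ (-τ₀) ∂μ ≤ D := by
  obtain ⟨α, η, M, hα, hη, hM, hF⟩ := hF
  -- This choice gives `3 * r < η`. With `τ = α / 2` the `n`-th layer contributes a multiple of
  -- `2^{nτ} · 2^{-nα} = 2^{-nτ}`, which is summable.
  set r := η / 4 with hr
  have hr0 : 0 < r := by positivity
  set τ := α / 2 with hτ
  have hτ0 : 0 < τ := by positivity
  set ρ : ℝ := (1 / 2 : ℝ) ^ τ with hρ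
  have hρ0 : 0 < ρ := by positivity
  have hρ1 : ρ < 1 := Real.rpow_lt_one (by norm_num) (by norm_num) hτ0
  set B : ℝ := (r * (1 / 2)) ^ (-τ) * (M * (3 * r) ^ α) with hB
  have hB0 : 0 ≤ B := by positivity
  refine ⟨τ, hτ0, ENNReal.ofReal (r ^ (-τ)) + ∑' n : ℕ, ENNReal.ofReal (B * ρ ^ n), ?_, fun c => ?_⟩
  · rw [← ENNReal.ofReal_tsum_of_nonneg (fun n => by positivity)
      ((summable_geometric_of_lt_one hρ0.le hρ1).mul_left B)]
    exact ENNReal.add_ne_top.2 ⟨ENNReal.ofReal_ne_top, ENNReal.ofReal_ne_top⟩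
  · have hms : ∀ n : ℕ, MeasurableSet {z : ℝ | |z| ≤ r * (1 / 2) ^ n} := fun n =>
      measurableSet_le measurable_abs measurable_const
    have hXc : Measurable fun ω => X ω + c := hX.add_const c
    have hind : ∀ n : ℕ, Measurable fun ω => (Set.indicator {z : ℝ | |z| ≤ r * (1 / 2) ^ n} 1
        (X ω + c) : ENNReal) := fun n => (measurable_one.indicator (hms n)).comp hXc
    refine (lintegral_mono fun ω => enorm_rpow_neg_le_tsum hr0 hτ0 (X ω + c)).trans ?_
    rw [lintegral_add_left measurable_const, lintegral_const, measure_univ, mul_one,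
      lintegral_tsum fun n => ((hind n).const_mul _).aemeasurable]
    refine add_le_add le_rfl (ENNReal.tsum_le_tsum fun n => ?_)
    rw [lintegral_const_mul _ (hind n)]
    have h1 : ∫⁻ ω, Set.indicator {z : ℝ | |z| ≤ r * (1 / 2) ^ n} 1 (X ω + c) ∂μ =
        μ {ω | |X ω + c| ≤ r * (1 / 2) ^ n} := by
      have hm : MeasurableSet {ω | |X ω + c| ≤ r * (1 / 2) ^ n} :=
        measurableSet_le (measurable_abs.comp hXc) measurable_const
      rw [← lintegral_indicator_one hm]
      rfl
    have hpow : ((1 : ℝ) / 2) ^ n ≤ 1 := pow_le_one₀ (by norm_num) (by norm_num)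
    have h2 := measure_abs_add_le_of_holder (μ := μ) hX hF (r := r * (1 / 2) ^ n)
      (by positivity) (by rw [hr] at hr0 ⊢; nlinarith) c
    rw [h1]
    refine (mul_le_mul_right h2 _).trans ?_
    rw [← ENNReal.ofReal_mul (by positivity)]
    refine ENNReal.ofReal_le_ofReal (le_of_eq ?_)
    have e1 : (r * (1 / 2) ^ (n + 1)) ^ (-τ) = (r * (1 / 2)) ^ (-τ) * (ρ ^ n)⁻¹ := by
      rw [pow_succ', ← mul_assoc, Real.mul_rpow (by positivity) (by positivity), hρ,
        ← Real.rpow_natCast ((1 / 2 : ℝ) ^ τ), ← Real.rpow_mul (by norm_num),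
        ← Real.rpow_neg (by norm_num), ← Real.rpow_natCast, ← Real.rpow_mul (by norm_num)]
      congr 2; ring
    have e2 : (3 * (r * (1 / 2) ^ n)) ^ α = (3 * r) ^ α * (ρ ^ n * ρ ^ n) := by
      rw [← mul_assoc, Real.mul_rpow (by positivity) (by positivity), ← pow_add, hρ,
        ← Real.rpow_natCast ((1 / 2 : ℝ) ^ τ), ← Real.rpow_mul (by norm_num),
        ← Real.rpow_natCast, ← Real.rpow_mul (by norm_num)]
      congr 2; push_cast; rw [hτ]; ring
    rw [e1, e2, hB]
    field_simp

lemma enorm_rpow_neg_le_one_add {τ τ₀ : ℝ} (hτ : 0 < τ) (h : τ ≤ τ₀) (y : ℝ) :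
    ‖y‖ₑ ^ (-τ) ≤ 1 + ‖y‖ₑ ^ (-τ₀) := by
  rw [ENNReal.rpow_neg, ENNReal.rpow_neg]
  rcases le_total 1 ‖y‖ₑ with h1 | h1
  · exact (ENNReal.inv_le_one.2 (ENNReal.one_le_rpow h1 hτ)).trans le_self_add
  · exact (ENNReal.inv_le_inv.2 (ENNReal.rpow_le_rpow_of_exponent_ge h1 h)).trans le_add_self

/-! ### Negative moments of determinants -/

/-- Integrate over `X` first, with `Y` and `Z` fixed: `|XY + Z| = |Y| |X + Z / Y|`, and the bound
`D` is uniform in the shift `Z / Y`. Where `Y = 0` the right-hand integrand is `⊤`, since `D ≠ 0`.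
-/
lemma lintegral_affine_rpow_neg_le [IsProbabilityMeasure μ] (hε : ∀ t, Measurable (ε t))
    (hi : iIndepFun ε μ) {S T : Set ℤ} (hST : Disjoint S T) {X Y Z : Ω → ℝ}
    (hX : Measurable[noiseSigma ε S] X) (hY : Measurable[noiseSigma ε T] Y)
    (hZ : Measurable[noiseSigma ε T] Z) {τ : ℝ} {D : ENNReal} (hτ : 0 < τ)
    (hD0 : D ≠ 0) (hD : ∀ c : ℝ, ∫⁻ ω, ‖X ω + c‖ₑ ^ (-τ) ∂μ ≤ D) :
    ∫⁻ ω, ‖X ω * Y ω + Z ω‖ₑ ^ (-τ) ∂μ ≤ D * ∫⁻ ω, ‖Y ω‖ₑ ^ (-τ) ∂μ := by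
  have hXm := measurable_of_noiseSigma hε hX
  have hYm := measurable_of_noiseSigma hε hY
  have hZm := measurable_of_noiseSigma hε hZ
  have hind : IndepFun (fun ω => (Y ω, Z ω)) X μ :=
    indepFun_of_noiseSigma hε hi hST.symm (hY.prodMk hZ) hX
  have hmap := (indepFun_iff_map_prod_eq_prod_map_map (hYm.prodMk hZm).aemeasurable
    hXm.aemeasurable).1 hind
  set φ : (ℝ × ℝ) × ℝ → ENNReal := fun w => ‖w.2 * w.1.1 + w.1.2‖ₑ ^ (-τ) with hφ
  have hφm : Measurable φ := by
    have : Measurable fun w : (ℝ × ℝ) × ℝ => w.2 * w.1.1 + w.1.2 := by fun_prop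
    exact this.enorm.pow_const _
  have h1 : ∫⁻ ω, ‖X ω * Y ω + Z ω‖ₑ ^ (-τ) ∂μ =
      ∫⁻ w, φ w ∂(μ.map fun ω => ((Y ω, Z ω), X ω)) := by
    rw [lintegral_map hφm ((hYm.prodMk hZm).prodMk hXm)]
  have : IsProbabilityMeasure (μ.map X) := Measure.isProbabilityMeasure_map hXm.aemeasurable
  rw [h1, hmap, lintegral_prod _ hφm.aemeasurable, lintegral_map
    (hφm.lintegral_prod_right') (hYm.prodMk hZm), ← lintegral_const_mul _ (hYm.enorm.pow_const _)]
  refine lintegral_mono fun ω => ?_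
  have hφw : Measurable fun y => φ ((Y ω, Z ω), y) := hφm.comp measurable_prodMk_left
  rw [lintegral_map hφw hXm]
  rcases eq_or_ne (Y ω) 0 with h0 | h0
  · rw [h0, enorm_zero, ENNReal.zero_rpow_of_neg (by linarith), ENNReal.mul_top hD0]
    exact le_top
  · have h2 : ∀ ω', φ ((Y ω, Z ω), X ω') = ‖Y ω‖ₑ ^ (-τ) * ‖X ω' + Z ω / Y ω‖ₑ ^ (-τ) := by
      intro ω'
      rw [← ENNReal.mul_rpow_of_ne_top (by simp) (by simp), ← enorm_mul]
      simp only [hφ]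
      congr 2
      field_simp
    simp only [h2]
    rw [lintegral_const_mul _ ((hXm.add_const _).enorm.pow_const _), mul_comm D]
    gcongr
    exact hD _

lemma measurable_matrix_det {α : Type*} [MeasurableSpace α] {k : ℕ}
    {A : α → Matrix (Fin k) (Fin k) ℝ} (hA : ∀ i j, Measurable fun w => A w i j) :
    Measurable fun w => (A w).det := by
  simp only [Matrix.det_apply]
  refine Finset.measurable_sum _ fun s _ => ?_
  exact (Finset.measurable_prod _ fun i _ => hA _ _).const_smul _

/-- The square matrix of the noises with times `f i j`. -/
def noiseMatrix (ε : ℤ → Ω → ℝ) {k : ℕ} (f : Fin k → Fin k → ℤ) (ω : Ω) :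
    Matrix (Fin k) (Fin k) ℝ := Matrix.of fun i j => ε (f i j) ω

/-- Expanded along the first row, the determinant is affine in its corner entry with the corner
minor as slope. The entries are distinct noises, so slope and intercept are independent of the
corner; each step of the induction costs a factor `D`. -/
lemma lintegral_det_rpow_neg_le [IsProbabilityMeasure μ] (hε : ∀ t, Measurable (ε t))
    (hi : iIndepFun ε μ) {τ : ℝ} {D : ENNReal} (hτ : 0 < τ)
    (hD0 : D ≠ 0) (hD : ∀ (t : ℤ) (c : ℝ), ∫⁻ ω, ‖ε t ω + c‖ₑ ^ (-τ) ∂μ ≤ D) {k : ℕ}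
    (f : Fin k → Fin k → ℤ) (hf : ∀ i j i' j', f i j = f i' j' → i = i' ∧ j = j') :
    ∫⁻ ω, ‖(noiseMatrix ε f ω).det‖ₑ ^ (-τ) ∂μ ≤ D ^ k := by
  induction k with
  | zero => simp
  | succ k ih =>
    set T : Set ℤ := {t | t ≠ f 0 0} with hT
    have hmin : ∀ j : Fin (k + 1), Measurable[noiseSigma ε T] fun ω =>
        ((noiseMatrix ε f ω).submatrix Fin.succ j.succAbove).det := by
      intro j
      refine @measurable_matrix_det Ω (noiseSigma ε T) k _ fun i l => ?_
      refine measurable_noise (S := T) (i := f i.succ (j.succAbove l)) ?_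
      intro h
      exact Fin.succ_ne_zero i (hf _ _ _ _ h).1
    have hexp : ∀ ω, (noiseMatrix ε f ω).det = ε (f 0 0) ω *
        (noiseMatrix ε (fun i j => f i.succ j.succ) ω).det +
        ∑ j : Fin k, (-1) ^ ((j.succ : Fin (k + 1)) : ℕ) * ε (f 0 j.succ) ω *
          ((noiseMatrix ε f ω).submatrix Fin.succ j.succ.succAbove).det := by
      intro ω
      rw [Matrix.det_succ_row_zero, Fin.sum_univ_succ]
      congr 1
      simp only [Fin.val_zero, pow_zero, one_mul, Fin.succAbove_zero]
      rfl
    simp only [hexp]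
    refine (lintegral_affine_rpow_neg_le hε hi (S := {f 0 0}) (T := T) ?_ (measurable_noise rfl)
      ?_ ?_ hτ hD0 (hD _)).trans ?_
    · simp [hT]
    · have := hmin 0
      simp only [Fin.succAbove_zero] at this
      exact this
    · refine Finset.measurable_sum _ fun j _ => Measurable.mul (Measurable.const_mul ?_ _) (hmin _)
      refine measurable_noise (S := T) ?_
      intro h
      exact Fin.succ_ne_zero j (hf _ _ _ _ h).2
    · rw [pow_succ']
      gcongr
      refine ih _ fun i j i' j' h => ?_
      simpa using hf _ _ _ _ h

end MultistepAR
end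

noncomputable section
namespace MultistepAR

variable {Ω : Type*} [mΩ : MeasurableSpace Ω] {μ : Measure Ω} {ε : ℤ → Ω → ℝ} {σ : ℝ}

/-! ### A lower bound for the least singular value of a matrix -/

/-- A lower bound for the least eigenvalue of `Aᵀ A`. -/
def eigenLower {k : ℕ} (A : Matrix (Fin k) (Fin k) ℝ) : ℝ :=
  A.det ^ 2 / (1 + ∑ i, ∑ j, A.adjugate i j ^ 2)

lemma one_add_adjugate_pos {k : ℕ} (A : Matrix (Fin k) (Fin k) ℝ) :
    0 < 1 + ∑ i, ∑ j, A.adjugate i j ^ 2 := by positivity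

lemma eigenLower_nonneg {k : ℕ} (A : Matrix (Fin k) (Fin k) ℝ) : 0 ≤ eigenLower A :=
  div_nonneg (sq_nonneg _) (one_add_adjugate_pos A).le

lemma dotProduct_mulVec_self_le {k : ℕ} (B : Matrix (Fin k) (Fin k) ℝ) (w : Fin k → ℝ) :
    (B *ᵥ w) ⬝ᵥ (B *ᵥ w) ≤ (∑ i, ∑ j, B i j ^ 2) * (w ⬝ᵥ w) := by
  simp only [dotProduct, Matrix.mulVec]
  rw [Finset.sum_mul]
  refine Finset.sum_le_sum fun i _ => ?_
  have := Finset.sum_mul_sq_le_sq_mul_sq Finset.univ (fun j => B i j) w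
  simpa [sq] using this

/-- From `det A • v = adj A (A v)` and the Frobenius bound for the adjugate. The `1 +` in the
denominator excludes division by zero. -/
lemma eigenLower_mul_le {k : ℕ} (A : Matrix (Fin k) (Fin k) ℝ) (v : Fin k → ℝ) :
    eigenLower A * (v ⬝ᵥ v) ≤ (A *ᵥ v) ⬝ᵥ (A *ᵥ v) := by
  have h1 : A.adjugate *ᵥ (A *ᵥ v) = A.det • v := by
    rw [Matrix.mulVec_mulVec, Matrix.adjugate_mul, Matrix.smul_mulVec, Matrix.one_mulVec]
  have h2 := dotProduct_mulVec_self_le A.adjugate (A *ᵥ v)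
  rw [h1, smul_dotProduct, dotProduct_smul] at h2
  have h3 : 0 ≤ (A *ᵥ v) ⬝ᵥ (A *ᵥ v) := Finset.sum_nonneg fun i _ => mul_self_nonneg _
  rw [eigenLower, div_mul_eq_mul_div, div_le_iff₀ (one_add_adjugate_pos A)]
  simp only [smul_eq_mul] at h2
  nlinarith

lemma abs_adjugate_le {k : ℕ} (A : Matrix (Fin k) (Fin k) ℝ) {Q : ℝ} (hQ : 1 ≤ Q)
    (hA : ∀ i j, |A i j| ≤ Q) (i j : Fin k) : |A.adjugate i j| ≤ (k.factorial : ℝ) * Q ^ k := by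
  rw [Matrix.adjugate_apply]
  have := Matrix.det_le (A := A.updateRow j (Pi.single i 1)) (abv := AbsoluteValue.abs) (x := Q) ?_
  · simpa using this
  · intro r s
    rw [AbsoluteValue.abs_apply, Matrix.updateRow_apply]
    split_ifs
    · rw [Pi.single_apply]
      split_ifs <;> simp <;> linarith
    · exact hA r s

lemma measurable_eigenLower {α : Type*} [MeasurableSpace α] {k : ℕ}
    {A : α → Matrix (Fin k) (Fin k) ℝ} (hA : ∀ i j, Measurable fun w => A w i j) :
    Measurable fun w => eigenLower (A w) := by
  refine ((measurable_matrix_det hA).pow_const 2).div (measurable_const.add ?_)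
  refine Finset.measurable_sum _ fun i _ => Finset.measurable_sum _ fun j _ => ?_
  refine Measurable.pow_const ?_ 2
  simp only [Matrix.adjugate_apply]
  refine measurable_matrix_det fun r s => ?_
  simp only [Matrix.updateRow_apply]
  split_ifs
  · exact measurable_const
  · exact hA r s

/-- With `W` the denominator, the left side is `W^τ |det A|^{-2τ}`, at most the sum of the squares
of its factors. `W` grows like `Q ^ (2 * k)`, and `4 * k * τ ≤ 1` makes `W^{2τ}` at most linear in
`Q`, so a first moment of the entries suffices. -/
lemma enorm_eigenLower_rpow_neg_le {k : ℕ} (A : Matrix (Fin k) (Fin k) ℝ) {τ Q : ℝ} (hτ : 0 < τ)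
    (hτk : 4 * k * τ ≤ 1) (hQ : 1 ≤ Q) (hA : ∀ i j, |A i j| ≤ Q) :
    ‖eigenLower A‖ₑ ^ (-τ) ≤
      ENNReal.ofReal ((1 + (k * k) * (k.factorial : ℝ) ^ 2) ^ (2 * τ) * Q) +
        ‖A.det‖ₑ ^ (-(4 * τ)) := by
  set W := 1 + ∑ i, ∑ j, A.adjugate i j ^ 2 with hW
  have hW0 : 0 < W := one_add_adjugate_pos A
  have hWle : W ≤ (1 + (k * k) * (k.factorial : ℝ) ^ 2) * Q ^ (2 * k) := by
    have h1 : ∑ i, ∑ j, A.adjugate i j ^ 2 ≤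
        ∑ _i : Fin k, ∑ _j : Fin k, ((k.factorial : ℝ) * Q ^ k) ^ 2 := by
      refine Finset.sum_le_sum fun i _ => Finset.sum_le_sum fun j _ => ?_
      rw [← sq_abs]
      have := abs_adjugate_le A hQ hA i j
      gcongr
    simp only [Finset.sum_const, Finset.card_univ, Fintype.card_fin, nsmul_eq_mul] at h1
    have h2 : 1 ≤ Q ^ (2 * k) := one_le_pow₀ hQ
    have h3 : (Q ^ k) ^ 2 = Q ^ (2 * k) := by rw [← pow_mul, mul_comm]
    rw [mul_pow, h3] at h1
    rw [hW]
    nlinarith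
  have hWτ : W ^ (2 * τ) ≤ (1 + (k * k) * (k.factorial : ℝ) ^ 2) ^ (2 * τ) * Q := by
    calc W ^ (2 * τ) ≤ ((1 + (k * k) * (k.factorial : ℝ) ^ 2) * Q ^ (2 * k)) ^ (2 * τ) := by
          gcongr
      _ = (1 + (k * k) * (k.factorial : ℝ) ^ 2) ^ (2 * τ) * (Q ^ (2 * k)) ^ (2 * τ) :=
          Real.mul_rpow (by positivity) (by positivity)
      _ ≤ _ := by
          gcongr
          rw [← Real.rpow_natCast, ← Real.rpow_mul (by linarith)]
          calc Q ^ (((2 * k : ℕ) : ℝ) * (2 * τ)) ≤ Q ^ (1 : ℝ) :=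
                Real.rpow_le_rpow_of_exponent_le hQ (by push_cast; linarith)
            _ = Q := Real.rpow_one Q
  rcases eq_or_ne A.det 0 with h0 | h0
  · rw [h0, enorm_zero, ENNReal.zero_rpow_of_neg (by linarith), add_top]
    exact le_top
  · have hd : 0 < |A.det| := abs_pos.2 h0
    have hpos : 0 < eigenLower A := by
      rw [eigenLower]; positivity
    have e1 : ‖eigenLower A‖ₑ ^ (-τ) = ENNReal.ofReal (W ^ τ * |A.det| ^ (-(2 * τ))) := by
      rw [Real.enorm_eq_ofReal hpos.le, ENNReal.ofReal_rpow_of_pos hpos]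
      congr 1
      rw [eigenLower, ← hW, ← sq_abs, Real.div_rpow (by positivity) hW0.le, Real.rpow_neg hW0.le,
        ← Real.rpow_natCast |A.det| 2, ← Real.rpow_mul hd.le, div_inv_eq_mul, mul_comm]
      congr 2; push_cast; ring
    have e2 : ‖A.det‖ₑ ^ (-(4 * τ)) = ENNReal.ofReal (|A.det| ^ (-(4 * τ))) := by
      rw [Real.enorm_eq_ofReal_abs, ENNReal.ofReal_rpow_of_pos hd]
    rw [e1, e2, ← ENNReal.ofReal_add (by positivity) (by positivity)]
    refine ENNReal.ofReal_le_ofReal ?_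
    refine le_trans ?_ (add_le_add_left hWτ _)
    have s1 : W ^ (2 * τ) = (W ^ τ) ^ 2 := by
      rw [← Real.rpow_natCast, ← Real.rpow_mul hW0.le]; congr 1; push_cast; ring
    have s2 : |A.det| ^ (-(4 * τ)) = (|A.det| ^ (-(2 * τ))) ^ 2 := by
      rw [← Real.rpow_natCast, ← Real.rpow_mul hd.le]; congr 1; push_cast; ring
    rw [s1, s2]
    nlinarith [sq_nonneg (W ^ τ - |A.det| ^ (-(2 * τ))), sq_nonneg (W ^ τ),
      sq_nonneg (|A.det| ^ (-(2 * τ)))]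

/-- Small negative powers of `eigenLower` of a noise matrix have bounded expectation. -/
lemma exists_lintegral_eigenLower_le [IsProbabilityMeasure μ] (hε : IsIIDNoise μ ε σ)
    (hF : HolderDistribution fun u => cdf (μ.map (ε 1)) u) (k : ℕ) :
    ∃ τ₁ : ℝ, 0 < τ₁ ∧ ∃ D : ENNReal, D ≠ ⊤ ∧ ∀ τ : ℝ, 0 < τ → τ ≤ τ₁ →
      ∀ f : Fin k → Fin k → ℤ, (∀ i j i' j', f i j = f i' j' → i = i' ∧ j = j') →
        ∫⁻ ω, ‖eigenLower (noiseMatrix ε f ω)‖ₑ ^ (-τ) ∂μ ≤ D := by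
  obtain ⟨τ₀, hτ₀, D₀, hD₀, hD⟩ := exists_lintegral_rpow_neg_le (hε.measurable 1) hF
  have hK := LpBound.of_memLp (memLp_one_iff_integrable.2 hε.integrable)
  set K := (eLpNorm (ε 1) 1 μ).toReal
  set E : ℝ := (1 + (k * k) * (k.factorial : ℝ) ^ 2) with hE
  have hE1 : 1 ≤ E := by rw [hE]; linarith [show 0 ≤ (k * k) * (k.factorial : ℝ) ^ 2 by positivity]
  -- `τ₀ / 4` serves the exponent `4 * τ` on the determinant; the second term serves the linear
  -- bound in `Q`, with `k + 1` to allow `k = 0`. The constant `1 + D₀` is nonzero and covers all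
  -- exponents up to `τ₀`.
  refine ⟨min (τ₀ / 4) (1 / (4 * (k + 1))), by positivity,
    ENNReal.ofReal (E * (1 + k * (k * K))) + (1 + D₀) ^ k,
    ENNReal.add_ne_top.2 ⟨ENNReal.ofReal_ne_top, ENNReal.pow_ne_top (by simp [hD₀])⟩,
    fun τ hτ hτ₁ f hf => ?_⟩
  have hτa : 4 * τ ≤ τ₀ := by linarith [hτ₁.trans (min_le_left _ _)]
  have hτb : 4 * (k + 1) * τ ≤ 1 := by
    have := hτ₁.trans (min_le_right _ _)
    rw [le_div_iff₀ (by positivity)] at this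
    linarith
  have hk0 : (0 : ℝ) ≤ k := by positivity
  have hτk : 4 * k * τ ≤ 1 := by nlinarith
  have hEτ : E ^ (2 * τ) ≤ E := by
    calc E ^ (2 * τ) ≤ E ^ (1 : ℝ) := Real.rpow_le_rpow_of_exponent_le hE1 (by nlinarith)
      _ = E := Real.rpow_one E
  set Q : Ω → ℝ := fun ω => 1 + ∑ i, ∑ j, |ε (f i j) ω| with hQ
  have hQm : Measurable Q := measurable_const.add (Finset.measurable_sum _ fun i _ =>
    Finset.measurable_sum _ fun j _ => (hε.measurable _).abs)
  have hQ1 : ∀ ω, 1 ≤ Q ω := fun ω => by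
    have : 0 ≤ ∑ i, ∑ j, |ε (f i j) ω| := by positivity
    simp only [hQ]; linarith
  have hQA : ∀ ω i j, |noiseMatrix ε f ω i j| ≤ Q ω := by
    intro ω i j
    have h1 : |ε (f i j) ω| ≤ ∑ j, |ε (f i j) ω| :=
      Finset.single_le_sum (f := fun j => |ε (f i j) ω|) (fun _ _ => abs_nonneg _)
        (Finset.mem_univ j)
    have h2 : ∑ j, |ε (f i j) ω| ≤ ∑ i, ∑ j, |ε (f i j) ω| :=
      Finset.single_le_sum (f := fun i => ∑ j, |ε (f i j) ω|)
        (fun _ _ => Finset.sum_nonneg fun _ _ => abs_nonneg _) (Finset.mem_univ i)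
    change |ε (f i j) ω| ≤ 1 + _
    linarith
  refine (lintegral_mono fun ω => enorm_eigenLower_rpow_neg_le (noiseMatrix ε f ω) hτ hτk (hQ1 ω)
    (hQA ω)).trans ?_
  rw [lintegral_add_left (hQm.const_mul _).ennreal_ofReal]
  refine add_le_add ?_ ?_
  · have hint : ∀ i j : Fin k, Integrable (fun ω => |ε (f i j) ω|) μ := fun i j =>
      (hε.lpBound hK (f i j)).integrable.abs
    have hQi : Integrable Q μ := (integrable_const _).add
      (integrable_finsetSum _ fun i _ => integrable_finsetSum _ fun j _ => hint i j)
    rw [← ofReal_integral_eq_lintegral_ofReal (hQi.const_mul _)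
      (.of_forall fun ω => mul_nonneg (by positivity) (by linarith [hQ1 ω]))]
    refine ENNReal.ofReal_le_ofReal ?_
    rw [integral_const_mul]
    have hle : ∫ ω, Q ω ∂μ ≤ 1 + k * (k * K) := by
      simp only [hQ]
      rw [integral_add (integrable_const _)
        (integrable_finsetSum _ fun i _ => integrable_finsetSum _ fun j _ => hint i j),
        integral_finsetSum _ fun i _ => integrable_finsetSum _ fun j _ => hint i j]
      simp only [integral_const, probReal_univ, one_smul]
      have h1 : ∀ i : Fin k, ∫ ω, ∑ j, |ε (f i j) ω| ∂μ ≤ k * K := by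
        intro i
        rw [integral_finsetSum _ fun j _ => hint i j]
        refine (Finset.sum_le_sum fun j _ => (hε.lpBound hK (f i j)).integral_abs_le).trans ?_
        simp
      have h2 := Finset.sum_le_sum fun (i : Fin k) (_ : i ∈ Finset.univ) => h1 i
      simp only [Finset.sum_const, Finset.card_univ, Fintype.card_fin, nsmul_eq_mul] at h2
      linarith
    have h0 : 0 ≤ ∫ ω, Q ω ∂μ := integral_nonneg fun ω => zero_le_one.trans (hQ1 ω)
    exact mul_le_mul hEτ hle h0 (by linarith)
  · refine lintegral_det_rpow_neg_le hε.measurable hε.indep (by linarith) (by simp) ?_ f hf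
    intro t c
    have h1 : ∫⁻ ω, ‖ε t ω + c‖ₑ ^ (-(4 * τ)) ∂μ = ∫⁻ ω, ‖ε 1 ω + c‖ₑ ^ (-(4 * τ)) ∂μ :=
      ((hε.identDistrib t).comp (u := fun y : ℝ => ‖y + c‖ₑ ^ (-(4 * τ)))
        ((measurable_id.add_const c).enorm.pow_const _)).lintegral_eq
    rw [h1]
    refine (lintegral_mono fun ω => enorm_rpow_neg_le_one_add (τ₀ := τ₀) (by linarith) hτa _).trans ?_
    rw [lintegral_add_left measurable_const]
    simp only [lintegral_const, measure_univ, mul_one]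
    exact add_le_add le_rfl (hD c)

/-! ### Sums over disjoint groups of noises -/

lemma lintegral_prod_le_of_disjoint [IsProbabilityMeasure μ] (hε : ∀ t, Measurable (ε t))
    (hi : iIndepFun ε μ) {ι : Type*} (I : Finset ι) {Y : ι → Ω → ENNReal} {S : ι → Set ℤ}
    {D : ENNReal} (hmeas : ∀ i ∈ I, Measurable[noiseSigma ε (S i)] (Y i))
    (hdisj : ∀ i ∈ I, ∀ j ∈ I, i ≠ j → Disjoint (S i) (S j))
    (hD : ∀ i ∈ I, ∫⁻ ω, Y i ω ∂μ ≤ D) :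
    ∫⁻ ω, ∏ i ∈ I, Y i ω ∂μ ≤ D ^ I.card := by
  classical
  induction I using Finset.induction_on with
  | empty => simp
  | insert i I hiI ih =>
    have hii := Finset.mem_insert_self i I
    have hZm : Measurable[noiseSigma ε (⋃ j ∈ I, S j)] fun ω => ∏ j ∈ I, Y j ω := by
      refine Finset.measurable_prod _ fun j hj => ?_
      exact (hmeas j (Finset.mem_insert_of_mem hj)).mono
        (noiseSigma_mono (Set.subset_biUnion_of_mem (u := fun j => S j) hj)) le_rfl
    have hST : Disjoint (S i) (⋃ j ∈ I, S j) := by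
      rw [Set.disjoint_iUnion₂_right]
      intro j hj
      exact hdisj i hii j (Finset.mem_insert_of_mem hj) (by rintro rfl; exact hiI hj)
    simp only [Finset.prod_insert hiI]
    rw [lintegral_mul_eq_lintegral_mul_lintegral_of_independent_measurableSpace
      (noiseSigma_le hε _) (noiseSigma_le hε _) (indep_noiseSigma hε hi hST) (hmeas i hii) hZm,
      Finset.card_insert_of_notMem hiI, pow_succ']
    exact mul_le_mul' (hD i hii) (ih (fun j hj => hmeas j (Finset.mem_insert_of_mem hj))
      (fun j hj l hl => hdisj j (Finset.mem_insert_of_mem hj) l (Finset.mem_insert_of_mem hl))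
      (fun j hj => hD j (Finset.mem_insert_of_mem hj)))

/-- Every `Y i` is at most the sum, so the sum to the power `-q` is at most the product of the `Y i
^ (-q / |I|)`. Independence factorises the expectation: enough groups turn a small negative moment
into one of order `q`. -/
lemma lpBound_inv_sum_of_disjoint [IsProbabilityMeasure μ] (hε : ∀ t, Measurable (ε t))
    (hi : iIndepFun ε μ) {ι : Type*} (I : Finset ι) {Y : ι → Ω → ℝ} {S : ι → Set ℤ}
    {D : ENNReal} (hDtop : D ≠ ⊤) {q : ℕ} (hq : q ≠ 0) (hI : I.Nonempty)
    (hmeas : ∀ i ∈ I, Measurable[noiseSigma ε (S i)] (Y i))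
    (hdisj : ∀ i ∈ I, ∀ j ∈ I, i ≠ j → Disjoint (S i) (S j)) (h0 : ∀ i ∈ I, ∀ ω, 0 ≤ Y i ω)
    (hD : ∀ i ∈ I, ∫⁻ ω, ‖Y i ω‖ₑ ^ (-((q : ℝ) / I.card)) ∂μ ≤ D) :
    (∀ᵐ ω ∂μ, 0 < ∑ i ∈ I, Y i ω) ∧
      LpBound μ q (fun ω => (∑ i ∈ I, Y i ω)⁻¹) ((D ^ I.card).toReal ^ ((q : ℝ)⁻¹)) := by
  have hc : (0 : ℝ) < I.card := by exact_mod_cast hI.card_pos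
  have hq0 : (0 : ℝ) < q := by positivity
  have hmeas' : ∀ i ∈ I, Measurable (Y i) := fun i hiI => measurable_of_noiseSigma hε (hmeas i hiI)
  have hsm : Measurable fun ω => ∑ i ∈ I, Y i ω := Finset.measurable_sum _ hmeas'
  have hfin : D ^ I.card ≠ ⊤ := ENNReal.pow_ne_top hDtop
  have hprod := lintegral_prod_le_of_disjoint hε hi I (D := D)
    (Y := fun i ω => ‖Y i ω‖ₑ ^ (-((q : ℝ) / I.card)))
    (fun i hiI => (measurable_enorm.pow_const (-((q : ℝ) / I.card))).comp (hmeas i hiI)) hdisj hD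
  have hpt : ∀ ω, ‖∑ i ∈ I, Y i ω‖ₑ ^ (-(q : ℝ)) ≤ ∏ i ∈ I, ‖Y i ω‖ₑ ^ (-((q : ℝ) / I.card)) := by
    intro ω
    have h1 : ∀ i ∈ I, ‖∑ i ∈ I, Y i ω‖ₑ ^ (-((q : ℝ) / I.card)) ≤
        ‖Y i ω‖ₑ ^ (-((q : ℝ) / I.card)) := by
      intro i hiI
      rw [ENNReal.rpow_neg, ENNReal.rpow_neg]
      refine ENNReal.inv_le_inv.2 (ENNReal.rpow_le_rpow ?_ (by positivity))
      rw [Real.enorm_eq_ofReal (h0 i hiI ω),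
        Real.enorm_eq_ofReal (Finset.sum_nonneg fun j hj => h0 j hj ω)]
      exact ENNReal.ofReal_le_ofReal
        (Finset.single_le_sum (f := fun j => Y j ω) (fun j hj => h0 j hj ω) hiI)
    refine le_trans (le_of_eq ?_) (Finset.prod_le_prod' h1)
    rw [Finset.prod_const, ← ENNReal.rpow_natCast, ← ENNReal.rpow_mul]
    congr 1
    field_simp
  have hle : ∫⁻ ω, ‖∑ i ∈ I, Y i ω‖ₑ ^ (-(q : ℝ)) ∂μ ≤ D ^ I.card := (lintegral_mono hpt).trans hprod
  constructor
  · filter_upwards [ae_lt_top (hsm.enorm.pow_const _) (ne_top_of_le_ne_top hfin hle)] with ω hω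
    refine lt_of_le_of_ne (Finset.sum_nonneg fun j hj => h0 j hj ω) fun h => ?_
    rw [← h, enorm_zero, ENNReal.zero_rpow_of_neg (by linarith)] at hω
    exact lt_irrefl _ hω
  · refine ⟨hsm.inv.aestronglyMeasurable, by positivity, ?_⟩
    rw [eLpNorm_eq_lintegral_rpow_enorm_toReal (by exact_mod_cast hq) (by simp)]
    simp only [ENNReal.toReal_natCast]
    rw [← ENNReal.ofReal_rpow_of_nonneg ENNReal.toReal_nonneg (by positivity),
      ENNReal.ofReal_toReal hfin, one_div]
    refine ENNReal.rpow_le_rpow (le_trans (lintegral_mono fun ω => ?_) hle) (by positivity)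
    rcases eq_or_ne (∑ i ∈ I, Y i ω) 0 with hz | hz
    · rw [hz, inv_zero, enorm_zero, ENNReal.zero_rpow_of_pos hq0]
      exact zero_le
    · rw [enorm_inv hz, ENNReal.inv_rpow, ENNReal.rpow_neg]

end MultistepAR
end

noncomputable section
namespace MultistepAR

variable {Ω : Type*} [mΩ : MeasurableSpace Ω] {μ : Measure Ω} {ε : ℤ → Ω → ℝ} {σ : ℝ}

/-! ### Negative moments of the sample covariance matrix -/

/-- Filtering: quadratic forms in the noises are dominated by quadratic forms in the process. -/
lemma sum_sq_filter_le {α : ℕ → ℝ} {p k : ℕ} {X E : ℤ → ℝ}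
    (hE : ∀ t, E t = ∑ j ∈ Finset.range (p + 1), α j * X (t - (j : ℤ))) (v : Fin k → ℝ)
    (m₁ m₂ : ℕ) :
    ∑ t ∈ Finset.Icc (m₁ + p) m₂, (∑ l : Fin k, v l * E ((t : ℤ) - ((l : ℕ) : ℤ))) ^ 2 ≤
      (∑ j ∈ Finset.range (p + 1), α j ^ 2) * (p + 1) *
        ∑ j ∈ Finset.Icc m₁ m₂, (∑ l : Fin k, v l * X ((j : ℤ) - ((l : ℕ) : ℤ))) ^ 2 := by
  set u : ℤ → ℝ := fun j => ∑ l : Fin k, v l * X (j - ((l : ℕ) : ℤ)) with hu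
  set A := ∑ j ∈ Finset.range (p + 1), α j ^ 2 with hA
  have hA0 : 0 ≤ A := Finset.sum_nonneg fun _ _ => sq_nonneg _
  have h1 : ∀ t : ℤ, ∑ l : Fin k, v l * E (t - ((l : ℕ) : ℤ)) =
      ∑ j ∈ Finset.range (p + 1), α j * u (t - (j : ℤ)) := by
    intro t
    simp only [hE, hu, Finset.mul_sum]
    rw [Finset.sum_comm]
    refine Finset.sum_congr rfl fun j _ => Finset.sum_congr rfl fun l _ => ?_
    rw [show t - ((l : ℕ) : ℤ) - (j : ℤ) = t - (j : ℤ) - ((l : ℕ) : ℤ) by ring]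
    ring
  have h2 : ∀ t : ℤ, (∑ l : Fin k, v l * E (t - ((l : ℕ) : ℤ))) ^ 2 ≤
      A * ∑ j ∈ Finset.range (p + 1), u (t - (j : ℤ)) ^ 2 := by
    intro t
    rw [h1]
    exact Finset.sum_mul_sq_le_sq_mul_sq _ _ _
  have h3 : ∀ j ∈ Finset.range (p + 1), ∑ t ∈ Finset.Icc (m₁ + p) m₂, u ((t : ℤ) - (j : ℤ)) ^ 2 ≤
      ∑ t ∈ Finset.Icc m₁ m₂, u (t : ℤ) ^ 2 := by
    intro j hj
    have hj := Finset.mem_range.1 hj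
    have : ∑ t ∈ Finset.Icc (m₁ + p) m₂, u ((t : ℤ) - (j : ℤ)) ^ 2 =
        ∑ t ∈ (Finset.Icc (m₁ + p) m₂).image (fun t => t - j), u (t : ℤ) ^ 2 := by
      rw [Finset.sum_image]
      · refine Finset.sum_congr rfl fun t ht => ?_
        have := (Finset.mem_Icc.1 ht).1
        rw [Nat.cast_sub (by omega)]
      · intro s hs t ht hst
        simp only [Finset.coe_Icc, Set.mem_Icc] at hs ht
        simp only at hst
        omega
    rw [this]
    refine Finset.sum_le_sum_of_subset_of_nonneg ?_ fun _ _ _ => sq_nonneg _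
    intro s hs
    obtain ⟨t, ht, rfl⟩ := Finset.mem_image.1 hs
    rw [Finset.mem_Icc] at ht ⊢
    omega
  calc _ ≤ ∑ t ∈ Finset.Icc (m₁ + p) m₂,
        A * ∑ j ∈ Finset.range (p + 1), u ((t : ℤ) - (j : ℤ)) ^ 2 :=
        Finset.sum_le_sum fun t _ => h2 t
    _ = A * ∑ j ∈ Finset.range (p + 1), ∑ t ∈ Finset.Icc (m₁ + p) m₂, u ((t : ℤ) - (j : ℤ)) ^ 2 := by
        rw [← Finset.mul_sum, Finset.sum_comm]
    _ ≤ A * ∑ _j ∈ Finset.range (p + 1), ∑ t ∈ Finset.Icc m₁ m₂, u (t : ℤ) ^ 2 :=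
        mul_le_mul_of_nonneg_left (Finset.sum_le_sum h3) hA0
    _ = _ := by
        rw [Finset.sum_const, Finset.card_range, nsmul_eq_mul]
        push_cast
        ring

/-! ### Blocks of noises at distinct times. -/

/-- The row times of the `G`-th block of noises. -/
def blockRow (s k G : ℕ) (i : Fin k) : ℕ := s + (G * k + i) * k

/-- The times of the noises in the `G`-th block. -/
def blockTime (s k G : ℕ) (i l : Fin k) : ℤ := (blockRow s k G i : ℤ) - ((l : ℕ) : ℤ)

lemma eq_of_mul_add_eq {k a b i j : ℕ} (hi : i < k) (hj : j < k)
    (h : a * k + i = b * k + j) : a = b ∧ i = j := by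
  have hab : a = b := by
    rcases lt_trichotomy a b with hlt | heq | hlt
    · have := Nat.mul_le_mul_right k (Nat.succ_le_of_lt hlt)
      rw [Nat.succ_mul] at this
      omega
    · exact heq
    · have := Nat.mul_le_mul_right k (Nat.succ_le_of_lt hlt)
      rw [Nat.succ_mul] at this
      omega
  subst hab
  exact ⟨rfl, by omega⟩

lemma blockRow_injective {s k G G' : ℕ} {i i' : Fin k} (h : blockRow s k G i = blockRow s k G' i') :
    G = G' ∧ i = i' := by
  have hk : 0 < k := i.pos
  have h1 : (G * k + i) * k = (G' * k + i') * k := by simpa [blockRow] using h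
  obtain ⟨h2, h3⟩ := eq_of_mul_add_eq i.2 i'.2 (Nat.eq_of_mul_eq_mul_right hk h1)
  exact ⟨h2, Fin.ext h3⟩

/-- Successive rows are `k` apart and each reaches back `k - 1` steps, so no noise occurs twice.
This gives distinct entries within a block and independence between blocks. -/
lemma blockTime_injective {s k G G' : ℕ} {i i' l l' : Fin k}
    (h : blockTime s k G i l = blockTime s k G' i' l') : G = G' ∧ i = i' ∧ l = l' := by
  have hk : 0 < k := i.pos
  have h1 : (G * k + i) * k + (l' : ℕ) = (G' * k + i') * k + (l : ℕ) := by
    have : ((s + (G * k + i) * k : ℕ) : ℤ) - ((l : ℕ) : ℤ) =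
      ((s + (G' * k + i') * k : ℕ) : ℤ) - ((l' : ℕ) : ℤ) := h
    omega
  obtain ⟨h2, h3⟩ := eq_of_mul_add_eq l'.2 l.2 h1
  obtain ⟨h4, h5⟩ := eq_of_mul_add_eq i.2 i'.2 h2
  exact ⟨h4, Fin.ext h5, Fin.ext h3.symm⟩

lemma LpBound.of_le {q : ENNReal} {f g : Ω → ℝ} {C : ℝ} (hg : LpBound μ q g C)
    (hf : AEStronglyMeasurable f μ) (h : ∀ᵐ ω ∂μ, |f ω| ≤ |g ω|) : LpBound μ q f C :=
  ⟨hf, hg.nonneg, (eLpNorm_mono_ae h).trans hg.le⟩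

lemma dotProduct_sampleGam (x : ℤ → Ω → ℝ) (h k n : ℕ) (ω : Ω) (v : Fin k → ℝ) :
    v ⬝ᵥ (sampleGam x h k n ω *ᵥ v) = ((n : ℝ) - h - k + 1)⁻¹ *
      ∑ j ∈ Finset.Icc k (n - h), (∑ l : Fin k, v l * x ((j : ℤ) - ((l : ℕ) : ℤ)) ω) ^ 2 := by
  rw [sampleGam, Matrix.smul_mulVec, dotProduct_smul, smul_eq_mul, Matrix.sum_mulVec,
    dotProduct_sum]
  congr 1
  refine Finset.sum_congr rfl fun j _ => ?_
  rw [Matrix.vecMulVec_mulVec]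
  simp only [dotProduct, lagVec, Pi.smul_apply, MulOpposite.smul_eq_mul_unop, MulOpposite.unop_op,
    sq, Finset.sum_mul]
  refine Finset.sum_congr rfl fun l _ => ?_
  rw [Finset.mul_sum, Finset.mul_sum, Finset.mul_sum]
  refine Finset.sum_congr rfl fun l' _ => ?_
  ring

/-- The inequality of harmonic and arithmetic means, from Cauchy-Schwarz applied to `1 = s i * (s
i)⁻¹`. -/
lemma inv_sum_le {ι : Type*} (I : Finset ι) (hI : I.Nonempty) (s : ι → ℝ) (hs : ∀ i ∈ I, 0 < s i) :
    (∑ i ∈ I, s i)⁻¹ ≤ ((I.card : ℝ) ^ 2)⁻¹ * ∑ i ∈ I, (s i)⁻¹ := by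
  have h := Finset.sum_sq_le_sum_mul_sum_of_sq_le_mul I (r := fun _ => (1 : ℝ)) (f := s)
    (g := fun i => (s i)⁻¹) (fun i hi => (hs i hi).le) (fun i hi => (inv_pos.2 (hs i hi)).le)
    (fun i hi => by rw [mul_inv_cancel₀ (hs i hi).ne']; norm_num)
  have h0 : 0 < ∑ i ∈ I, s i := Finset.sum_pos hs hI
  have hc : (0 : ℝ) < I.card := by exact_mod_cast hI.card_pos
  simp only [Finset.sum_const, nsmul_eq_mul, mul_one] at h
  rw [inv_eq_one_div, inv_mul_eq_div, div_le_div_iff₀ h0 (by positivity)]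
  linarith

/-- The least eigenvalue of the sample covariance matrix is bounded below by a variable whose
inverse has bounded moments of any order. -/
lemma exists_sampleGam_lower_bound [IsProbabilityMeasure μ] {p : ℕ} {a : ℕ → ℝ} {x : ℤ → Ω → ℝ}
    (hε : IsIIDNoise μ ε σ) (hx : IsStationaryAR μ p a ε x)
    (hF : HolderDistribution fun u => cdf (μ.map (ε 1)) u) (h : ℕ) {k : ℕ} (hk : 1 ≤ k)
    {q : ℕ} (hq : q ≠ 0) :
    ∃ (C : ℝ) (n₀ : ℕ), ∀ n ≥ n₀, ∃ lam : Ω → ℝ, (∀ᵐ ω ∂μ, 0 < lam ω) ∧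
      (∀ᵐ ω ∂μ, ∀ v : Fin k → ℝ, lam ω * (v ⬝ᵥ v) ≤ v ⬝ᵥ (sampleGam x h k n ω *ᵥ v)) ∧
      LpBound μ q (fun ω => (lam ω)⁻¹) C := by
  obtain ⟨τ₁, hτ₁, D, hDtop, hD⟩ := exists_lintegral_eigenLower_le hε hF k
  -- A group consists of `L` independent blocks; sharing the power `q` among them leaves exponents
  -- `q / L ≤ τ₁`.
  obtain ⟨L, hL⟩ := exists_nat_gt ((q : ℝ) / τ₁)
  have hq0 : (0 : ℝ) < q := by positivity
  have hL0 : (0 : ℝ) < L := lt_trans (by positivity) hL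
  have hLpos : 0 < L := by exact_mod_cast hL0
  have hqL : (q : ℝ) / L ≤ τ₁ := by
    rw [div_lt_iff₀ hτ₁] at hL
    rw [div_le_iff₀ hL0]
    linarith
  set A := ∑ j ∈ Finset.range (p + 1), (arPoly p a).coeff j ^ 2 with hA
  have hApos : 0 < A := by
    refine Finset.sum_pos' (fun _ _ => sq_nonneg _) ⟨0, by simp, ?_⟩
    rw [arPoly_coeff_zero]; norm_num
  set κ := A * (p + 1) with hκ
  have hκ0 : 0 < κ := by positivity
  set Cs := (D ^ (Finset.range L).card).toReal ^ ((q : ℝ)⁻¹) with hCs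
  -- The filter expressing noises through `x` looks `p` steps further back, and the sample begins at
  -- time `k`.
  set s := k + p with hs
  set Y : ℕ → Ω → ℝ := fun G ω => eigenLower (noiseMatrix ε (blockTime s k G) ω) with hY
  have hYm : ∀ G, Measurable[noiseSigma ε {t | ∃ i l, t = blockTime s k G i l}] (Y G) := by
    intro G
    refine @measurable_eigenLower Ω (noiseSigma ε _) k _ fun i l => ?_
    exact measurable_noise ⟨i, l, rfl⟩
  have hblock : ∀ m : ℕ, (∀ᵐ ω ∂μ, 0 < ∑ g ∈ Finset.range L, Y (m * L + g) ω) ∧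
      LpBound μ q (fun ω => (∑ g ∈ Finset.range L, Y (m * L + g) ω)⁻¹) Cs := by
    intro m
    refine lpBound_inv_sum_of_disjoint hε.measurable hε.indep (Finset.range L)
      (Y := fun g => Y (m * L + g)) (S := fun g => {t | ∃ i l, t = blockTime s k (m * L + g) i l})
      hDtop hq ⟨0, by simpa using hLpos⟩ (fun g _ => hYm _) ?_ (fun g _ ω => eigenLower_nonneg _) ?_
    · intro g _ g' _ hgg'
      rw [Set.disjoint_left]
      rintro t ⟨i, l, rfl⟩ ⟨i', l', h'⟩
      exact hgg' (by have := (blockTime_injective h').1; omega)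
    · intro g _
      rw [Finset.card_range]
      refine hD _ (by positivity) hqL _ fun i j i' j' h' => (blockTime_injective h').2
  have hposall : ∀ᵐ ω ∂μ, ∀ m : ℕ, 0 < ∑ g ∈ Finset.range L, Y (m * L + g) ω :=
    ae_all_iff.2 fun m => (hblock m).1
  have hCs0 : 0 ≤ Cs := (hblock 0).2.nonneg
  -- A group covers `L * k * k` time points. The threshold makes room for one group, so `M ≥ 1`, and
  -- the bracket bounds the ratio `N / M`.
  refine ⟨κ * (h + k + p + 2 * (L * k * k)) * Cs, h + k + p + L * k * k, fun n hn => ?_⟩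
  set M := (n - h - k - p) / (L * k * k) with hM
  have hLkk : 0 < L * k * k := by positivity
  have hM1 : 1 ≤ M := (Nat.one_le_div_iff hLkk).2 (by omega)
  have hMle : M * (L * k * k) ≤ n - h - k - p := Nat.div_mul_le_self _ _
  have hMlt : n - h - k - p < (M + 1) * (L * k * k) := by
    rw [mul_comm]; exact Nat.lt_mul_div_succ _ hLkk
  set N : ℝ := (n : ℝ) - h - k + 1 with hN
  have hnr : (h : ℝ) + k + p + 0 ≤ n := by
    have : h + k + p + 0 ≤ n := by omega
    exact_mod_cast this
  have hN0 : 0 < N := by have : (0 : ℝ) ≤ p := by positivity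
                         linarith
  have hM0 : (0 : ℝ) < M := by exact_mod_cast hM1
  have hNM : N ≤ M * (h + k + p + 2 * (L * k * k)) := by
    have h1 : n ≤ h + k + p + (M + 1) * (L * k * k) := by omega
    have h2 : (n : ℝ) ≤ h + k + p + (M + 1) * (L * k * k) := by exact_mod_cast h1
    have h3 : (1 : ℝ) ≤ M := by exact_mod_cast hM1
    have h4 : (1 : ℝ) ≤ k := by exact_mod_cast hk
    have h5 : (0 : ℝ) ≤ (h : ℝ) + k + p := by positivity
    have h6 : (0 : ℝ) ≤ (L * k * k : ℝ) := by positivity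
    have h7 : (0 : ℝ) ≤ h := by positivity
    nlinarith [mul_le_mul_of_nonneg_right h3 h5, mul_le_mul_of_nonneg_right h3 h6]
  set S : Ω → ℝ := fun ω => ∑ m ∈ Finset.range M, ∑ g ∈ Finset.range L, Y (m * L + g) ω with hS
  have hMne : (Finset.range M).Nonempty := ⟨0, Finset.mem_range.2 hM1⟩
  -- `S` sums about `N / (L * k * k)` groups. Its inverse is controlled by averaging the inverses of
  -- the groups, so the moment bound does not deteriorate with `n`.
  refine ⟨fun ω => (κ * N)⁻¹ * S ω, ?_, ?_, ?_⟩
  · filter_upwards [hposall] with ω hω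
    have : 0 < S ω := Finset.sum_pos (fun m _ => hω m) hMne
    positivity
  · filter_upwards [hx.ae_equation] with ω hω v
    have hE : ∀ t, ε t ω = ∑ j ∈ Finset.range (p + 1), (arPoly p a).coeff j * x (t - (j : ℤ)) ω := by
      intro t
      have h1 := aeval_backshift_arPoly p a (fun t => x t ω) t
      rw [hω, aeval_backshift_apply _ _ _ (Nat.lt_succ_of_le (arPoly_natDegree_le p a))] at h1
      exact h1.symm
    have h1 := sum_sq_filter_le (X := fun t => x t ω) (E := fun t => ε t ω) hE v k (n - h)
    rw [dotProduct_sampleGam, ← hN]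
    set φ : ℕ → ℝ := fun t => (∑ l : Fin k, v l * ε ((t : ℤ) - ((l : ℕ) : ℤ)) ω) ^ 2 with hφ
    have h2 : S ω * (v ⬝ᵥ v) ≤ ∑ t ∈ Finset.Icc (k + p) (n - h), φ t := by
      have h3 : ∀ G, Y G ω * (v ⬝ᵥ v) ≤ ∑ i : Fin k, φ (blockRow s k G i) := by
        intro G
        refine (eigenLower_mul_le _ v).trans (le_of_eq ?_)
        simp only [dotProduct, Matrix.mulVec, hφ, sq]
        refine Finset.sum_congr rfl fun i _ => ?_
        have : ∑ l, noiseMatrix ε (blockTime s k G) ω i l * v l =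
            ∑ l : Fin k, v l * ε ((blockRow s k G i : ℤ) - ((l : ℕ) : ℤ)) ω :=
          Finset.sum_congr rfl fun l _ => mul_comm _ _
        rw [this]
      calc S ω * (v ⬝ᵥ v) = ∑ m ∈ Finset.range M, ∑ g ∈ Finset.range L,
            Y (m * L + g) ω * (v ⬝ᵥ v) := by
            simp only [hS, Finset.sum_mul]
        _ ≤ ∑ m ∈ Finset.range M, ∑ g ∈ Finset.range L, ∑ i : Fin k,
            φ (blockRow s k (m * L + g) i) :=
            Finset.sum_le_sum fun m _ => Finset.sum_le_sum fun g _ => h3 _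
        _ = ∑ w ∈ Finset.range M ×ˢ (Finset.range L ×ˢ (Finset.univ : Finset (Fin k))),
            φ (blockRow s k (w.1 * L + w.2.1) w.2.2) := by
            rw [Finset.sum_product]
            refine Finset.sum_congr rfl fun m _ => ?_
            rw [Finset.sum_product]
        _ = ∑ t ∈ (Finset.range M ×ˢ (Finset.range L ×ˢ (Finset.univ : Finset (Fin k)))).image
            (fun w => blockRow s k (w.1 * L + w.2.1) w.2.2), φ t := by
            rw [Finset.sum_image]
            rintro ⟨m, g, i⟩ hw ⟨m', g', i'⟩ hw' heq
            simp only [Finset.coe_product, Set.mem_prod, Finset.coe_range, Set.mem_Iio] at hw hw'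
            obtain ⟨h4, h5⟩ := blockRow_injective heq
            obtain ⟨h6, h7⟩ := eq_of_mul_add_eq hw.2.1 hw'.2.1 h4
            simp only at h5 h6 h7
            rw [h5, h6, h7]
        _ ≤ ∑ t ∈ Finset.Icc (k + p) (n - h), φ t := by
            refine Finset.sum_le_sum_of_subset_of_nonneg ?_ fun _ _ _ => sq_nonneg _
            intro t ht
            obtain ⟨⟨m, g, i⟩, hw, rfl⟩ := Finset.mem_image.1 ht
            simp only [Finset.mem_product, Finset.mem_range, Finset.mem_univ, and_true] at hw
            rw [Finset.mem_Icc]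
            refine ⟨Nat.le_add_right _ _, ?_⟩
            have h4 : m * L + g + 1 ≤ M * L := by
              have := Nat.mul_le_mul_right L (Nat.succ_le_of_lt hw.1)
              rw [Nat.succ_mul] at this
              omega
            have h5 : (m * L + g) * k + i ≤ M * L * k := by
              have := Nat.mul_le_mul_right k h4
              rw [Nat.succ_mul] at this
              have := i.2
              omega
            have h6 := Nat.mul_le_mul_right k h5
            have h7 : M * L * k * k = M * (L * k * k) := by ring
            simp only [blockRow]
            omega
    have h3 : S ω * (v ⬝ᵥ v) ≤ κ * ∑ j ∈ Finset.Icc k (n - h),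
        (∑ l : Fin k, v l * x ((j : ℤ) - ((l : ℕ) : ℤ)) ω) ^ 2 := h2.trans h1
    rw [mul_inv, mul_comm κ⁻¹, mul_assoc, mul_assoc]
    refine mul_le_mul_of_nonneg_left ?_ (by positivity)
    rwa [inv_mul_le_iff₀ hκ0]
  · have hSm : Measurable S := Finset.measurable_sum _ fun m _ => Finset.measurable_sum _ fun g _ =>
      measurable_of_noiseSigma hε.measurable (hYm _)
    have hb : LpBound μ q (fun ω => κ * N * ((M : ℝ) ^ 2)⁻¹ *
        ∑ m ∈ Finset.range M, (∑ g ∈ Finset.range L, Y (m * L + g) ω)⁻¹) _ :=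
      (LpBound.sum (by exact_mod_cast Nat.one_le_iff_ne_zero.2 hq) (Finset.range M)
        fun m _ => (hblock m).2).const_mul (κ * N * ((M : ℝ) ^ 2)⁻¹)
    refine (hb.of_le (hSm.const_mul _).inv.aestronglyMeasurable ?_).mono ?_
    · filter_upwards [hposall] with ω hω
      have hS0 : 0 < S ω := Finset.sum_pos (fun m _ => hω m) hMne
      refine le_trans ?_ (le_abs_self _)
      change |((κ * N)⁻¹ * S ω)⁻¹| ≤ _
      rw [abs_of_pos (by positivity)]
      have := inv_sum_le (Finset.range M) hMne _ fun m _ => hω m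
      rw [Finset.card_range] at this
      rw [mul_inv, inv_inv, mul_assoc (κ * N)]
      exact mul_le_mul_of_nonneg_left this (by positivity)
    · rw [Finset.sum_const, Finset.card_range, nsmul_eq_mul, abs_of_pos (by positivity)]
      have : κ * N * ((M : ℝ) ^ 2)⁻¹ * (M * Cs) = κ * (N / M) * Cs := by
        field_simp
      rw [this]
      have h1 : N / M ≤ h + k + p + 2 * (L * k * k) := by
        rw [div_le_iff₀ hM0]; linarith
      gcongr

end MultistepAR
end

noncomputable section
namespace MultistepAR

variable {Ω : Type*} [mΩ : MeasurableSpace Ω] {μ : Measure Ω} {ε : ℤ → Ω → ℝ} {σ : ℝ}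
  {b : ℕ → ℝ} {C ρ : ℝ}

/-! ### Second moments of the score -/

/-- The terms `X_{i-c} η_i` of the score, where `η_i` is the `h`-step forecast error. -/
def scoreTerm (b : ℕ → ℝ) (ε : ℤ → Ω → ℝ) (h c : ℕ) (i : ℤ) (ω : Ω) : ℝ :=
  maProcess b ε (i - (c : ℤ)) ω * maPartial b ε h (i + h) ω

lemma measurable_maProcess_Iic (b : ℕ → ℝ) (ε : ℤ → Ω → ℝ) {t s : ℤ} (h : t ≤ s) :
    Measurable[noiseSigma ε (Set.Iic s)] (maProcess b ε t) :=
  measurable_maProcess b ε (Set.Iic_subset_Iic.2 h)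

lemma integral_scoreTerm [IsProbabilityMeasure μ] (hε : IsIIDNoise μ ε σ) (h c : ℕ) (i : ℤ) :
    ∫ ω, scoreTerm b ε h c i ω ∂μ = 0 := by
  simp only [scoreTerm]
  rw [integral_mul_of_noiseSigma hε.measurable hε.indep (S := Set.Iic i) (T := Set.Ioi i)
    (by rw [Set.disjoint_left]; intro j hj hj'; simp at hj hj'; omega)
    (measurable_maProcess_Iic b ε (by omega)) (measurable_forecast_error b ε h i),
    integral_maPartial hε, mul_zero]

lemma measurable_scoreTerm (b : ℕ → ℝ) (ε : ℤ → Ω → ℝ) (h c : ℕ) {i s : ℤ} (his : i + h ≤ s) :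
    Measurable[noiseSigma ε (Set.Iic s)] (scoreTerm b ε h c i) :=
  (measurable_maProcess_Iic b ε (by omega)).mul
    (measurable_maPartial b ε fun j _ => by simp only [Set.mem_Iic]; omega)

/-- If `s ≠ t`, the later noise is independent of the other three factors and has mean zero. If `s =
t`, its square is independent of both process values. -/
lemma integral_four [IsProbabilityMeasure μ] (hε : IsIIDNoise μ ε σ) {g : ℤ → ℝ}
    (hg : ∀ u v, ∫ ω, maProcess b ε u ω * maProcess b ε v ω ∂μ = g (u - v)) {u v s t : ℤ}
    (hus : u < s) (hvt : v < t) :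
    ∫ ω, (maProcess b ε u ω * ε s ω) * (maProcess b ε v ω * ε t ω) ∂μ =
      if s = t then σ ^ 2 * g (u - v) else 0 := by
  have hdisj : ∀ r : ℤ, Disjoint (Set.Iic (r - 1)) {r} := fun r => by
    rw [Set.disjoint_singleton_right]; simp
  have key : ∀ {u v s t : ℤ}, u < s → v < t → s < t →
      ∫ ω, (maProcess b ε u ω * ε s ω) * (maProcess b ε v ω * ε t ω) ∂μ = 0 := by
    intro u v s t hus hvt hst
    have hm : Measurable[noiseSigma ε (Set.Iic (t - 1))]
        fun ω => maProcess b ε u ω * ε s ω * maProcess b ε v ω :=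
      ((measurable_maProcess_Iic b ε (by omega)).mul
        (measurable_noise (by simp only [Set.mem_Iic]; omega))).mul
        (measurable_maProcess_Iic b ε (by omega))
    simp only [← mul_assoc]
    rw [integral_mul_of_noiseSigma hε.measurable hε.indep (hdisj t) hm (measurable_noise rfl),
      hε.integral_eq_zero, mul_zero]
  split_ifs with hst
  · subst hst
    have hm : Measurable[noiseSigma ε (Set.Iic (s - 1))]
        fun ω => maProcess b ε u ω * maProcess b ε v ω :=
      (measurable_maProcess_Iic b ε (by omega)).mul (measurable_maProcess_Iic b ε (by omega))
    have hs : Measurable[noiseSigma ε {s}] (ε s) := measurable_noise rfl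
    have hm' : Measurable[noiseSigma ε {s}] fun ω => ε s ω * ε s ω := hs.mul hs
    have e1 := integral_mul_of_noiseSigma hε.measurable hε.indep (hdisj s) hm hm'
    rw [hε.integral_sq, hg] at e1
    rw [mul_comm (σ ^ 2), ← e1]
    exact integral_congr_ae (.of_forall fun ω => mul_mul_mul_comm _ _ _ _)
  · rcases lt_or_gt_of_ne hst with h | h
    · exact key hus hvt h
    · have := key hvt hus h
      rw [← this]
      exact integral_congr_ae (.of_forall fun ω => mul_comm _ _)

/-- Each `i` has exactly one matching `j`, unless that `j` falls outside the range; this can happen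
only for the first `h` or the last `h` indices. -/
lemma abs_card_shift_sub_le {h J s s' : ℕ} (hs : s < h) (hs' : s' < h) (i₀ : ℤ) :
    |(∑ i ∈ Finset.range J, ∑ j ∈ Finset.range J,
      if i₀ + i + h - s = i₀ + j + h - s' then (1 : ℝ) else 0) - J| ≤ 2 * h := by
  have h1 : ∀ i ∈ Finset.range J, (∑ j ∈ Finset.range J,
      if i₀ + i + h - s = i₀ + j + h - s' then (1 : ℝ) else 0) =
      if i + s' - s < J ∧ s ≤ i + s' then 1 else 0 := by
    intro i _
    by_cases hc : i + s' - s < J ∧ s ≤ i + s'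
    · rw [if_pos hc, Finset.sum_eq_single (i + s' - s)]
      · rw [if_pos (by omega)]
      · intro j _ hj
        rw [if_neg (by omega)]
      · intro hn
        exact absurd (Finset.mem_range.2 hc.1) hn
    · rw [if_neg hc]
      refine Finset.sum_eq_zero fun j hj => ?_
      have := Finset.mem_range.1 hj
      rw [if_neg (by omega)]
  rw [Finset.sum_congr rfl h1]
  have h2 : (J : ℝ) = ∑ _i ∈ Finset.range J, (1 : ℝ) := by simp
  rw [h2, ← Finset.sum_sub_distrib]
  refine (Finset.abs_sum_le_sum_abs _ _).trans ?_
  have h3 : ∀ i ∈ Finset.range J, |(if i + s' - s < J ∧ s ≤ i + s' then (1 : ℝ) else 0) - 1| ≤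
      if i ∈ Finset.range h ∪ Finset.Ico (J - h) J then 1 else 0 := by
    intro i hi
    have hi := Finset.mem_range.1 hi
    by_cases hc : i + s' - s < J ∧ s ≤ i + s'
    · rw [if_pos hc]; simp; split_ifs <;> norm_num
    · rw [if_neg hc, if_pos]
      · norm_num
      · rw [Finset.mem_union, Finset.mem_range, Finset.mem_Ico]
        omega
  refine (Finset.sum_le_sum h3).trans ?_
  rw [Finset.sum_ite_mem, Finset.sum_const, nsmul_eq_mul, mul_one]
  have h4 : (Finset.range J ∩ (Finset.range h ∪ Finset.Ico (J - h) J)).card ≤ 2 * h := by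
    refine (Finset.card_le_card Finset.inter_subset_right).trans
      ((Finset.card_union_le _ _).trans ?_)
    simp
    omega
  exact_mod_cast h4

/-- The long-run covariance of the score. -/
def scoreCov (b : ℕ → ℝ) (σ : ℝ) (g : ℤ → ℝ) (h c d : ℕ) : ℝ :=
  ∑ s ∈ Finset.range h, ∑ s' ∈ Finset.range h,
    b s * b s' * (σ ^ 2 * g ((s : ℤ) - c - ((s' : ℤ) - d)))

/-- Expand both forecast errors into noises. By `integral_four` only coinciding noise times survive,
and each pair of lags `s`, `s'` then occurs `J` times up to a boundary effect of at most `2 * h`. -/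
lemma exists_integral_score_sub_le [IsProbabilityMeasure μ] (hε : IsIIDNoise μ ε σ)
    (hb : GeomDecay b C ρ) {K : ℝ} (hK : LpBound μ 8 (ε 1) K) {g : ℤ → ℝ}
    (hg : ∀ u v, ∫ ω, maProcess b ε u ω * maProcess b ε v ω ∂μ = g (u - v)) (h c d : ℕ) :
    ∃ B : ℝ, 0 ≤ B ∧ ∀ (i₀ : ℤ) (J : ℕ),
      |(∫ ω, (∑ i ∈ Finset.range J, scoreTerm b ε h c (i₀ + i) ω) *
        (∑ i ∈ Finset.range J, scoreTerm b ε h d (i₀ + i) ω) ∂μ) - J * scoreCov b σ g h c d| ≤ B := by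
  refine ⟨∑ s ∈ Finset.range h, ∑ s' ∈ Finset.range h,
    |b s * b s' * (σ ^ 2 * g ((s : ℤ) - c - ((s' : ℤ) - d)))| * (2 * h),
    Finset.sum_nonneg fun _ _ => Finset.sum_nonneg fun _ _ => by positivity, fun i₀ J => ?_⟩
  have hterm : ∀ (c : ℕ) (i : ℤ) (ω : Ω), scoreTerm b ε h c i ω = ∑ s ∈ Finset.range h,
      b s * (maProcess b ε (i - (c : ℤ)) ω * ε (i + h - s) ω) := by
    intro c i ω
    rw [scoreTerm, maPartial, Finset.mul_sum]
    exact Finset.sum_congr rfl fun s _ => by ring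
  have hXε : ∀ u s : ℤ, LpBound μ 2 (fun ω => maProcess b ε u ω * ε s ω) _ := fun u s =>
    ((lpBound_maProcess hε hb (by norm_num) hK u).mono_exponent (q₁ := 4) (by norm_num)).mul
      ((hε.lpBound hK s).mono_exponent (q₁ := 4) (by norm_num))
  have hint : ∀ u s v t : ℤ, Integrable (fun ω => (maProcess b ε u ω * ε s ω) *
      (maProcess b ε v ω * ε t ω)) μ := fun u s v t =>
    integrable_mul_of_memLp_two (hXε u s).memLp (hXε v t).memLp
  have hexp : ∫ ω, (∑ i ∈ Finset.range J, scoreTerm b ε h c (i₀ + i) ω) *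
        (∑ i ∈ Finset.range J, scoreTerm b ε h d (i₀ + i) ω) ∂μ =
      ∑ i ∈ Finset.range J, ∑ j ∈ Finset.range J, ∑ s ∈ Finset.range h, ∑ s' ∈ Finset.range h,
        b s * b s' * (if i₀ + i + h - s = i₀ + j + h - s' then
          σ ^ 2 * g ((s : ℤ) - c - ((s' : ℤ) - d)) else 0) := by
    have h1 : ∀ ω, (∑ i ∈ Finset.range J, scoreTerm b ε h c (i₀ + i) ω) *
        (∑ i ∈ Finset.range J, scoreTerm b ε h d (i₀ + i) ω) =
        ∑ i ∈ Finset.range J, ∑ j ∈ Finset.range J, ∑ s ∈ Finset.range h, ∑ s' ∈ Finset.range h,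
          b s * b s' * ((maProcess b ε (i₀ + i - (c : ℤ)) ω * ε (i₀ + i + h - s) ω) *
            (maProcess b ε (i₀ + j - (d : ℤ)) ω * ε (i₀ + j + h - s') ω)) := by
      intro ω
      rw [Finset.sum_mul_sum]
      refine Finset.sum_congr rfl fun i _ => Finset.sum_congr rfl fun j _ => ?_
      rw [hterm, hterm, Finset.sum_mul_sum]
      exact Finset.sum_congr rfl fun s _ => Finset.sum_congr rfl fun s' _ => by ring
    simp only [h1]
    rw [integral_finsetSum _ fun i _ => integrable_finsetSum _ fun j _ => integrable_finsetSum _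
      fun s _ => integrable_finsetSum _ fun s' _ => (hint _ _ _ _).const_mul _]
    refine Finset.sum_congr rfl fun i _ => ?_
    rw [integral_finsetSum _ fun j _ => integrable_finsetSum _
      fun s _ => integrable_finsetSum _ fun s' _ => (hint _ _ _ _).const_mul _]
    refine Finset.sum_congr rfl fun j _ => ?_
    rw [integral_finsetSum _ fun s _ => integrable_finsetSum _ fun s' _ =>
      (hint _ _ _ _).const_mul _]
    refine Finset.sum_congr rfl fun s hs => ?_
    rw [integral_finsetSum _ fun s' _ => (hint _ _ _ _).const_mul _]
    refine Finset.sum_congr rfl fun s' hs' => ?_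
    have hs := Finset.mem_range.1 hs
    have hs' := Finset.mem_range.1 hs'
    rw [integral_const_mul, integral_four hε hg (by omega) (by omega)]
    split_ifs with heq
    · congr 3
      omega
    · rfl
  have hswap : ∑ i ∈ Finset.range J, ∑ j ∈ Finset.range J, ∑ s ∈ Finset.range h,
      ∑ s' ∈ Finset.range h, b s * b s' * (if i₀ + i + h - s = i₀ + j + h - s' then
          σ ^ 2 * g ((s : ℤ) - c - ((s' : ℤ) - d)) else 0) =
      ∑ s ∈ Finset.range h, ∑ s' ∈ Finset.range h,
        b s * b s' * (σ ^ 2 * g ((s : ℤ) - c - ((s' : ℤ) - d))) *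
        ∑ i ∈ Finset.range J, ∑ j ∈ Finset.range J,
          if i₀ + i + h - s = i₀ + j + h - s' then (1 : ℝ) else 0 := by
    simp only [Finset.mul_sum]
    have e1 : ∀ F : ℕ → ℕ → ℕ → ℕ → ℝ, ∑ i ∈ Finset.range J, ∑ j ∈ Finset.range J,
        ∑ s ∈ Finset.range h, ∑ s' ∈ Finset.range h, F i j s s' =
        ∑ s ∈ Finset.range h, ∑ s' ∈ Finset.range h, ∑ i ∈ Finset.range J, ∑ j ∈ Finset.range J,
          F i j s s' := by
      intro F
      calc _ = ∑ x ∈ Finset.range J ×ˢ Finset.range J, ∑ y ∈ Finset.range h ×ˢ Finset.range h,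
            F x.1 x.2 y.1 y.2 := by simp only [Finset.sum_product]
        _ = ∑ y ∈ Finset.range h ×ˢ Finset.range h, ∑ x ∈ Finset.range J ×ˢ Finset.range J,
            F x.1 x.2 y.1 y.2 := Finset.sum_comm
        _ = _ := by simp only [Finset.sum_product]
    rw [e1]
    refine Finset.sum_congr rfl fun s _ => Finset.sum_congr rfl fun s' _ =>
      Finset.sum_congr rfl fun i _ => Finset.sum_congr rfl fun j _ => ?_
    split_ifs <;> simp
  rw [hexp, hswap, scoreCov, Finset.mul_sum, ← Finset.sum_sub_distrib]
  refine (Finset.abs_sum_le_sum_abs _ _).trans (Finset.sum_le_sum fun s hs => ?_)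
  rw [Finset.mul_sum, ← Finset.sum_sub_distrib]
  refine (Finset.abs_sum_le_sum_abs _ _).trans (Finset.sum_le_sum fun s' hs' => ?_)
  rw [mul_comm (J : ℝ), ← mul_sub, abs_mul]
  exact mul_le_mul_of_nonneg_left (abs_card_shift_sub_le (Finset.mem_range.1 hs)
    (Finset.mem_range.1 hs') i₀) (abs_nonneg _)

/-! ### Fourth moments of the score -/

/-- The `L^4` norm of the score grows like the square root of the number of terms. -/
lemma exists_lpBound_score [IsProbabilityMeasure μ] (hε : IsIIDNoise μ ε σ)
    (hb : GeomDecay b C ρ) {K : ℝ} (hK : LpBound μ 8 (ε 1) K) {h m : ℕ} {w : ℕ → ℝ}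
    (hdec : ∀ t : ℤ, ∀ᵐ ω ∂μ, maProcess b ε (t + h) ω =
      ∑ j ∈ Finset.range m, w j * maProcess b ε (t - (j : ℤ)) ω + maPartial b ε h (t + h) ω)
    (c : ℕ) :
    ∃ B : ℝ, 0 ≤ B ∧ ∀ (i₀ : ℤ) (J : ℕ),
      LpBound μ 4 (fun ω => ∑ i ∈ Finset.range J, scoreTerm b ε h c (i₀ + i) ω) (B * √J) := by
  set D := (C / (1 - ρ)) ^ 2 * (8 * K ^ 2) with hD
  have hD0 : 0 ≤ D := by positivity
  refine ⟨(1 + ∑ j ∈ Finset.range m, |w j|) * D, by positivity, fun i₀ J => ?_⟩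
  set I : Finset ℤ := (Finset.range J).image fun i : ℕ => i₀ + i with hI
  have hinj : Set.InjOn (fun i : ℕ => i₀ + (i : ℤ)) (Finset.range J) := by
    intro i _ j _ hij
    simpa using hij
  have hcard : (I.card : ℝ) = J := by
    rw [hI, Finset.card_image_of_injOn hinj, Finset.card_range]
  have hpair : ∀ u v : ℤ, LpBound μ 4 (fun ω => ∑ i ∈ I,
      (maProcess b ε (i + u) ω * maProcess b ε (i + v) ω -
        ∫ ω', maProcess b ε (i + u) ω' * maProcess b ε (i + v) ω' ∂μ)) (D * √J) := by
    intro u v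
    have := lpBound_maProcess_pair_sum hε hb hK I u v
    rw [hcard] at this
    exact this.mono (le_of_eq (by rw [hD]; ring))
  -- Since `η_i = X_{i+h} - ∑ w_j X_{i-j}`, each score term is a fixed combination of products of
  -- two process values. The centering constants cancel (`hmean`) because score terms have mean
  -- zero.
  have h1 := (hpair (-c) h).sub (by norm_num) (LpBound.sum (by norm_num) (Finset.range m) fun j _ =>
    (hpair (-c) (-j)).const_mul (w j))
  have hall : ∀ᵐ ω ∂μ, ∀ t : ℤ, maProcess b ε (t + h) ω =
      ∑ j ∈ Finset.range m, w j * maProcess b ε (t - (j : ℤ)) ω + maPartial b ε h (t + h) ω :=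
    ae_all_iff.2 hdec
  have hL2 : ∀ t, MemLp (maProcess b ε t) 2 μ := fun t =>
    ((lpBound_maProcess hε hb (by norm_num) hK t).mono_exponent (q₁ := 2) (by norm_num)).memLp
  have hmean : ∀ t : ℤ, (∫ ω, maProcess b ε (t + -c) ω * maProcess b ε (t + h) ω ∂μ) -
      ∑ j ∈ Finset.range m, w j *
        ∫ ω, maProcess b ε (t + -c) ω * maProcess b ε (t + -j) ω ∂μ = 0 := by
    intro t
    have hi : ∀ j : ℕ, Integrable (fun ω => w j *
        (maProcess b ε (t + -c) ω * maProcess b ε (t + -j) ω)) μ := fun j =>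
      (integrable_mul_of_memLp_two (hL2 _) (hL2 _)).const_mul _
    rw [← integral_scoreTerm (b := b) hε h c t]
    simp only [← integral_const_mul]
    rw [← integral_finsetSum _ fun j _ => hi j, ← integral_sub
      (integrable_mul_of_memLp_two (hL2 _) (hL2 _)) (integrable_finsetSum _ fun j _ => hi j)]
    refine integral_congr_ae ?_
    filter_upwards [hall] with ω hω
    simp only [scoreTerm]
    rw [hω t, mul_add, Finset.mul_sum, ← sub_eq_add_neg]
    have : ∀ j : ℕ, w j * (maProcess b ε (t - c) ω * maProcess b ε (t + -j) ω) =
        maProcess b ε (t - c) ω * (w j * maProcess b ε (t - j) ω) := fun j => by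
      rw [← sub_eq_add_neg]; ring
    simp only [this]
    ring
  refine (h1.congr ?_).mono (le_of_eq ?_)
  · filter_upwards [hall] with ω hω
    simp only [Finset.mul_sum]
    rw [Finset.sum_comm (t := I), ← Finset.sum_sub_distrib, hI, Finset.sum_image hinj]
    refine Finset.sum_congr rfl fun i _ => ?_
    have h2 := hmean (i₀ + i)
    simp only [mul_sub, Finset.sum_sub_distrib]
    simp only [scoreTerm]
    rw [hω (i₀ + i), mul_add, Finset.mul_sum] at *
    have : ∀ j : ℕ, w j * (maProcess b ε (i₀ + i + -c) ω * maProcess b ε (i₀ + i + -j) ω) =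
        maProcess b ε (i₀ + i + -c) ω * (w j * maProcess b ε (i₀ + i - j) ω) := fun j => by
      rw [← sub_eq_add_neg, ← sub_eq_add_neg]; ring
    simp only [this]
    rw [← sub_eq_add_neg] at *
    linarith
  · rw [← Finset.sum_mul]
    ring

end MultistepAR
end

noncomputable section
namespace MultistepAR

variable {Ω : Type*} [mΩ : MeasurableSpace Ω] {μ : Measure Ω} {ε : ℤ → Ω → ℝ} {σ : ℝ}
  {b : ℕ → ℝ} {C ρ : ℝ}

/-! ### Asymptotic decoupling of the score and the last regressor -/

lemma LpBound.mul_four [IsProbabilityMeasure μ] {A A' T T' : Ω → ℝ} {α α' τ τ' : ℝ}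
    (hA : LpBound μ 8 A α) (hA' : LpBound μ 8 A' α') (hT : LpBound μ 4 T τ)
    (hT' : LpBound μ 4 T' τ') :
    LpBound μ 1 (fun ω => (A ω * A' ω) * (T ω * T' ω)) ((α * α') * (τ * τ')) := by
  have h1 : LpBound μ 4 _ _ := hA.mul hA'
  have h2 : LpBound μ 2 _ _ := hT.mul hT'
  exact (h1.mono_exponent (q₁ := 2) (by norm_num)).mul h2

/-- Below, `A` is an entry of the last regressor with recent part `P`; `U` and `V` are the early and
late parts of a score sum, and `Q` is the recent part of `V`. Replacing `A` by `P` costs `δ`,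
replacing `V` by `Q` in the cross terms costs `r`. Those cross terms then vanish, as `U` is centered
and independent of the rest; `P P' U U'` factorises, and `V V'` is only estimated. -/
lemma abs_integral_four_sub_le [IsProbabilityMeasure μ] (hε : ∀ t, Measurable (ε t))
    (hi : iIndepFun ε μ) {S T : Set ℤ} (hST : Disjoint S T)
    {A A' P P' U U' V V' Q Q' : Ω → ℝ} {D δ B₁ B₂ r : ℝ}
    (hA : LpBound μ 8 A D) (hA' : LpBound μ 8 A' D) (hP : LpBound μ 8 P D)
    (hP' : LpBound μ 8 P' D)
    (hd : LpBound μ 8 (fun ω => A ω - P ω) δ) (hd' : LpBound μ 8 (fun ω => A' ω - P' ω) δ)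
    (hU : LpBound μ 4 U B₁) (hU' : LpBound μ 4 U' B₁) (hV : LpBound μ 4 V B₂)
    (hV' : LpBound μ 4 V' B₂)
    (hr : LpBound μ 4 (fun ω => V ω - Q ω) r) (hr' : LpBound μ 4 (fun ω => V' ω - Q' ω) r)
    (mP : Measurable[noiseSigma ε T] P) (mP' : Measurable[noiseSigma ε T] P')
    (mU : Measurable[noiseSigma ε S] U) (mU' : Measurable[noiseSigma ε S] U')
    (mQ : Measurable[noiseSigma ε T] Q) (mQ' : Measurable[noiseSigma ε T] Q')
    (hU0 : ∫ ω, U ω ∂μ = 0) (hU0' : ∫ ω, U' ω ∂μ = 0) :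
    |(∫ ω, (A ω * A' ω) * ((U ω + V ω) * (U' ω + V' ω)) ∂μ) -
      (∫ ω, A ω * A' ω ∂μ) * ∫ ω, U ω * U' ω ∂μ| ≤
      2 * D * δ * ((B₁ + B₂) ^ 2 + B₁ ^ 2) + 2 * D ^ 2 * B₁ * r + D ^ 2 * B₂ ^ 2 := by
  have h1 : (1 : ENNReal) ≤ 1 := le_rfl
  have h4 : (1 : ENNReal) ≤ 4 := by norm_num
  have hW := hU.add h4 hV
  have hW' := hU'.add h4 hV'
  have hQ : LpBound μ 4 Q (B₂ + r) := (hV.sub h4 hr).congr (.of_forall fun ω => by simp)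
  have hQ' : LpBound μ 4 Q' (B₂ + r) := (hV'.sub h4 hr').congr (.of_forall fun ω => by simp)
  have e1 := hd.mul_four hA' hW hW'
  have e2 := hP.mul_four hd' hW hW'
  have e3 := hP.mul_four hP' hU hr'
  have e4 := hP.mul_four hP' hr hU'
  have e5 := hP.mul_four hP' hV hV'
  have i1 := hP.mul_four hP' hU hQ'
  have i2 := hP.mul_four hP' hQ hU'
  have i3 := hP.mul_four hP' hU hU'
  have z1 : ∫ ω, (P ω * P' ω) * (U ω * Q' ω) ∂μ = 0 := by
    have := integral_mul_of_noiseSigma hε hi hST mU ((mP.mul mP').mul mQ')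
    rw [hU0, zero_mul] at this
    rw [← this]
    exact integral_congr_ae (.of_forall fun ω => by simp only [Pi.mul_apply]; ring)
  have z2 : ∫ ω, (P ω * P' ω) * (Q ω * U' ω) ∂μ = 0 := by
    have := integral_mul_of_noiseSigma hε hi hST mU' ((mP.mul mP').mul mQ)
    rw [hU0', zero_mul] at this
    rw [← this]
    exact integral_congr_ae (.of_forall fun ω => by simp only [Pi.mul_apply]; ring)
  have z3 : ∫ ω, (P ω * P' ω) * (U ω * U' ω) ∂μ =
      (∫ ω, P ω * P' ω ∂μ) * ∫ ω, U ω * U' ω ∂μ :=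
    integral_mul_of_noiseSigma hε hi hST.symm (mP.mul mP') (mU.mul mU')
  have hAA : ∀ {f g : Ω → ℝ} {c d : ℝ}, LpBound μ 8 f c → LpBound μ 8 g d →
      LpBound μ 1 (fun ω => f ω * g ω) (c * d) := fun hf hg =>
    (LpBound.mul (r := 4) hf hg).mono_exponent (by norm_num)
  have hUU : LpBound μ 1 (fun ω => U ω * U' ω) (B₁ * B₁) :=
    (LpBound.mul (r := 2) hU hU').mono_exponent (by norm_num)
  have q1 : |(∫ ω, A ω * A' ω ∂μ) - ∫ ω, P ω * P' ω ∂μ| ≤ 2 * D * δ := by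
    rw [← integral_sub (hAA hA hA').integrable (hAA hP hP').integrable]
    refine ((((hAA hd hA').add h1 (hAA hP hd')).congr (.of_forall fun ω => ?_)).mono
      (le_of_eq ?_)).abs_integral_le
    · ring
    · ring
  have q2 : |(∫ ω, (A ω * A' ω) * ((U ω + V ω) * (U' ω + V' ω)) ∂μ) -
      (∫ ω, P ω * P' ω ∂μ) * ∫ ω, U ω * U' ω ∂μ| ≤
      2 * D * δ * (B₁ + B₂) ^ 2 + 2 * D ^ 2 * B₁ * r + D ^ 2 * B₂ ^ 2 := by
    have hsum := (((e1.add h1 e2).add h1 e3).add h1 e4).add h1 e5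
    have i12 := i1.add h1 i2
    have : (∫ ω, (A ω * A' ω) * ((U ω + V ω) * (U' ω + V' ω)) ∂μ) -
        (∫ ω, P ω * P' ω ∂μ) * ∫ ω, U ω * U' ω ∂μ =
        (∫ ω, (A ω * A' ω) * ((U ω + V ω) * (U' ω + V' ω)) ∂μ) -
        ∫ ω, ((P ω * P' ω) * (U ω * Q' ω) + (P ω * P' ω) * (Q ω * U' ω)) +
          (P ω * P' ω) * (U ω * U' ω) ∂μ := by
      rw [integral_add i12.integrable i3.integrable,
        integral_add i1.integrable i2.integrable, z1, z2, z3, zero_add, zero_add]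
    rw [this, ← integral_sub (hA.mul_four hA' hW hW').integrable
      (i12.add h1 i3).integrable]
    refine ((hsum.congr (.of_forall fun ω => ?_)).mono (le_of_eq ?_)).abs_integral_le
    · ring
    · ring
  have q3 := hUU.abs_integral_le
  have hDδ : 0 ≤ 2 * D * δ := mul_nonneg (mul_nonneg zero_le_two hA.nonneg) hd.nonneg
  calc _ = |((∫ ω, (A ω * A' ω) * ((U ω + V ω) * (U' ω + V' ω)) ∂μ) -
      (∫ ω, P ω * P' ω ∂μ) * ∫ ω, U ω * U' ω ∂μ) -
      ((∫ ω, A ω * A' ω ∂μ) - ∫ ω, P ω * P' ω ∂μ) * ∫ ω, U ω * U' ω ∂μ| := by ring_nf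
    _ ≤ _ := abs_sub _ _
    _ ≤ (2 * D * δ * (B₁ + B₂) ^ 2 + 2 * D ^ 2 * B₁ * r + D ^ 2 * B₂ ^ 2) +
        2 * D * δ * (B₁ * B₁) := by
      rw [abs_mul]
      exact add_le_add q2 (mul_le_mul q1 q3 (abs_nonneg _) hDδ)
    _ = _ := by ring

/-! ### Truncating the process and the score at a time `τ`. -/

/-- The part of `X_s` that depends on the noises after time `τ` only. -/
def maRecent (b : ℕ → ℝ) (ε : ℤ → Ω → ℝ) (τ s : ℤ) (ω : Ω) : ℝ :=
  maPartial b ε (s - τ).toNat s ω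

lemma measurable_maRecent (b : ℕ → ℝ) (ε : ℤ → Ω → ℝ) (τ s : ℤ) :
    Measurable[noiseSigma ε (Set.Ioi τ)] (maRecent b ε τ s) :=
  measurable_maPartial b ε fun j hj => by simp only [Set.mem_Ioi]; omega

/-- The slack `d` absorbs fixed lags at the price of `ρ ^ (-d)`. It also covers `s < τ`, where
`toNat` makes the recent part zero. -/
lemma lpBound_maProcess_sub_maRecent [IsProbabilityMeasure μ] (hε : IsIIDNoise μ ε σ)
    (hb : GeomDecay b C ρ) {q : ENNReal} (hq : 1 ≤ q) {K : ℝ} (hK : LpBound μ q (ε 1) K)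
    {τ s : ℤ} {j d : ℕ} (hj : (j : ℤ) ≤ s - τ + d) :
    LpBound μ q (fun ω => maProcess b ε s ω - maRecent b ε τ s ω)
      (C / (1 - ρ) * K * (ρ ^ d)⁻¹ * ρ ^ j) := by
  refine (lpBound_maProcess_sub hε hb hq hK _ s).mono ?_
  have h1 : ρ ^ (s - τ).toNat * ρ ^ d ≤ ρ ^ j := by
    rw [← pow_add]
    exact pow_le_pow_of_le_one hb.ρ_pos.le hb.ρ_lt_one.le (by omega)
  have h2 : ρ ^ (s - τ).toNat ≤ (ρ ^ d)⁻¹ * ρ ^ j := by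
    rw [inv_mul_eq_div, le_div_iff₀ (pow_pos hb.ρ_pos d)]
    exact h1
  have h3 := mul_le_mul_of_nonneg_left h2 (mul_nonneg hb.const_nonneg hK.nonneg)
  linarith

/-- The part of the score terms that depends on the noises after time `τ` only. -/
def scoreRecent (b : ℕ → ℝ) (ε : ℤ → Ω → ℝ) (h c : ℕ) (τ i : ℤ) (ω : Ω) : ℝ :=
  maRecent b ε τ (i - c) ω * maPartial b ε h (i + h) ω

lemma measurable_scoreRecent (b : ℕ → ℝ) (ε : ℤ → Ω → ℝ) (h c : ℕ) (τ i : ℤ) :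
    Measurable[noiseSigma ε (Set.Ioi τ)] (scoreRecent b ε h c τ i) := by
  -- For `i < τ` the forecast error may contain noises up to `τ`, but then the recent part of the
  -- regressor is an empty sum.
  by_cases hi : τ ≤ i
  · exact (measurable_maRecent b ε τ _).mul
      (measurable_maPartial b ε fun j hj => by simp only [Set.mem_Ioi]; omega)
  · have : scoreRecent b ε h c τ i = fun _ => 0 := by
      ext ω
      simp [scoreRecent, maRecent, maPartial, show (i - c - τ).toNat = 0 by omega]
    rw [this]
    exact measurable_const

lemma pow_mul_succ_sq_le {ρ : ℝ} (h0 : 0 < ρ) (h1 : ρ < 1) :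
    ∃ B : ℝ, 0 ≤ B ∧ ∀ m : ℕ, ρ ^ m * ((m : ℝ) + 1) ^ 2 ≤ B := by
  have h := (summable_pow_mul_geometric_of_norm_lt_one 2
    (show ‖ρ‖ < 1 by rwa [Real.norm_of_nonneg h0.le])).tendsto_atTop_zero
  obtain ⟨B, hB⟩ := h.bddAbove_range
  refine ⟨B * ρ⁻¹, mul_nonneg ?_ (inv_nonneg.2 h0.le), fun m => ?_⟩
  · exact le_trans (by positivity) (hB ⟨0, rfl⟩)
  · have := hB ⟨m + 1, rfl⟩
    simp only at this
    rw [← div_eq_mul_inv, le_div_iff₀ h0]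
    calc _ = ((m + 1 : ℕ) : ℝ) ^ 2 * ρ ^ (m + 1) := by push_cast; ring
      _ ≤ B := this

-- The last `l = ⌊√J⌋` score terms act as a buffer. Given the noises after the early terms, the
-- regressor is known up to `ρ ^ l`, which outweighs the growth `J` of the squared score. The
-- squared late part, the mixed terms and the `l` terms missing from the main term are each `O(√J)`.
set_option maxHeartbeats 800000 in
lemma exists_abs_integral_score_sub_le [IsProbabilityMeasure μ] (hε : IsIIDNoise μ ε σ)
    (hb : GeomDecay b C ρ) {K : ℝ} (hK : LpBound μ 8 (ε 1) K) {g : ℤ → ℝ}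
    (hg : ∀ u v, ∫ ω, maProcess b ε u ω * maProcess b ε v ω ∂μ = g (u - v)) {h m : ℕ} {w : ℕ → ℝ}
    (hdec : ∀ t : ℤ, ∀ᵐ ω ∂μ, maProcess b ε (t + h) ω =
      ∑ j ∈ Finset.range m, w j * maProcess b ε (t - (j : ℤ)) ω + maPartial b ε h (t + h) ω)
    (p q c d : ℕ) :
    ∃ B : ℝ, 0 ≤ B ∧ ∀ (i₀ : ℤ) (J : ℕ),
      |(∫ ω, (maProcess b ε (i₀ + J + h - 1 - p) ω * maProcess b ε (i₀ + J + h - 1 - q) ω) *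
        ((∑ i ∈ Finset.range J, scoreTerm b ε h c (i₀ + i) ω) *
        ∑ i ∈ Finset.range J, scoreTerm b ε h d (i₀ + i) ω) ∂μ) -
        J * (g ((q : ℤ) - p) * scoreCov b σ g h c d)| ≤ B * (1 + √J) := by
  have hq8 : (1 : ENNReal) ≤ 8 := by norm_num
  obtain ⟨Bc, hBc0, hBc⟩ := exists_lpBound_score hε hb hK hdec c
  obtain ⟨Bd, hBd0, hBd⟩ := exists_lpBound_score hε hb hK hdec d
  obtain ⟨B₀, hB₀0, hB₀⟩ := exists_integral_score_sub_le hε hb hK hg h c d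
  obtain ⟨Bρ, hBρ0, hBρ⟩ := pow_mul_succ_sq_le hb.ρ_pos hb.ρ_lt_one
  set D := C / (1 - ρ) * K with hD
  have hD0 : 0 ≤ D := mul_nonneg hb.const_nonneg hK.nonneg
  set V := scoreCov b σ g h c d with hV
  set E := D * (ρ ^ (p + q))⁻¹ with hE
  have hρ1 : 0 < 1 - ρ := by linarith [hb.ρ_lt_one]
  have hE0 : 0 ≤ E := mul_nonneg hD0 (inv_nonneg.2 (pow_nonneg hb.ρ_pos.le _))
  set r := D * (ρ ^ (h + c + d))⁻¹ * D / (1 - ρ) with hr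
  have hr0 : 0 ≤ r := div_nonneg (mul_nonneg (mul_nonneg hD0
    (inv_nonneg.2 (pow_nonneg hb.ρ_pos.le _))) hD0) hρ1.le
  set Bs := Bc + Bd with hBs
  have hBs0 : 0 ≤ Bs := add_nonneg hBc0 hBd0
  refine ⟨2 * D * E * (5 * Bs ^ 2 * Bρ) + 2 * D ^ 2 * Bs * r + D ^ 2 * Bs ^ 2 +
    |g ((q : ℤ) - p)| * (B₀ + |V|), by positivity, fun i₀ J => ?_⟩
  set l := Nat.sqrt J with hl
  obtain ⟨N, hN⟩ : ∃ N, J = N + l := ⟨J - l, by have := Nat.sqrt_le_self J; omega⟩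
  -- The last noise time in the first `N` score terms: their indices end at `i₀ + N - 1`, and
  -- forecast errors reach `h` further.
  set τ : ℤ := i₀ + N + h - 1 with hτ
  have hlJ : (l : ℝ) ≤ √J := by
    rw [Real.le_sqrt (by positivity) (by positivity)]
    have := Nat.sqrt_le' J
    exact_mod_cast this
  have hJl : (J : ℝ) ≤ ((l : ℝ) + 1) ^ 2 := by
    have := (Nat.lt_succ_sqrt' J).le
    exact_mod_cast this
  have hsqrtN : √(N : ℝ) ≤ √J := Real.sqrt_le_sqrt (by rw [hN]; push_cast; linarith [(Nat.cast_nonneg l : (0:ℝ) ≤ l)])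
  have hsqrtl : √(l : ℝ) ≤ √J := Real.sqrt_le_sqrt (by rw [hN]; push_cast; linarith [(Nat.cast_nonneg N : (0:ℝ) ≤ N)])
  have hrecent : ∀ s, LpBound μ 8 (maRecent b ε τ s) D := fun s =>
    lpBound_maPartial hε hb hq8 hK _ s
  have hproc : ∀ s, LpBound μ 8 (maProcess b ε s) D := fun s => lpBound_maProcess hε hb hq8 hK s
  have hsub : ∀ v : ℕ, v ≤ p + q → LpBound μ 8 (fun ω => maProcess b ε (i₀ + J + h - 1 - v) ω -
      maRecent b ε τ (i₀ + J + h - 1 - v) ω) (E * ρ ^ l) := fun v hv =>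
    lpBound_maProcess_sub_maRecent hε hb hq8 hK (by rw [hN]; push_cast; omega)
  have hscore : ∀ e : ℕ, e ≤ c + d → LpBound μ 4 (fun ω =>
      (∑ i ∈ Finset.range l, scoreTerm b ε h e (i₀ + N + i) ω) -
      ∑ i ∈ Finset.range l, scoreRecent b ε h e τ (i₀ + N + i) ω) r := by
    intro e he
    have h1 := LpBound.sum (μ := μ) (q := 4) (by norm_num) (Finset.range l) fun i _ =>
      LpBound.mul (r := 4) (lpBound_maProcess_sub_maRecent hε hb hq8 hK (τ := τ)
        (s := i₀ + N + (i : ℤ) - e) (j := i) (d := h + c + d) (by push_cast; omega))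
        (lpBound_maPartial hε hb hq8 hK h (i₀ + N + (i : ℤ) + h))
    refine (h1.mono ?_).congr (.of_forall fun ω => ?_)
    · rw [← Finset.sum_mul, ← Finset.mul_sum, ← hD, mul_right_comm]
      have h2 : ∑ i ∈ Finset.range l, ρ ^ i ≤ 1 / (1 - ρ) := by
        have := geom_sum_Ico_le_of_lt_one (m := 0) (n := l) hb.ρ_pos.le hb.ρ_lt_one
        rwa [← Finset.range_eq_Ico, pow_zero] at this
      rw [show r = D * (ρ ^ (h + c + d))⁻¹ * D * (1 / (1 - ρ)) by rw [hr]; ring]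
      have h3 : 0 ≤ D * (ρ ^ (h + c + d))⁻¹ * D := mul_nonneg (mul_nonneg hD0
        (inv_nonneg.2 (pow_nonneg hb.ρ_pos.le _))) hD0
      exact mul_le_mul_of_nonneg_left h2 h3
    · simp only [← Finset.sum_sub_distrib]
      refine Finset.sum_congr rfl fun i _ => ?_
      simp only [scoreTerm, scoreRecent]
      ring
  have hBound : ∀ e B', (∀ (i₀ : ℤ) (J : ℕ),
      LpBound μ 4 (fun ω => ∑ i ∈ Finset.range J, scoreTerm b ε h e (i₀ + i) ω) (B' * √J)) →
      B' ≤ Bs → LpBound μ 4 (fun ω => ∑ i ∈ Finset.range N, scoreTerm b ε h e (i₀ + i) ω)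
        (Bs * √J) ∧ LpBound μ 4 (fun ω => ∑ i ∈ Finset.range l,
          scoreTerm b ε h e (i₀ + N + i) ω) (Bs * √l) := by
    intro e B' hB' hle
    exact ⟨(hB' i₀ N).mono (mul_le_mul hle hsqrtN (Real.sqrt_nonneg _) hBs0),
      (hB' (i₀ + N) l).mono (mul_le_mul_of_nonneg_right hle (Real.sqrt_nonneg _))⟩
  have mU : ∀ e : ℕ, Measurable[noiseSigma ε (Set.Iic τ)]
      fun ω => ∑ i ∈ Finset.range N, scoreTerm b ε h e (i₀ + i) ω := fun e =>
    Finset.measurable_sum _ fun i hi => measurable_scoreTerm b ε h e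
      (by have := Finset.mem_range.1 hi; omega)
  have mV : ∀ e : ℕ, Measurable[noiseSigma ε (Set.Ioi τ)]
      fun ω => ∑ i ∈ Finset.range l, scoreRecent b ε h e τ (i₀ + N + i) ω := fun e =>
    Finset.measurable_sum _ fun i _ => measurable_scoreRecent b ε h e τ _
  have hU0 : ∀ e : ℕ, ∫ ω, ∑ i ∈ Finset.range N, scoreTerm b ε h e (i₀ + i) ω ∂μ = 0 := by
    intro e
    rw [integral_finsetSum _ fun i _ => ?_]
    · exact Finset.sum_eq_zero fun i _ => integral_scoreTerm hε h e _
    · have := LpBound.mul (r := 4) (hproc (i₀ + (i : ℤ) - e))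
        (lpBound_maPartial hε hb hq8 hK h (i₀ + (i : ℤ) + h))
      exact (this.mono_exponent (q₁ := 1) (by norm_num)).integrable
  have hc := hBound c Bc hBc (by linarith)
  have hd := hBound d Bd hBd (by linarith)
  have main := abs_integral_four_sub_le hε.measurable hε.indep (S := Set.Iic τ) (T := Set.Ioi τ)
    (by rw [Set.disjoint_left]; intro j hj hj'; simp at hj hj'; omega)
    (hproc _) (hproc _) (hrecent _) (hrecent _) (hsub p (by omega)) (hsub q (by omega))
    hc.1 hd.1 hc.2 hd.2 (hscore c (by omega)) (hscore d (by omega))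
    (measurable_maRecent b ε τ _) (measurable_maRecent b ε τ _) (mU c) (mU d) (mV c) (mV d)
    (hU0 c) (hU0 d)
  have hsplit : ∀ (e : ℕ) (ω : Ω), ∑ i ∈ Finset.range J, scoreTerm b ε h e (i₀ + i) ω =
      ∑ i ∈ Finset.range N, scoreTerm b ε h e (i₀ + i) ω +
        ∑ i ∈ Finset.range l, scoreTerm b ε h e (i₀ + N + i) ω := by
    intro e ω
    rw [hN, Finset.sum_range_add]
    simp only [Nat.cast_add, add_assoc]
  simp only [hsplit]
  have hgpq : ∫ ω, maProcess b ε (i₀ + J + h - 1 - p) ω * maProcess b ε (i₀ + J + h - 1 - q) ω ∂μ =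
      g ((q : ℤ) - p) := by
    rw [hg]
    congr 1
    ring
  rw [hgpq] at main
  set I := ∫ ω, (maProcess b ε (i₀ + J + h - 1 - p) ω * maProcess b ε (i₀ + J + h - 1 - q) ω) *
        ((∑ i ∈ Finset.range N, scoreTerm b ε h c (i₀ + i) ω +
        ∑ i ∈ Finset.range l, scoreTerm b ε h c (i₀ + N + i) ω) *
        (∑ i ∈ Finset.range N, scoreTerm b ε h d (i₀ + i) ω +
        ∑ i ∈ Finset.range l, scoreTerm b ε h d (i₀ + N + i) ω)) ∂μ
  have h0 := hB₀ i₀ N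
  set I₀ := ∫ ω, (∑ i ∈ Finset.range N, scoreTerm b ε h c (i₀ + i) ω) *
        (∑ i ∈ Finset.range N, scoreTerm b ε h d (i₀ + i) ω) ∂μ
  have hNJ : (N : ℝ) = J - l := by rw [hN]; push_cast; ring
  have e1 : |I - J * (g ((q : ℤ) - p) * V)| ≤ |I - g ((q : ℤ) - p) * I₀| +
      |g ((q : ℤ) - p)| * (|I₀ - N * V| + l * |V|) := by
    calc _ = |(I - g ((q : ℤ) - p) * I₀) + g ((q : ℤ) - p) * ((I₀ - N * V) - l * V)| := by
          rw [hNJ]; ring_nf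
      _ ≤ _ := by
        refine (abs_add_le _ _).trans (add_le_add le_rfl ?_)
        rw [abs_mul]
        refine mul_le_mul_of_nonneg_left ((abs_sub _ _).trans (le_of_eq ?_)) (abs_nonneg _)
        rw [abs_mul, Nat.abs_cast]
  refine e1.trans ?_
  have hsJ : 0 ≤ √(J : ℝ) := Real.sqrt_nonneg _
  have hJ2 : √(J : ℝ) ^ 2 = J := Real.sq_sqrt (by positivity)
  have hl2 : √(l : ℝ) ^ 2 = l := Real.sq_sqrt (by positivity)
  have b1 : 2 * D * (E * ρ ^ l) * ((Bs * √J + Bs * √l) ^ 2 + (Bs * √J) ^ 2) ≤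
      2 * D * E * (5 * Bs ^ 2 * Bρ) := by
    have h1 : (Bs * √J + Bs * √l) ^ 2 + (Bs * √J) ^ 2 ≤ 5 * Bs ^ 2 * ((l : ℝ) + 1) ^ 2 := by
      have h2 : (Bs * √J + Bs * √l) ^ 2 ≤ (2 * (Bs * √J)) ^ 2 := by
        refine pow_le_pow_left₀ (by positivity) ?_ 2
        linarith [mul_le_mul_of_nonneg_left hsqrtl hBs0]
      have h3 : (Bs * √(J : ℝ)) ^ 2 ≤ Bs ^ 2 * ((l : ℝ) + 1) ^ 2 := by
        rw [mul_pow Bs, hJ2]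
        exact mul_le_mul_of_nonneg_left hJl (sq_nonneg _)
      nlinarith
    calc _ ≤ 2 * D * (E * ρ ^ l) * (5 * Bs ^ 2 * ((l : ℝ) + 1) ^ 2) := by
          refine mul_le_mul_of_nonneg_left h1 ?_
          have := pow_nonneg hb.ρ_pos.le l
          positivity
      _ = 2 * D * E * (5 * Bs ^ 2 * (ρ ^ l * ((l : ℝ) + 1) ^ 2)) := by ring
      _ ≤ _ := by
        refine mul_le_mul_of_nonneg_left ?_ (by positivity)
        exact mul_le_mul_of_nonneg_left (hBρ l) (by positivity)
  have b2 : |g ((q : ℤ) - p)| * (|I₀ - N * V| + l * |V|) ≤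
      |g ((q : ℤ) - p)| * (B₀ + |V|) * (1 + √J) := by
    rw [mul_assoc]
    refine mul_le_mul_of_nonneg_left ?_ (abs_nonneg _)
    have h1 : (l : ℝ) * |V| ≤ √J * |V| := mul_le_mul_of_nonneg_right hlJ (abs_nonneg _)
    have h2 : (B₀ + |V|) * (1 + √J) = B₀ + |V| + B₀ * √J + √J * |V| := by ring
    linarith [mul_nonneg hB₀0 hsJ, abs_nonneg V]
  have b3 : D ^ 2 * (Bs * √l) ^ 2 ≤ D ^ 2 * Bs ^ 2 * √J := by
    rw [mul_pow Bs, hl2, ← mul_assoc]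
    exact mul_le_mul_of_nonneg_left hlJ (by positivity)
  have b4 : 2 * D ^ 2 * (Bs * √J) * r = 2 * D ^ 2 * Bs * r * √J := by ring
  have p1 : 0 ≤ 2 * D * E * (5 * Bs ^ 2 * Bρ) * √J := by positivity
  have p2 : 0 ≤ 2 * D ^ 2 * Bs * r := by positivity
  have p3 : 0 ≤ D ^ 2 * Bs ^ 2 := by positivity
  refine (add_le_add main b2).trans ?_
  have b5 : (2 * D * E * (5 * Bs ^ 2 * Bρ) + 2 * D ^ 2 * Bs * r + D ^ 2 * Bs ^ 2 +
      |g ((q : ℤ) - p)| * (B₀ + |V|)) * (1 + √J) =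
      2 * D * E * (5 * Bs ^ 2 * Bρ) + 2 * D * E * (5 * Bs ^ 2 * Bρ) * √J +
      (2 * D ^ 2 * Bs * r + 2 * D ^ 2 * Bs * r * √J) + (D ^ 2 * Bs ^ 2 + D ^ 2 * Bs ^ 2 * √J) +
      |g ((q : ℤ) - p)| * (B₀ + |V|) * (1 + √J) := by ring
  rw [b5, b4]
  linarith

end MultistepAR
end

noncomputable section
namespace MultistepAR

variable {Ω : Type*} [mΩ : MeasurableSpace Ω] {μ : Measure Ω} {ε : ℤ → Ω → ℝ} {σ : ℝ}
  {b : ℕ → ℝ} {C ρ : ℝ}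

/-! ### Perturbation of a quadratic form in an inverse matrix -/

section LinearAlgebra

variable {k : ℕ}

/-- The sum of the absolute values of the entries of a matrix. -/
def entrySum (A : Matrix (Fin k) (Fin k) ℝ) : ℝ := ∑ i, ∑ j, |A i j|

lemma entrySum_nonneg (A : Matrix (Fin k) (Fin k) ℝ) : 0 ≤ entrySum A :=
  Finset.sum_nonneg fun _ _ => Finset.sum_nonneg fun _ _ => abs_nonneg _

lemma zero_le_dotProduct_self (v : Fin k → ℝ) : 0 ≤ v ⬝ᵥ v :=
  Finset.sum_nonneg fun i _ => mul_self_nonneg (v i)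

lemma abs_dotProduct_le (v w : Fin k → ℝ) : |v ⬝ᵥ w| ≤ √(v ⬝ᵥ v) * √(w ⬝ᵥ w) := by
  rw [← Real.sqrt_mul (zero_le_dotProduct_self v)]
  refine Real.abs_le_sqrt ?_
  simpa [dotProduct, sq] using Finset.sum_mul_sq_le_sq_mul_sq Finset.univ v w

lemma sqrt_mulVec_le (B : Matrix (Fin k) (Fin k) ℝ) (w : Fin k → ℝ) :
    √((B *ᵥ w) ⬝ᵥ (B *ᵥ w)) ≤ entrySum B * √(w ⬝ᵥ w) := by
  have h1 : ∑ i, ∑ j, B i j ^ 2 ≤ entrySum B ^ 2 := by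
    have h2 : ∀ i, ∑ j, B i j ^ 2 ≤ (∑ j, |B i j|) ^ 2 := fun i => by
      simpa using Finset.sum_sq_le_sq_sum_of_nonneg (s := Finset.univ)
        (f := fun j => |B i j|) fun j _ => abs_nonneg _
    refine (Finset.sum_le_sum fun i _ => h2 i).trans ?_
    exact Finset.sum_sq_le_sq_sum_of_nonneg fun i _ => Finset.sum_nonneg fun j _ => abs_nonneg _
  rw [Real.sqrt_le_left (mul_nonneg (entrySum_nonneg B) (Real.sqrt_nonneg _)), mul_pow,
    Real.sq_sqrt (zero_le_dotProduct_self w)]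
  exact (dotProduct_mulVec_self_le B w).trans
    (mul_le_mul_of_nonneg_right h1 (zero_le_dotProduct_self w))

lemma sqrt_le_inv_mul_of_lower_bound {A : Matrix (Fin k) (Fin k) ℝ} {l : ℝ} (hl : 0 < l)
    (hA : ∀ v : Fin k → ℝ, l * (v ⬝ᵥ v) ≤ v ⬝ᵥ (A *ᵥ v)) (y : Fin k → ℝ) :
    √(y ⬝ᵥ y) ≤ l⁻¹ * √((A *ᵥ y) ⬝ᵥ (A *ᵥ y)) := by
  have h1 := (hA y).trans ((le_abs_self _).trans (abs_dotProduct_le y (A *ᵥ y)))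
  have h2 := Real.mul_self_sqrt (zero_le_dotProduct_self y : 0 ≤ y ⬝ᵥ y)
  rcases (Real.sqrt_nonneg (y ⬝ᵥ y)).eq_or_lt with h0 | h0
  · rw [← h0]
    exact mul_nonneg (inv_nonneg.2 hl.le) (Real.sqrt_nonneg _)
  · rw [inv_mul_eq_div, le_div_iff₀ hl]
    refine le_of_mul_le_mul_left ?_ h0
    calc _ = l * (√(y ⬝ᵥ y) * √(y ⬝ᵥ y)) := by ring
      _ ≤ _ := by rw [h2]; exact h1

lemma isUnit_det_of_lower_bound {A : Matrix (Fin k) (Fin k) ℝ} {l : ℝ} (hl : 0 < l)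
    (hA : ∀ v : Fin k → ℝ, l * (v ⬝ᵥ v) ≤ v ⬝ᵥ (A *ᵥ v)) : IsUnit A.det := by
  rw [isUnit_iff_ne_zero]
  intro h0
  obtain ⟨v, hv, hAv⟩ := Matrix.exists_mulVec_eq_zero_iff.2 h0
  have h1 := hA v
  rw [hAv, dotProduct_zero] at h1
  exact hv (dotProduct_self_eq_zero.1 (le_antisymm (nonpos_of_mul_nonpos_right h1 hl)
    (zero_le_dotProduct_self v)))

/-- With `u = A⁻¹ T` and `v = Γ⁻¹ T` one has `A (v - u) = (A - Γ) v`, so `v - u` is small; then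
factor the difference of squares. The factor `(1 + l⁻¹)²` is distributed over the entries of `x` so
that each product `x i * (1 + l⁻¹)` can be placed in `L⁸`. -/
lemma abs_quadratic_inv_sub_le {A Γ : Matrix (Fin k) (Fin k) ℝ} {l : ℝ} (hl : 0 < l)
    (hA : ∀ v : Fin k → ℝ, l * (v ⬝ᵥ v) ≤ v ⬝ᵥ (A *ᵥ v)) (hΓ : IsUnit Γ.det) (x T : Fin k → ℝ) :
    |(x ⬝ᵥ (A⁻¹ *ᵥ T)) ^ 2 - (x ⬝ᵥ (Γ⁻¹ *ᵥ T)) ^ 2| ≤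
      (1 + entrySum Γ⁻¹) ^ 2 *
        (((∑ i, (x i * (1 + l⁻¹)) * (x i * (1 + l⁻¹))) * entrySum (A - Γ)) * ∑ i, T i * T i) := by
  have hAu := isUnit_det_of_lower_bound hl hA
  set u := A⁻¹ *ᵥ T with hu
  set v := Γ⁻¹ *ᵥ T with hv
  set g := entrySum Γ⁻¹
  set Δ := entrySum (A - Γ)
  have hg : 0 ≤ g := entrySum_nonneg _
  have hΔ : 0 ≤ Δ := entrySum_nonneg _
  have hl' : 0 < l⁻¹ := inv_pos.2 hl
  have hAu' : A *ᵥ u = T := by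
    rw [hu, Matrix.mulVec_mulVec, Matrix.mul_nonsing_inv _ hAu, Matrix.one_mulVec]
  have hΓv : Γ *ᵥ v = T := by
    rw [hv, Matrix.mulVec_mulVec, Matrix.mul_nonsing_inv _ hΓ, Matrix.one_mulVec]
  have huv : A *ᵥ (v - u) = (A - Γ) *ᵥ v := by
    rw [Matrix.mulVec_sub, Matrix.sub_mulVec, hAu', hΓv]
  have hX := Real.sqrt_nonneg (x ⬝ᵥ x)
  have hT := Real.sqrt_nonneg (T ⬝ᵥ T)
  have bv : √(v ⬝ᵥ v) ≤ g * √(T ⬝ᵥ T) := sqrt_mulVec_le _ _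
  have bu : √(u ⬝ᵥ u) ≤ l⁻¹ * √(T ⬝ᵥ T) := by
    have := sqrt_le_inv_mul_of_lower_bound hl hA u
    rwa [hAu'] at this
  have bd : √((v - u) ⬝ᵥ (v - u)) ≤ l⁻¹ * (Δ * (g * √(T ⬝ᵥ T))) := by
    refine (sqrt_le_inv_mul_of_lower_bound hl hA _).trans ?_
    rw [huv]
    exact mul_le_mul_of_nonneg_left ((sqrt_mulVec_le _ _).trans
      (mul_le_mul_of_nonneg_left bv hΔ)) hl'.le
  have e1 : |x ⬝ᵥ (v - u)| ≤ √(x ⬝ᵥ x) * (l⁻¹ * (Δ * (g * √(T ⬝ᵥ T)))) :=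
    (abs_dotProduct_le _ _).trans (mul_le_mul_of_nonneg_left bd hX)
  have e2 : |x ⬝ᵥ u + x ⬝ᵥ v| ≤ √(x ⬝ᵥ x) * ((l⁻¹ + g) * √(T ⬝ᵥ T)) := by
    refine (abs_add_le _ _).trans ((add_le_add (abs_dotProduct_le _ _)
      (abs_dotProduct_le _ _)).trans ?_)
    rw [← mul_add, add_mul]
    exact mul_le_mul_of_nonneg_left (add_le_add bu bv) hX
  have hxx : x ⬝ᵥ x = √(x ⬝ᵥ x) * √(x ⬝ᵥ x) :=
    (Real.mul_self_sqrt (zero_le_dotProduct_self x)).symm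
  have hTT : T ⬝ᵥ T = √(T ⬝ᵥ T) * √(T ⬝ᵥ T) :=
    (Real.mul_self_sqrt (zero_le_dotProduct_self T)).symm
  calc _ = |x ⬝ᵥ (v - u)| * |x ⬝ᵥ u + x ⬝ᵥ v| := by
        rw [← abs_mul, dotProduct_sub, abs_sub_comm]
        congr 1
        ring
    _ ≤ _ := mul_le_mul e1 e2 (abs_nonneg _) (by positivity)
    _ = (g * (l⁻¹ * (l⁻¹ + g))) * ((x ⬝ᵥ x) * Δ * (T ⬝ᵥ T)) := by
        conv_rhs => rw [hxx, hTT]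
        ring
    _ ≤ ((1 + g) ^ 2 * (1 + l⁻¹) ^ 2) * ((x ⬝ᵥ x) * Δ * (T ⬝ᵥ T)) := by
        refine mul_le_mul_of_nonneg_right ?_ (mul_nonneg (mul_nonneg
          (zero_le_dotProduct_self x) hΔ) (zero_le_dotProduct_self T))
        have h1 : 0 ≤ g * l⁻¹ := by positivity
        have h2 : (1 + g) ^ 2 * (1 + l⁻¹) ^ 2 = ((1 + g) * (1 + l⁻¹)) ^ 2 := by ring
        have h3 : g * l⁻¹ ≤ (1 + g) * (1 + l⁻¹) := by nlinarith
        have h4 : l⁻¹ + g ≤ (1 + g) * (1 + l⁻¹) := by nlinarith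
        rw [h2, sq, ← mul_assoc]
        exact mul_le_mul h3 h4 (by positivity) (by positivity)
    _ = _ := by
        have : ∑ i, (x i * (1 + l⁻¹)) * (x i * (1 + l⁻¹)) = (1 + l⁻¹) ^ 2 * (x ⬝ᵥ x) := by
          rw [dotProduct, Finset.mul_sum]
          exact Finset.sum_congr rfl fun i _ => by ring
        rw [this, show ∑ i, T i * T i = T ⬝ᵥ T from rfl]
        ring

lemma measurable_matrix_inv {α : Type*} [MeasurableSpace α]
    {A : α → Matrix (Fin k) (Fin k) ℝ} (hA : ∀ i j, Measurable fun w => A w i j) (i j : Fin k) :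
    Measurable fun w => (A w)⁻¹ i j := by
  simp only [Matrix.inv_def, Matrix.smul_apply, Ring.inverse_eq_inv', smul_eq_mul,
    Matrix.adjugate_apply]
  refine (measurable_matrix_det hA).inv.mul (measurable_matrix_det fun i' j' => ?_)
  simp only [Matrix.updateRow_apply]
  split_ifs
  · exact measurable_const
  · exact hA _ _

end LinearAlgebra

/-! ### Hölder's inequality with high moments -/

/-- The excess `δ` in the moment condition pays for the inverse eigenvalue: `1/8 = 1/(8+δ) + 1/s`
with `s = 8 (8 + δ) / δ`, and any integer `q > s` will do. -/
lemma exists_lpBound_mul_eight [IsProbabilityMeasure μ] {δ : ℝ} (hδ : 0 < δ) :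
    ∃ q : ℕ, q ≠ 0 ∧ ∀ {f g : Ω → ℝ} {A B : ℝ}, LpBound μ (ENNReal.ofReal (8 + δ)) f A →
      LpBound μ q g B → LpBound μ 8 (fun ω => f ω * g ω) (A * B) := by
  set s : ℝ := 8 * (8 + δ) / δ with hs
  have hs0 : 0 < s := by positivity
  have : ENNReal.HolderTriple (ENNReal.ofReal (8 + δ)) (ENNReal.ofReal s) 8 := ⟨by
    rw [← ENNReal.ofReal_inv_of_pos (by positivity), ← ENNReal.ofReal_inv_of_pos hs0,
      ← ENNReal.ofReal_add (by positivity) (by positivity),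
      show (8 : ENNReal) = ENNReal.ofReal 8 by norm_num,
      ← ENNReal.ofReal_inv_of_pos (by norm_num)]
    congr 1
    rw [hs]
    field_simp⟩
  obtain ⟨q, hq⟩ := exists_nat_gt s
  refine ⟨q, by rintro rfl; simp at hq; linarith, fun hf hg => ?_⟩
  refine hf.mul (hg.mono_exponent (q₁ := ENNReal.ofReal s) ?_)
  rw [← ENNReal.ofReal_natCast]
  exact ENNReal.ofReal_le_ofReal hq.le

end MultistepAR
end

noncomputable section
namespace MultistepAR

variable {Ω : Type*} [mΩ : MeasurableSpace Ω] {μ : Measure Ω} {ε : ℤ → Ω → ℝ} {σ : ℝ}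
  {b : ℕ → ℝ} {C ρ : ℝ}

/-! ### The error of the direct predictor -/

/-- The score vector of the direct regression. -/
def scoreVec (b : ℕ → ℝ) (ε : ℤ → Ω → ℝ) (h k N : ℕ) (ω : Ω) : Fin k → ℝ :=
  fun i => ∑ j ∈ Finset.range N, scoreTerm b ε h i ((k : ℤ) + j) ω

lemma sum_Icc_eq_sum_range {M : Type*} [AddCommMonoid M] {h k n : ℕ} (hn : h + k ≤ n) (f : ℤ → M) :
    ∑ j ∈ Finset.Icc k (n - h), f j = ∑ j ∈ Finset.range (n + 1 - h - k), f ((k : ℤ) + j) := by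
  have : Finset.Icc k (n - h) = Finset.Ico k (k + (n + 1 - h - k)) := by
    ext j
    simp only [Finset.mem_Icc, Finset.mem_Ico]
    omega
  rw [this, Finset.sum_Ico_eq_sum_range, Nat.add_sub_cancel_left]
  simp only [Nat.cast_add]

lemma cast_sample_size {h k n : ℕ} (hn : h + k ≤ n) :
    ((n + 1 - h - k : ℕ) : ℝ) = (n : ℝ) - h - k + 1 := by
  rw [Nat.cast_sub (by omega), Nat.cast_sub (by omega)]
  push_cast
  ring

lemma sampleCross_maProcess {h k n : ℕ} (hn : h + k ≤ n) {c : ℕ → ℝ} {ω : Ω}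
    (hdec : ∀ t : ℤ, maProcess b ε (t + h) ω =
      ∑ j ∈ Finset.range k, c j * maProcess b ε (t - (j : ℤ)) ω + maPartial b ε h (t + h) ω) :
    sampleCross (maProcess b ε) h k n ω =
      sampleGam (maProcess b ε) h k n ω *ᵥ (fun i : Fin k => c i) +
        ((n + 1 - h - k : ℕ) : ℝ)⁻¹ • scoreVec b ε h k (n + 1 - h - k) ω := by
  rw [sampleCross, sampleGam, Matrix.smul_mulVec, cast_sample_size hn, ← smul_add,
    Matrix.sum_mulVec]
  congr 1
  have h1 : scoreVec b ε h k (n + 1 - h - k) ω =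
      ∑ j ∈ Finset.Icc k (n - h), fun i : Fin k => scoreTerm b ε h i (j : ℤ) ω := by
    rw [sum_Icc_eq_sum_range hn fun j => fun i : Fin k => scoreTerm b ε h i j ω]
    ext i
    rw [scoreVec, Finset.sum_apply]
  rw [h1, ← Finset.sum_add_distrib]
  refine Finset.sum_congr rfl fun j _ => ?_
  ext i
  simp only [Pi.add_apply, Pi.smul_apply, smul_eq_mul, Matrix.vecMulVec_mulVec, lagVec, scoreTerm,
    dotProduct, MulOpposite.smul_eq_mul_unop, MulOpposite.unop_op]
  rw [hdec j, Finset.sum_range, add_mul]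
  congr 1
  · rw [mul_comm]
    congr 1
    exact Finset.sum_congr rfl fun _ _ => mul_comm _ _
  · exact mul_comm _ _

/-- The estimation part of the error of the direct predictor. -/
def estimationError (b : ℕ → ℝ) (ε : ℤ → Ω → ℝ) (h k n : ℕ) (ω : Ω) : ℝ :=
  ((n + 1 - h - k : ℕ) : ℝ)⁻¹ * (lagVec (maProcess b ε) k n ω ⬝ᵥ
    ((sampleGam (maProcess b ε) h k n ω)⁻¹ *ᵥ scoreVec b ε h k (n + 1 - h - k) ω))

lemma directError_maProcess {h k n : ℕ} (hn : h + k ≤ n) {c : ℕ → ℝ} {ω : Ω}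
    (hdec : ∀ t : ℤ, maProcess b ε (t + h) ω =
      ∑ j ∈ Finset.range k, c j * maProcess b ε (t - (j : ℤ)) ω + maPartial b ε h (t + h) ω)
    (hdet : IsUnit (sampleGam (maProcess b ε) h k n ω).det) {θ : ℕ → Ω → Fin k → ℝ}
    (hθ : sampleGam (maProcess b ε) h k n ω *ᵥ θ n ω = sampleCross (maProcess b ε) h k n ω) :
    directError (maProcess b ε) h k θ n ω =
      maPartial b ε h (n + h) ω - estimationError b ε h k n ω := by
  rw [sampleCross_maProcess hn hdec] at hθ
  have h1 := congrArg (fun v => (sampleGam (maProcess b ε) h k n ω)⁻¹ *ᵥ v) hθ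
  simp only [Matrix.mulVec_add, Matrix.mulVec_mulVec, Matrix.nonsing_inv_mul _ hdet,
    Matrix.one_mulVec, Matrix.mulVec_smul] at h1
  rw [directError, hdec, h1, dotProduct_add, dotProduct_smul, estimationError, smul_eq_mul]
  have : lagVec (maProcess b ε) k n ω ⬝ᵥ (fun i : Fin k => c i) =
      ∑ j ∈ Finset.range k, c j * maProcess b ε ((n : ℤ) - (j : ℤ)) ω := by
    rw [Finset.sum_range, dotProduct]
    exact Finset.sum_congr rfl fun _ _ => mul_comm _ _
  rw [this]
  ring

lemma sampleGam_apply (x : ℤ → Ω → ℝ) (h k n : ℕ) (ω : Ω) (i j : Fin k) :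
    sampleGam x h k n ω i j = ((n : ℝ) - h - k + 1)⁻¹ *
      ∑ s ∈ Finset.Icc k (n - h), x ((s : ℤ) - (i : ℕ)) ω * x ((s : ℤ) - (j : ℕ)) ω := by
  rw [sampleGam, Matrix.smul_apply, Matrix.sum_apply, smul_eq_mul]
  rfl

/-- The last score term has index `n - h`, and its forecast error ends at time `n`. Hence the
estimation error is independent of the forecast error at `n`. -/
lemma measurable_estimationError (b : ℕ → ℝ) (ε : ℤ → Ω → ℝ) {h k n : ℕ} (hn : h + k ≤ n) :
    Measurable[noiseSigma ε (Set.Iic (n : ℤ))] (estimationError b ε h k n) := by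
  have hinv : ∀ i j, Measurable[noiseSigma ε (Set.Iic (n : ℤ))]
      fun ω => (sampleGam (maProcess b ε) h k n ω)⁻¹ i j := by
    refine @measurable_matrix_inv k Ω (noiseSigma ε (Set.Iic (n : ℤ))) _ fun i j => ?_
    simp only [sampleGam_apply]
    refine Measurable.const_mul (Finset.measurable_sum _ fun s hs => ?_) _
    have := (Finset.mem_Icc.1 hs).2
    exact (measurable_maProcess_Iic b ε (by omega)).mul (measurable_maProcess_Iic b ε (by omega))
  unfold estimationError
  simp only [dotProduct, Matrix.mulVec]
  refine Measurable.const_mul (Finset.measurable_sum _ fun i _ => ?_) _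
  refine (measurable_maProcess_Iic b ε (by omega)).mul (Finset.measurable_sum _ fun j _ => ?_)
  refine (hinv i j).mul (Finset.measurable_sum _ fun s hs => ?_)
  have := Finset.mem_range.1 hs
  exact measurable_scoreTerm b ε h _ (by omega)

/-! ### The covariance matrices -/

lemma Gam_maProcess {g : ℤ → ℝ}
    (hg : ∀ u v, ∫ ω, maProcess b ε u ω * maProcess b ε v ω ∂μ = g (u - v)) {k : ℕ}
    (i j : Fin k) : Gam μ (maProcess b ε) k i j = g ((j : ℕ) - ((i : ℕ) : ℤ)) := by
  simp only [Gam, Matrix.of_apply, lagVec, hg]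
  congr 1
  ring

lemma covMatrix_maProcess [IsProbabilityMeasure μ] (hε : IsIIDNoise μ ε σ) (hb : GeomDecay b C ρ)
    {K : ℝ} (hK : LpBound μ 2 (ε 1) K) {g : ℤ → ℝ}
    (hg : ∀ u v, ∫ ω, maProcess b ε u ω * maProcess b ε v ω ∂μ = g (u - v)) (h : ℕ) {k : ℕ}
    (i j : Fin k) :
    covMatrix μ (fun ω => ∑ s ∈ Finset.range h, b s • lagVec (maProcess b ε) k s ω) i j * σ ^ 2 =
      scoreCov b σ g h i j := by
  have hL2 : ∀ t, MemLp (maProcess b ε t) 2 μ := fun t =>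
    (lpBound_maProcess hε hb (by norm_num) hK t).memLp
  simp only [covMatrix, Matrix.of_apply, Finset.sum_apply, Pi.smul_apply, smul_eq_mul, lagVec]
  rw [covariance_fun_sum_fun_sum' (fun s _ => (hL2 _).const_mul _) fun s _ => (hL2 _).const_mul _,
    scoreCov, Finset.sum_mul]
  refine Finset.sum_congr rfl fun s _ => ?_
  rw [Finset.sum_mul]
  refine Finset.sum_congr rfl fun s' _ => ?_
  rw [covariance_const_mul_left, covariance_const_mul_right, covariance_eq_sub (hL2 _) (hL2 _),
    integral_maProcess hε hb, zero_mul, sub_zero]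
  simp only [Pi.mul_apply, hg]
  ring

/-- A null vector `v` of `Γ` makes `v'𝐱_j = 0` a.s. for all `j`, so the sample quadratic form
vanishes at `v`, contrary to its positivity for a single `n`. -/
lemma isUnit_det_Gam_maProcess [IsProbabilityMeasure μ] (hε : IsIIDNoise μ ε σ)
    (hb : GeomDecay b C ρ) {K : ℝ} (hK : LpBound μ 2 (ε 1) K) {g : ℤ → ℝ}
    (hg : ∀ u v, ∫ ω, maProcess b ε u ω * maProcess b ε v ω ∂μ = g (u - v)) {h k n : ℕ}
    (hpos : ∀ᵐ ω ∂μ, ∀ v : Fin k → ℝ, v ≠ 0 →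
      0 < v ⬝ᵥ (sampleGam (maProcess b ε) h k n ω *ᵥ v)) :
    IsUnit (Gam μ (maProcess b ε) k).det := by
  have hL2 : ∀ t, MemLp (maProcess b ε t) 2 μ := fun t =>
    (lpBound_maProcess hε hb (by norm_num) hK t).memLp
  rw [isUnit_iff_ne_zero]
  intro h0
  obtain ⟨v, hv, hΓv⟩ := Matrix.exists_mulVec_eq_zero_iff.2 h0
  have hquad : v ⬝ᵥ (Gam μ (maProcess b ε) k *ᵥ v) = 0 := by rw [hΓv, dotProduct_zero]
  have hsq : ∀ t : ℤ, ∫ ω, (∑ l : Fin k, v l * maProcess b ε (t - ((l : ℕ) : ℤ)) ω) ^ 2 ∂μ = 0 := by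
    intro t
    rw [← hquad]
    simp only [sq, Finset.sum_mul_sum]
    rw [integral_finsetSum _ fun i _ => integrable_finsetSum _ fun j _ =>
      integrable_mul_of_memLp_two ((hL2 _).const_mul _) ((hL2 _).const_mul _)]
    simp only [dotProduct, Matrix.mulVec, Finset.mul_sum]
    refine Finset.sum_congr rfl fun i _ => ?_
    rw [integral_finsetSum _ fun j _ =>
      integrable_mul_of_memLp_two ((hL2 _).const_mul _) ((hL2 _).const_mul _)]
    refine Finset.sum_congr rfl fun j _ => ?_
    simp only [mul_mul_mul_comm]
    rw [integral_const_mul, hg, Gam_maProcess hg,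
      show t - ((i : ℕ) : ℤ) - (t - ((j : ℕ) : ℤ)) = (j : ℕ) - ((i : ℕ) : ℤ) by ring]
    ring
  have hzero : ∀ t : ℤ, ∀ᵐ ω ∂μ,
      (∑ l : Fin k, v l * maProcess b ε (t - ((l : ℕ) : ℤ)) ω) ^ 2 = 0 := by
    intro t
    have hi : Integrable (fun ω => (∑ l : Fin k,
        v l * maProcess b ε (t - ((l : ℕ) : ℤ)) ω) ^ 2) μ :=
      (memLp_finsetSum _ fun l _ => (hL2 _).const_mul _).integrable_sq
    exact (integral_eq_zero_iff_of_nonneg (fun ω => sq_nonneg _) hi).1 (hsq t)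
  have hall := ae_all_iff.2 hzero
  obtain ⟨ω, hω, hω'⟩ := (hall.and hpos).exists
  have := hω' v hv
  rw [dotProduct_sampleGam, Finset.sum_eq_zero fun (j : ℕ) _ => hω (j : ℤ),
    mul_zero] at this
  exact this.false

/-- Summing over `i` and `i'` first produces `(Γ⁻¹)ᵀ Γ Γ⁻¹ = (Γ⁻¹)ᵀ`. -/
lemma sum_quadratic_eq_trace {k : ℕ} {Γ V : Matrix (Fin k) (Fin k) ℝ} (hΓ : IsUnit Γ.det) :
    ∑ i, ∑ j, ∑ i', ∑ j', Γ⁻¹ i j * Γ⁻¹ i' j' * (Γ i i' * V j j') = (Γ⁻¹ * V).trace := by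
  have h1 : (Γ⁻¹)ᵀ * Γ * Γ⁻¹ = (Γ⁻¹)ᵀ := by
    rw [mul_assoc, Matrix.mul_nonsing_inv _ hΓ, mul_one]
  have h2 : ∀ j j', ∑ i, ∑ i', Γ⁻¹ i j * Γ⁻¹ i' j' * Γ i i' = Γ⁻¹ j' j := by
    intro j j'
    have := congrFun (congrFun h1 j) j'
    rw [Matrix.transpose_apply] at this
    rw [← this, Matrix.mul_apply, Finset.sum_comm]
    refine Finset.sum_congr rfl fun i' _ => ?_
    rw [Matrix.mul_apply, Finset.sum_mul]
    refine Finset.sum_congr rfl fun i _ => ?_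
    rw [Matrix.transpose_apply]
    ring
  calc _ = ∑ j, ∑ j', (∑ i, ∑ i', Γ⁻¹ i j * Γ⁻¹ i' j' * Γ i i') * V j j' := by
        rw [Finset.sum_comm]
        refine Finset.sum_congr rfl fun j _ => ?_
        simp only [Finset.sum_mul]
        rw [Finset.sum_comm (s := Finset.univ (α := Fin k)) (t := Finset.univ (α := Fin k))
          (f := fun j' i => ∑ i', Γ⁻¹ i j * Γ⁻¹ i' j' * Γ i i' * V j j')]
        refine Finset.sum_congr rfl fun i _ => ?_
        rw [Finset.sum_comm]
        simp only [mul_assoc]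
    _ = _ := by
        simp only [h2, Matrix.trace, Matrix.diag, Matrix.mul_apply]
        exact Finset.sum_comm

end MultistepAR
end

noncomputable section
namespace MultistepAR

variable {Ω : Type*} [mΩ : MeasurableSpace Ω] {μ : Measure Ω} {ε : ℤ → Ω → ℝ} {σ : ℝ}
  {b : ℕ → ℝ} {C ρ : ℝ}

/-! ### The mean-squared estimation error -/

lemma lpBound_sampleGam_sub [IsProbabilityMeasure μ] (hε : IsIIDNoise μ ε σ)
    (hb : GeomDecay b C ρ) {K : ℝ} (hK : LpBound μ 8 (ε 1) K) {g : ℤ → ℝ}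
    (hg : ∀ u v, ∫ ω, maProcess b ε u ω * maProcess b ε v ω ∂μ = g (u - v)) (h k : ℕ) :
    ∃ B : ℝ, 0 ≤ B ∧ ∀ n, h + k ≤ n → LpBound μ 4
      (fun ω => entrySum (sampleGam (maProcess b ε) h k n ω - Gam μ (maProcess b ε) k))
      (B * (√(n + 1 - h - k : ℕ))⁻¹) := by
  set D := (C / (1 - ρ)) ^ 2 * (8 * K ^ 2) with hD
  refine ⟨∑ _i : Fin k, ∑ _j : Fin k, D, Finset.sum_nonneg fun _ _ => Finset.sum_nonneg
    fun _ _ => by positivity, fun n hn => ?_⟩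
  set N := n + 1 - h - k with hN
  set I : Finset ℤ := (Finset.range N).image fun i : ℕ => (k : ℤ) + i with hI
  have hinj : Set.InjOn (fun i : ℕ => (k : ℤ) + (i : ℤ)) (Finset.range N) := by
    intro i _ j _ hij
    simpa using hij
  have hcard : (I.card : ℝ) = N := by
    rw [hI, Finset.card_image_of_injOn hinj, Finset.card_range]
  have hN0 : (0 : ℝ) < N := by
    have : 0 < N := by omega
    exact_mod_cast this
  have hentry : ∀ i j : Fin k, LpBound μ 4 (fun ω => |(sampleGam (maProcess b ε) h k n ω -
      Gam μ (maProcess b ε) k) i j|) (D * (√N)⁻¹) := by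
    intro i j
    have h1 := (lpBound_maProcess_pair_sum hε hb hK I (-(i : ℕ)) (-(j : ℕ))).const_mul (N : ℝ)⁻¹
    rw [hcard, abs_of_pos (inv_pos.2 hN0)] at h1
    refine (h1.of_le ?_ ?_).mono (le_of_eq ?_)
    · have : AEStronglyMeasurable (fun ω => (sampleGam (maProcess b ε) h k n ω -
          Gam μ (maProcess b ε) k) i j) μ := ?_
      · exact this.norm
      simp only [Matrix.sub_apply, sampleGam_apply]
      refine AEStronglyMeasurable.sub (AEStronglyMeasurable.const_mul
        (Finset.aestronglyMeasurable_fun_sum _ fun s _ => ?_) _) aestronglyMeasurable_const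
      exact (lpBound_maProcess hε hb (by norm_num) hK _).aesm.mul
        (lpBound_maProcess hε hb (by norm_num) hK _).aesm
    · refine .of_forall fun ω => ?_
      rw [abs_abs]
      refine le_of_eq (congrArg _ ?_)
      rw [Matrix.sub_apply, sampleGam_apply, Gam_maProcess hg, ← cast_sample_size hn, ← hN,
        sum_Icc_eq_sum_range hn fun s => maProcess b ε (s - (i : ℕ)) ω *
          maProcess b ε (s - (j : ℕ)) ω, ← hN, hI, Finset.sum_image hinj]
      simp only [hg, ← sub_eq_add_neg, sub_sub_sub_cancel_left, Finset.sum_sub_distrib,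
        Finset.sum_const, Finset.card_range, nsmul_eq_mul]
      rw [mul_sub, inv_mul_cancel_left₀ hN0.ne']
    · rw [hD, ← Real.sqrt_div_self]
      ring
  have := LpBound.sum (μ := μ) (q := 4) (by norm_num) Finset.univ fun i _ =>
    LpBound.sum (by norm_num) Finset.univ fun j _ => hentry i j
  refine this.mono (le_of_eq ?_)
  simp only [← Finset.sum_mul]

lemma exists_integral_quadratic_sub_le [IsProbabilityMeasure μ] (hε : IsIIDNoise μ ε σ)
    (hb : GeomDecay b C ρ) {K : ℝ} (hK : LpBound μ 8 (ε 1) K) {g : ℤ → ℝ}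
    (hg : ∀ u v, ∫ ω, maProcess b ε u ω * maProcess b ε v ω ∂μ = g (u - v)) {h k : ℕ} {w : ℕ → ℝ}
    (hdec : ∀ t : ℤ, ∀ᵐ ω ∂μ, maProcess b ε (t + h) ω =
      ∑ j ∈ Finset.range k, w j * maProcess b ε (t - (j : ℤ)) ω + maPartial b ε h (t + h) ω)
    (hdet : IsUnit (Gam μ (maProcess b ε) k).det) :
    ∃ B : ℝ, 0 ≤ B ∧ ∀ n, h + k ≤ n →
      Integrable (fun ω => (lagVec (maProcess b ε) k n ω ⬝ᵥ
        ((Gam μ (maProcess b ε) k)⁻¹ *ᵥ scoreVec b ε h k (n + 1 - h - k) ω)) ^ 2) μ ∧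
      |(∫ ω, (lagVec (maProcess b ε) k n ω ⬝ᵥ
        ((Gam μ (maProcess b ε) k)⁻¹ *ᵥ scoreVec b ε h k (n + 1 - h - k) ω)) ^ 2 ∂μ) -
        (n + 1 - h - k : ℕ) * ((Gam μ (maProcess b ε) k)⁻¹ *
          Matrix.of fun i j : Fin k => scoreCov b σ g h i j).trace| ≤
        B * (1 + √(n + 1 - h - k : ℕ)) := by
  set Γ := Gam μ (maProcess b ε) k with hΓ
  choose Bf hBf0 hBf using fun p q c d : ℕ =>
    exists_abs_integral_score_sub_le hε hb hK hg hdec p q c d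
  choose Bs hBs0 hBs using exists_lpBound_score hε hb hK hdec
  refine ⟨∑ i : Fin k, ∑ j : Fin k, ∑ i' : Fin k, ∑ j' : Fin k,
    |Γ⁻¹ i j * Γ⁻¹ i' j'| * Bf i i' j j', Finset.sum_nonneg fun i _ => Finset.sum_nonneg
    fun j _ => Finset.sum_nonneg fun i' _ => Finset.sum_nonneg fun j' _ =>
      mul_nonneg (abs_nonneg _) (hBf0 _ _ _ _), fun n hn => ?_⟩
  set N := n + 1 - h - k with hN
  set F : Fin k → Fin k → Fin k → Fin k → Ω → ℝ := fun i j i' j' ω =>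
    (maProcess b ε ((n : ℤ) - (i : ℕ)) ω * maProcess b ε ((n : ℤ) - (i' : ℕ)) ω) *
      (scoreVec b ε h k N ω j * scoreVec b ε h k N ω j') with hF
  have hexp : ∀ ω, (lagVec (maProcess b ε) k n ω ⬝ᵥ (Γ⁻¹ *ᵥ scoreVec b ε h k N ω)) ^ 2 =
      ∑ i, ∑ j, ∑ i', ∑ j', Γ⁻¹ i j * Γ⁻¹ i' j' * F i j i' j' ω := by
    intro ω
    have h1 : ∀ f : Fin k → Fin k → ℝ,
        (∑ i, ∑ j, f i j) ^ 2 = ∑ i, ∑ j, ∑ i', ∑ j', f i j * f i' j' := fun f => by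
      rw [sq]
      simp only [Finset.sum_mul]
      simp only [Finset.mul_sum]
    simp only [dotProduct, Matrix.mulVec, Finset.mul_sum, lagVec, hF]
    rw [h1]
    refine Finset.sum_congr rfl fun i _ => Finset.sum_congr rfl fun j _ =>
      Finset.sum_congr rfl fun i' _ => Finset.sum_congr rfl fun j' _ => ?_
    ring
  -- Two regressor entries in `L⁸` and two score entries in `L⁴` have an integrable product.
  have hFi : ∀ i j i' j', Integrable (F i j i' j') μ := fun i j i' j' =>
    ((lpBound_maProcess hε hb (by norm_num) hK _).mul_four
      (lpBound_maProcess hε hb (by norm_num) hK _) (hBs j k N) (hBs j' k N)).integrable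
  have hFb : ∀ i j i' j', |(∫ ω, F i j i' j' ω ∂μ) - N * (Γ i i' * scoreCov b σ g h j j')| ≤
      Bf i i' j j' * (1 + √N) := by
    intro i j i' j'
    have := hBf i i' j j' k N
    rw [show (k : ℤ) + N + h - 1 = n by omega] at this
    rw [hΓ, Gam_maProcess hg]
    exact this
  have hint : ∀ i j i' j', Integrable (fun ω => Γ⁻¹ i j * Γ⁻¹ i' j' * F i j i' j' ω) μ :=
    fun i j i' j' => (hFi i j i' j').const_mul _
  simp only [hexp]
  refine ⟨integrable_finsetSum _ fun i _ => integrable_finsetSum _ fun j _ =>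
    integrable_finsetSum _ fun i' _ => integrable_finsetSum _ fun j' _ => hint i j i' j', ?_⟩
  have hI : ∫ ω, ∑ i, ∑ j, ∑ i', ∑ j', Γ⁻¹ i j * Γ⁻¹ i' j' * F i j i' j' ω ∂μ =
      ∑ i, ∑ j, ∑ i', ∑ j', Γ⁻¹ i j * Γ⁻¹ i' j' * ∫ ω, F i j i' j' ω ∂μ := by
    rw [integral_finsetSum _ fun i _ => integrable_finsetSum _ fun j _ =>
      integrable_finsetSum _ fun i' _ => integrable_finsetSum _ fun j' _ => hint i j i' j']
    refine Finset.sum_congr rfl fun i _ => ?_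
    rw [integral_finsetSum _ fun j _ =>
      integrable_finsetSum _ fun i' _ => integrable_finsetSum _ fun j' _ => hint i j i' j']
    refine Finset.sum_congr rfl fun j _ => ?_
    rw [integral_finsetSum _ fun i' _ => integrable_finsetSum _ fun j' _ => hint i j i' j']
    refine Finset.sum_congr rfl fun i' _ => ?_
    rw [integral_finsetSum _ fun j' _ => hint i j i' j']
    exact Finset.sum_congr rfl fun j' _ => integral_const_mul _ _
  rw [hI, ← sum_quadratic_eq_trace hdet]
  simp only [Finset.mul_sum, Finset.sum_mul, ← Finset.sum_sub_distrib, Matrix.of_apply]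
  refine (Finset.abs_sum_le_sum_abs _ _).trans (Finset.sum_le_sum fun i _ => ?_)
  refine (Finset.abs_sum_le_sum_abs _ _).trans (Finset.sum_le_sum fun j _ => ?_)
  refine (Finset.abs_sum_le_sum_abs _ _).trans (Finset.sum_le_sum fun i' _ => ?_)
  refine (Finset.abs_sum_le_sum_abs _ _).trans (Finset.sum_le_sum fun j' _ => ?_)
  rw [mul_left_comm, ← mul_sub, abs_mul, mul_assoc]
  exact mul_le_mul_of_nonneg_left (hFb i j i' j') (abs_nonneg _)

/-- The mean square of the estimation part of the prediction error. -/
lemma exists_integral_estimationError_sub_le [IsProbabilityMeasure μ] (hε : IsIIDNoise μ ε σ)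
    (hb : GeomDecay b C ρ) {δ K K' : ℝ} (hδ : 0 < δ) (hK : LpBound μ 8 (ε 1) K)
    (hK' : LpBound μ (ENNReal.ofReal (8 + δ)) (ε 1) K') {g : ℤ → ℝ}
    (hg : ∀ u v, ∫ ω, maProcess b ε u ω * maProcess b ε v ω ∂μ = g (u - v)) {h k : ℕ} {w : ℕ → ℝ}
    (hdec : ∀ t : ℤ, ∀ᵐ ω ∂μ, maProcess b ε (t + h) ω =
      ∑ j ∈ Finset.range k, w j * maProcess b ε (t - (j : ℤ)) ω + maPartial b ε h (t + h) ω)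
    (hdet : IsUnit (Gam μ (maProcess b ε) k).det)
    (hlow : ∀ q : ℕ, q ≠ 0 → ∃ (A : ℝ) (n₀ : ℕ), ∀ n ≥ n₀, ∃ lam : Ω → ℝ, (∀ᵐ ω ∂μ, 0 < lam ω) ∧
      (∀ᵐ ω ∂μ, ∀ v : Fin k → ℝ,
        lam ω * (v ⬝ᵥ v) ≤ v ⬝ᵥ (sampleGam (maProcess b ε) h k n ω *ᵥ v)) ∧
      LpBound μ q (fun ω => (lam ω)⁻¹) A) :
    ∃ (B : ℝ) (n₀ : ℕ), 0 ≤ B ∧ ∀ n ≥ n₀, h + k ≤ n ∧ MemLp (estimationError b ε h k n) 2 μ ∧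
      |(n + 1 - h - k : ℕ) * (∫ ω, estimationError b ε h k n ω ^ 2 ∂μ) -
        ((Gam μ (maProcess b ε) k)⁻¹ *
          Matrix.of fun i j : Fin k => scoreCov b σ g h i j).trace| ≤
        B * (√(n + 1 - h - k : ℕ))⁻¹ := by
  set Γ := Gam μ (maProcess b ε) k with hΓ
  set f := (Γ⁻¹ * Matrix.of fun i j : Fin k => scoreCov b σ g h i j).trace
  obtain ⟨q, hq0, hmul⟩ := exists_lpBound_mul_eight (Ω := Ω) (μ := μ) hδ
  obtain ⟨A, n₀, hA⟩ := hlow q hq0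
  obtain ⟨B₁, hB₁0, hB₁⟩ := exists_integral_quadratic_sub_le hε hb hK hg hdec hdet
  obtain ⟨B₂, hB₂0, hB₂⟩ := lpBound_sampleGam_sub hε hb hK hg h k
  choose Bs hBs0 hBs using exists_lpBound_score hε hb hK hdec
  set D := C / (1 - ρ) * K' with hD
  have hA0 : 0 ≤ A := by
    obtain ⟨lam, -, -, hlam⟩ := hA n₀ le_rfl
    exact hlam.nonneg
  have hD0 : 0 ≤ D := mul_nonneg hb.const_nonneg hK'.nonneg
  have hq1 : (1 : ENNReal) ≤ q := by exact_mod_cast Nat.one_le_iff_ne_zero.2 hq0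
  set S₁ := ∑ _i : Fin k, (D * (1 + A)) * (D * (1 + A)) with hS₁
  set S₂ := ∑ i : Fin k, Bs i * Bs i with hS₂
  have hS₁0 : 0 ≤ S₁ := Finset.sum_nonneg fun _ _ => mul_self_nonneg _
  have hS₂0 : 0 ≤ S₂ := Finset.sum_nonneg fun _ _ => mul_self_nonneg _
  refine ⟨(1 + entrySum Γ⁻¹) ^ 2 * (S₁ * B₂ * S₂) + 2 * B₁, max n₀ (h + k), by positivity,
    fun n hn => ?_⟩
  have hn₀ : n₀ ≤ n := (le_max_left _ _).trans hn
  have hhk : h + k ≤ n := (le_max_right _ _).trans hn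
  obtain ⟨lam, hpos, hlower, hlam⟩ := hA n hn₀
  have hQ := hB₁ n hhk
  set N := n + 1 - h - k with hN
  set Q : Ω → ℝ := fun ω => lagVec (maProcess b ε) k n ω ⬝ᵥ (Γ⁻¹ *ᵥ scoreVec b ε h k N ω) with hQdef
  set P : Ω → ℝ := fun ω => lagVec (maProcess b ε) k n ω ⬝ᵥ
    ((sampleGam (maProcess b ε) h k n ω)⁻¹ *ᵥ scoreVec b ε h k N ω) with hPdef
  have hN1 : 1 ≤ N := by omega
  have hN1' : (1 : ℝ) ≤ N := by exact_mod_cast hN1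
  have hN0 : (0 : ℝ) < N := by linarith
  have hs0 : 0 < √(N : ℝ) := Real.sqrt_pos.2 hN0
  have hs1 : 1 ≤ √(N : ℝ) := Real.one_le_sqrt.2 hN1'
  have hss : √(N : ℝ) * √N = N := Real.mul_self_sqrt hN0.le
  have hWP : ∀ ω, estimationError b ε h k n ω = (N : ℝ)⁻¹ * P ω := fun ω => rfl
  have hWm : AEStronglyMeasurable (estimationError b ε h k n) μ :=
    (measurable_of_noiseSigma hε.measurable
      (measurable_estimationError b ε hhk)).aestronglyMeasurable
  have hPm : AEStronglyMeasurable P μ := by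
    refine (hWm.const_mul (N : ℝ)).congr (.of_forall fun ω => ?_)
    simp only [hWP, mul_inv_cancel_left₀ hN0.ne']
  have hQm : AEStronglyMeasurable (fun ω => Q ω ^ 2) μ := hQ.1.aestronglyMeasurable
  have hell : LpBound μ q (fun ω => 1 + (lam ω)⁻¹) (1 + A) := by
    have := (LpBound.const (μ := μ) (q := q) (by exact_mod_cast hq0) 1).add hq1 hlam
    rwa [abs_one] at this
  have hX : LpBound μ 4 (fun ω => ∑ i : Fin k,
      (lagVec (maProcess b ε) k n ω i * (1 + (lam ω)⁻¹)) *
        (lagVec (maProcess b ε) k n ω i * (1 + (lam ω)⁻¹))) S₁ := by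
    refine LpBound.sum (by norm_num) Finset.univ fun i _ => ?_
    have h1 : LpBound μ 8 (fun ω => lagVec (maProcess b ε) k n ω i * (1 + (lam ω)⁻¹))
        (D * (1 + A)) := hmul (lpBound_maProcess hε hb (by
          rw [← ENNReal.ofReal_one]; exact ENNReal.ofReal_le_ofReal (by linarith)) hK' _) hell
    exact h1.mul h1
  have hT : LpBound μ 2 (fun ω => ∑ i : Fin k,
      scoreVec b ε h k N ω i * scoreVec b ε h k N ω i) (S₂ * N) := by
    have h1 := LpBound.sum (μ := μ) (q := 2) (by norm_num) Finset.univ fun (i : Fin k) _ =>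
      LpBound.mul (r := 2) (hBs i k N) (hBs i k N)
    refine h1.mono (le_of_eq ?_)
    rw [hS₂, Finset.sum_mul]
    refine Finset.sum_congr rfl fun i _ => ?_
    calc _ = Bs i * Bs i * (√(N : ℝ) * √N) := by ring
      _ = _ := by rw [hss]
  -- Hölder with `1/4 + 1/4 + 1/2 = 1`: the weighted regressor is `O(1)`, the covariance error
  -- `O(N^{-1/2})` and the squared score `O(N)`, so the difference is `O(√N)`.
  have hXΔ := LpBound.mul (r := 2) hX (hB₂ n hhk)
  have hR := (LpBound.mul (r := 1) hXΔ hT).const_mul ((1 + entrySum Γ⁻¹) ^ 2)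
  have hdiff : LpBound μ 1 (fun ω => P ω ^ 2 - Q ω ^ 2)
      ((1 + entrySum Γ⁻¹) ^ 2 * (S₁ * B₂ * S₂) * √N) := by
    refine (hR.of_le ((hPm.pow 2).sub hQm) ?_).mono (le_of_eq ?_)
    · filter_upwards [hpos, hlower] with ω h1 h2
      exact (abs_quadratic_inv_sub_le h1 h2 hdet _ _).trans (le_abs_self _)
    · rw [abs_of_nonneg (sq_nonneg _), ← hN]
      have : (√(N : ℝ))⁻¹ * N = √N := by
        rw [inv_mul_eq_div, Real.div_sqrt]
      calc _ = (1 + entrySum Γ⁻¹) ^ 2 * (S₁ * B₂ * S₂) * ((√(N : ℝ))⁻¹ * N) := by ring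
        _ = _ := by rw [this]
  -- Finiteness of the mean square comes from the comparison itself: `P² = (P² - Q²) + Q²`.
  have hPi : Integrable (fun ω => P ω ^ 2) μ := by
    exact (hdiff.integrable.add hQ.1).congr (.of_forall fun ω => sub_add_cancel _ _)
  have hP2 : MemLp P 2 μ := (memLp_two_iff_integrable_sq hPm).2 hPi
  refine ⟨hhk, (hP2.const_mul (N : ℝ)⁻¹).ae_eq (.of_forall fun ω => (hWP ω).symm), ?_⟩
  have hWI : (N : ℝ) * ∫ ω, estimationError b ε h k n ω ^ 2 ∂μ =
      (N : ℝ)⁻¹ * ∫ ω, P ω ^ 2 ∂μ := by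
    simp only [hWP, mul_pow]
    rw [integral_const_mul, ← mul_assoc]
    congr 1
    field_simp
  have e1 := hdiff.abs_integral_le
  rw [integral_sub hPi hQ.1] at e1
  have e2 := hQ.2
  have e3 : |(∫ ω, P ω ^ 2 ∂μ) - N * f| ≤
      ((1 + entrySum Γ⁻¹) ^ 2 * (S₁ * B₂ * S₂) + 2 * B₁) * √N := by
    calc _ = |((∫ ω, P ω ^ 2 ∂μ) - ∫ ω, Q ω ^ 2 ∂μ) + ((∫ ω, Q ω ^ 2 ∂μ) - N * f)| := by ring_nf
      _ ≤ _ := abs_add_le _ _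
      _ ≤ (1 + entrySum Γ⁻¹) ^ 2 * (S₁ * B₂ * S₂) * √N + B₁ * (1 + √N) := add_le_add e1 e2
      _ ≤ _ := by nlinarith
  have e4 : (N : ℝ) * (∫ ω, estimationError b ε h k n ω ^ 2 ∂μ) - f =
      (N : ℝ)⁻¹ * ((∫ ω, P ω ^ 2 ∂μ) - N * f) := by
    rw [hWI, mul_sub, inv_mul_cancel_left₀ hN0.ne']
  rw [e4, abs_mul, abs_of_pos (inv_pos.2 hN0)]
  have e5 : (N : ℝ)⁻¹ * √N = (√N)⁻¹ := by
    rw [inv_mul_eq_div, Real.sqrt_div_self]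
  calc _ ≤ (N : ℝ)⁻¹ * (((1 + entrySum Γ⁻¹) ^ 2 * (S₁ * B₂ * S₂) + 2 * B₁) * √N) :=
        mul_le_mul_of_nonneg_left e3 (inv_nonneg.2 hN0.le)
    _ = _ := by rw [← e5]; ring

end MultistepAR
end

noncomputable section
namespace MultistepAR

variable {Ω : Type*} [mΩ : MeasurableSpace Ω] {μ : Measure Ω} {ε : ℤ → Ω → ℝ} {σ : ℝ}
  {b : ℕ → ℝ} {C ρ : ℝ}

/-! ### The mean-squared prediction error -/

lemma integral_sq_maPartial [IsProbabilityMeasure μ] (hε : IsIIDNoise μ ε σ) {K : ℝ}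
    (hK : LpBound μ 2 (ε 1) K) (b : ℕ → ℝ) (h : ℕ) (t : ℤ) :
    ∫ ω, maPartial b ε h t ω ^ 2 ∂μ = σ ^ 2 * ∑ j ∈ Finset.range h, b j ^ 2 := by
  have hi : ∀ i j : ℕ, Integrable (fun ω => b i * b j *
      (ε (t - (i : ℤ)) ω * ε (t - (j : ℤ)) ω)) μ := fun i j =>
    (integrable_mul_of_memLp_two (hε.lpBound hK _).memLp (hε.lpBound hK _).memLp).const_mul _
  simp only [maPartial, sq, Finset.sum_mul_sum, mul_mul_mul_comm (b _) (ε _ _)]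
  rw [integral_finsetSum _ fun i _ => integrable_finsetSum _ fun j _ => hi i j, Finset.mul_sum]
  refine Finset.sum_congr rfl fun i hi' => ?_
  rw [integral_finsetSum _ fun j _ => hi i j, Finset.sum_eq_single i]
  · rw [integral_const_mul, hε.integral_sq]
    ring
  · intro j _ hji
    rw [integral_const_mul, hε.integral_mul_of_ne (by omega), mul_zero]
  · exact fun hn => absurd hi' hn

/-- The mean-squared error of the direct predictor splits into the error of the optimal predictor
and the estimation error. -/
lemma integral_sq_directError_maProcess [IsProbabilityMeasure μ] (hε : IsIIDNoise μ ε σ)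
    (hb : GeomDecay b C ρ) {K : ℝ} (hK : LpBound μ 2 (ε 1) K) {h k n : ℕ} {w : ℕ → ℝ}
    (hdec : ∀ t : ℤ, ∀ᵐ ω ∂μ, maProcess b ε (t + h) ω =
      ∑ j ∈ Finset.range k, w j * maProcess b ε (t - (j : ℤ)) ω + maPartial b ε h (t + h) ω)
    (hn : h + k ≤ n) (hdet : ∀ᵐ ω ∂μ, IsUnit (sampleGam (maProcess b ε) h k n ω).det)
    {θ : ℕ → Ω → Fin k → ℝ} (hθ : IsDirectEstimator μ (maProcess b ε) h k θ)
    (hW : MemLp (estimationError b ε h k n) 2 μ) :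
    Integrable (fun ω => directError (maProcess b ε) h k θ n ω ^ 2) μ ∧
    ∫ ω, directError (maProcess b ε) h k θ n ω ^ 2 ∂μ =
      σ ^ 2 * ∑ j ∈ Finset.range h, b j ^ 2 + ∫ ω, estimationError b ε h k n ω ^ 2 ∂μ := by
  have hη : MemLp (maPartial b ε h (n + h)) 2 μ :=
    (lpBound_maPartial hε hb (by norm_num) hK h _).memLp
  have herr : (fun ω => directError (maProcess b ε) h k θ n ω ^ 2) =ᵐ[μ] fun ω =>
      maPartial b ε h (n + h) ω ^ 2 - 2 * (maPartial b ε h (n + h) ω *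
        estimationError b ε h k n ω) + estimationError b ε h k n ω ^ 2 := by
    filter_upwards [ae_all_iff.2 hdec, hdet, hθ n] with ω h1 h2 h3
    rw [directError_maProcess hn h1 h2 h3]
    ring
  have i1 := hη.integrable_sq
  have i2 := (integrable_mul_of_memLp_two hη hW).const_mul 2
  have i3 := hW.integrable_sq
  refine ⟨((i1.sub i2).add i3).congr herr.symm, ?_⟩
  have i12 : Integrable (fun ω => maPartial b ε h (n + h) ω ^ 2 -
      2 * (maPartial b ε h (n + h) ω * estimationError b ε h k n ω)) μ := i1.sub i2
  -- The cross term vanishes: the forecast error uses noises after `n`, the estimation error those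
  -- up to `n`.
  rw [integral_congr_ae herr, integral_add i12 i3, integral_sub i1 i2, integral_const_mul,
    integral_mul_of_noiseSigma hε.measurable hε.indep (S := Set.Ioi (n : ℤ)) (T := Set.Iic (n : ℤ))
      (by rw [Set.disjoint_left]; intro j hj hj'; simp at hj hj'; omega)
      (measurable_forecast_error b ε h n) (measurable_estimationError b ε hn),
    integral_maPartial hε, integral_sq_maPartial hε hK]
  ring

/-- Passes from the sample size `N` to `n` through `n I - f = (n / N) (N I - f) + f (n - N) / N`.
The condition `n ≥ 2 (h + k)` gives `n ≤ 2 N`, the source of the factors `2` and `4`. -/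
lemma abs_rescaled_sub_le {n N h k : ℕ} {f B I : ℝ} (hB : 0 ≤ B) (hN : N = n + 1 - h - k)
    (hk : 1 ≤ k) (hn : 2 * (h + k) ≤ n) (hI : |N * I - f| ≤ B * (√N)⁻¹) :
    |n * I - f| ≤ (4 * B + |f| * (2 * (h + k))) * (√n)⁻¹ := by
  have hN1 : 1 ≤ N := by omega
  have hN0 : (0 : ℝ) < N := by exact_mod_cast hN1
  have hn1 : 1 ≤ n := by omega
  have hn1' : (1 : ℝ) ≤ n := by exact_mod_cast hn1
  have hn0 : (0 : ℝ) < n := by linarith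
  have h2N : (n : ℝ) ≤ 2 * N := by
    have : n ≤ 2 * N := by omega
    exact_mod_cast this
  have hnN : (n : ℝ) - N ≤ h + k := by
    have : n ≤ N + (h + k) := by omega
    have : (n : ℝ) ≤ N + (h + k) := by exact_mod_cast this
    linarith
  have hNn : (N : ℝ) ≤ n := by
    have : N ≤ n := by omega
    exact_mod_cast this
  have hsn : 0 < √(n : ℝ) := Real.sqrt_pos.2 hn0
  have hsN : 0 < √(N : ℝ) := Real.sqrt_pos.2 hN0
  have hs : √(n : ℝ) ≤ 2 * √N := by
    rw [Real.sqrt_le_left (by positivity), mul_pow, Real.sq_sqrt hN0.le]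
    linarith
  have e1 : (√(N : ℝ))⁻¹ ≤ 2 * (√n)⁻¹ := by
    rw [← div_eq_mul_inv, inv_eq_one_div, div_le_div_iff₀ hsN hsn]
    linarith
  have e2 : (n : ℝ) / N ≤ 2 := by rwa [div_le_iff₀ hN0]
  have e3 : |((n : ℝ) - N) / N| ≤ 2 * (h + k) * (√n)⁻¹ := by
    have h1 : √(n : ℝ) ≤ n := by
      rw [Real.sqrt_le_left hn0.le]
      nlinarith
    rw [abs_of_nonneg (div_nonneg (by linarith) hN0.le), ← div_eq_mul_inv,
      div_le_div_iff₀ hN0 hsn]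
    have h2 : (0 : ℝ) ≤ h + k := by positivity
    calc ((n : ℝ) - N) * √n ≤ (h + k) * n := mul_le_mul hnN h1 hsn.le h2
      _ ≤ (h + k) * (2 * N) := mul_le_mul_of_nonneg_left h2N h2
      _ = _ := by ring
  calc |n * I - f| = |(n : ℝ) / N * (N * I - f) + f * (((n : ℝ) - N) / N)| := by
        congr 1
        field_simp
        ring
    _ ≤ _ := abs_add_le _ _
    _ ≤ 2 * (B * (2 * (√n)⁻¹)) + |f| * (2 * (h + k) * (√n)⁻¹) := by
        rw [abs_mul, abs_mul, abs_of_nonneg (div_nonneg hn0.le hN0.le)]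
        refine add_le_add (mul_le_mul e2 (hI.trans (mul_le_mul_of_nonneg_left e1 hB))
          (abs_nonneg _) zero_le_two) (mul_le_mul_of_nonneg_left e3 (abs_nonneg _))
    _ = _ := by ring

lemma memLp_of_integrable_abs_rpow {f : Ω → ℝ} {r : ℝ} (hr : 0 < r) (hf : Measurable f)
    (h : Integrable (fun ω => |f ω| ^ r) μ) : MemLp f (ENNReal.ofReal r) μ := by
  rw [← integrable_norm_rpow_iff hf.aestronglyMeasurable (by simpa using hr) ENNReal.ofReal_ne_top,
    ENNReal.toReal_ofReal hr.le]
  exact h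

section Congruence

variable {x y : ℤ → Ω → ℝ} {k : ℕ}

lemma lagVec_congr {ω : Ω} (h : ∀ t, x t ω = y t ω) (k : ℕ) (j : ℤ) :
    lagVec x k j ω = lagVec y k j ω := funext fun _ => h _

lemma sampleGam_congr {ω : Ω} (h : ∀ t, x t ω = y t ω) (m k n : ℕ) :
    sampleGam x m k n ω = sampleGam y m k n ω := by
  simp only [sampleGam, lagVec_congr h]

lemma sampleCross_congr {ω : Ω} (h : ∀ t, x t ω = y t ω) (m k n : ℕ) :
    sampleCross x m k n ω = sampleCross y m k n ω := by
  simp only [sampleCross, lagVec_congr h, h]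

lemma directError_congr {ω : Ω} (h : ∀ t, x t ω = y t ω) (m : ℕ) (θ : ℕ → Ω → Fin k → ℝ) (n : ℕ) :
    directError x m k θ n ω = directError y m k θ n ω := by
  simp only [directError, lagVec_congr h, h]

lemma Gam_congr (h : ∀ᵐ ω ∂μ, ∀ t, x t ω = y t ω) (k : ℕ) : Gam μ x k = Gam μ y k := by
  ext i j
  simp only [Gam, Matrix.of_apply]
  refine integral_congr_ae ?_
  filter_upwards [h] with ω hω
  rw [lagVec_congr hω]

lemma covMatrix_congr {u v : Ω → Fin k → ℝ} (h : u =ᵐ[μ] v) : covMatrix μ u = covMatrix μ v := by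
  ext i j
  have hi : ∀ i, (fun ω => u ω i) =ᵐ[μ] fun ω => v ω i := fun i => by
    filter_upwards [h] with ω hω
    rw [hω]
  simp only [covMatrix, Matrix.of_apply, covariance, integral_congr_ae (hi _)]
  refine integral_congr_ae ?_
  filter_upwards [hi i, hi j] with ω h1 h2
  rw [h1, h2]

end Congruence

end MultistepAR
end

/-! ### Assembly of the corollary. -/

open MultistepAR in
theorem corollary2p4 {Ω : Type*} [MeasurableSpace Ω] (μ : Measure Ω) [IsProbabilityMeasure μ]
    (p : ℕ) (a : ℕ → ℝ) (σ : ℝ) (ε x : ℤ → Ω → ℝ)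
    (hσ : 0 < σ)
    (hε : MultistepAR.IsIIDNoise μ ε σ)
    (hx : MultistepAR.IsStationaryAR μ p a ε x)
    (hF : MultistepAR.HolderDistribution (fun u => cdf (μ.map (ε 1)) u))
    (δ : ℝ) (hδ : 0 < δ)
    (hmom : Integrable (fun ω => |ε 1 ω| ^ (8 + δ)) μ)
    (h k : ℕ) (hh : 1 ≤ h)
    (hk : MultistepAR.predictionOrder μ x h ≤ k)
    (θ : ℕ → Ω → Fin k → ℝ)
    (hθ : MultistepAR.IsDirectEstimator μ x h k θ) :
    (∀ᶠ n : ℕ in atTop, Integrable (fun ω => MultistepAR.directError x h k θ n ω ^ 2) μ) ∧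
    (fun n : ℕ =>
        (n : ℝ) * (MultistepAR.mspeDirect μ x h k θ n - MultistepAR.sigmaSq p a σ h)
          - MultistepAR.f₂ μ x p a σ h k)
      =O[atTop] (fun n : ℕ => (n : ℝ) ^ (-(1 / 2 : ℝ))) := by
  obtain ⟨C, ρ, hC, hρ, hρ1, hle⟩ := exists_maCoeff_decay p a hx.no_zeros
  have hb : GeomDecay (maCoeff p a) C ρ := ⟨hC, hρ, hρ1, hle⟩
  have hK' := LpBound.of_memLp
    (memLp_of_integrable_abs_rpow (by positivity) (hε.measurable 1) hmom)
  set K := (eLpNorm (ε 1) (ENNReal.ofReal (8 + δ)) μ).toReal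
  have h8 : (8 : ENNReal) ≤ ENNReal.ofReal (8 + δ) := by
    rw [show (8 : ENNReal) = ENNReal.ofReal 8 by norm_num]
    exact ENNReal.ofReal_le_ofReal (by linarith)
  have hK : LpBound μ 8 (ε 1) K := hK'.mono_exponent h8
  have hK2 : LpBound μ 2 (ε 1) K := hK.mono_exponent (by norm_num)
  have hX := fun t => hx.ae_eq_maProcess hε hb hK2 t
  have hall : ∀ᵐ ω ∂μ, ∀ t, x t ω = maProcess (maCoeff p a) ε t ω := ae_all_iff.2 hX
  obtain ⟨hk1, w, hw⟩ := exists_direct_coeff hε hx hX hK2 hk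
  have hdec : ∀ t : ℤ, ∀ᵐ ω ∂μ, maProcess (maCoeff p a) ε (t + h) ω =
      ∑ j ∈ Finset.range k, w j * maProcess (maCoeff p a) ε (t - (j : ℤ)) ω +
        maPartial (maCoeff p a) ε h (t + h) ω := by
    intro t
    filter_upwards [hw t, hall] with ω h1 h2
    simpa only [h2] using h1
  -- The autocovariance function; stationarity of `x` makes that of the causal series a function of
  -- the time difference.
  set g : ℤ → ℝ := fun j => ∫ ω, x 0 ω * x (0 - j) ω ∂μ with hgdef
  have hg : ∀ u v, ∫ ω, maProcess (maCoeff p a) ε u ω * maProcess (maCoeff p a) ε v ω ∂μ =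
      g (u - v) := by
    intro u v
    rw [hgdef]
    simp only
    rw [← hx.cov_stationary u (u - v), sub_sub_cancel]
    refine integral_congr_ae ?_
    filter_upwards [hall] with ω hω
    rw [hω, hω]
  have hlow : ∀ q : ℕ, q ≠ 0 → ∃ (A : ℝ) (n₀ : ℕ), ∀ n ≥ n₀, ∃ lam : Ω → ℝ,
      (∀ᵐ ω ∂μ, 0 < lam ω) ∧ (∀ᵐ ω ∂μ, ∀ v : Fin k → ℝ, lam ω * (v ⬝ᵥ v) ≤
        v ⬝ᵥ (sampleGam (maProcess (maCoeff p a) ε) h k n ω *ᵥ v)) ∧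
      LpBound μ q (fun ω => (lam ω)⁻¹) A := by
    intro q hq
    obtain ⟨A, n₀, hA⟩ := exists_sampleGam_lower_bound hε hx hF h hk1 hq
    refine ⟨A, n₀, fun n hn => ?_⟩
    obtain ⟨lam, h1, h2, h3⟩ := hA n hn
    refine ⟨lam, h1, ?_, h3⟩
    filter_upwards [h2, hall] with ω h4 h5
    rwa [sampleGam_congr h5] at h4
  -- Only positivity of the lower bound is used here, to invert the sample matrix and `Γ`; any `q`
  -- would serve.
  obtain ⟨A₁, n₁, hA₁⟩ := hlow 1 one_ne_zero
  have hdetn : ∀ n ≥ n₁, ∀ᵐ ω ∂μ,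
      IsUnit (sampleGam (maProcess (maCoeff p a) ε) h k n ω).det := by
    intro n hn
    obtain ⟨lam, h1, h2, -⟩ := hA₁ n hn
    filter_upwards [h1, h2] with ω h3 h4
    exact isUnit_det_of_lower_bound h3 h4
  have hdet : IsUnit (Gam μ (maProcess (maCoeff p a) ε) k).det := by
    obtain ⟨lam, h1, h2, -⟩ := hA₁ n₁ le_rfl
    refine isUnit_det_Gam_maProcess hε hb hK2 hg (h := h) (n := n₁) ?_
    filter_upwards [h1, h2] with ω h3 h4 v hv
    refine lt_of_lt_of_le (mul_pos h3 ?_) (h4 v)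
    exact lt_of_le_of_ne (zero_le_dotProduct_self v) fun h0 => hv (dotProduct_self_eq_zero.1 h0.symm)
  obtain ⟨B, n₂, hB0, hB⟩ :=
    exists_integral_estimationError_sub_le hε hb hδ hK hK' hg hdec hdet hlow
  have hθ' : IsDirectEstimator μ (maProcess (maCoeff p a) ε) h k θ := by
    intro n
    filter_upwards [hθ n, hall] with ω h1 h2
    rwa [sampleGam_congr h2, sampleCross_congr h2] at h1
  have hf : f₂ μ x p a σ h k = ((Gam μ (maProcess (maCoeff p a) ε) k)⁻¹ *
      Matrix.of fun i j : Fin k => scoreCov (maCoeff p a) σ g h i j).trace := by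
    have h1 : covMatrix μ (fun ω => ∑ j ∈ Finset.range h, maCoeff p a j • lagVec x k j ω) =
        covMatrix μ (fun ω => ∑ j ∈ Finset.range h,
          maCoeff p a j • lagVec (maProcess (maCoeff p a) ε) k j ω) := by
      refine covMatrix_congr ?_
      filter_upwards [hall] with ω hω
      simp only [lagVec_congr hω]
    have h2 : (Matrix.of fun i j : Fin k => scoreCov (maCoeff p a) σ g h i j) =
        σ ^ 2 • covMatrix μ (fun ω => ∑ j ∈ Finset.range h,
          maCoeff p a j • lagVec (maProcess (maCoeff p a) ε) k j ω) := by
      ext i j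
      rw [Matrix.of_apply, ← covMatrix_maProcess hε hb hK2 hg h i j, Matrix.smul_apply,
        smul_eq_mul, mul_comm]
    rw [f₂, Gam_congr hall, h1, h2, Matrix.mul_smul, Matrix.trace_smul, smul_eq_mul, mul_comm]
  have hmain : ∀ n ≥ max n₁ n₂, Integrable (fun ω => directError x h k θ n ω ^ 2) μ ∧
      mspeDirect μ x h k θ n - sigmaSq p a σ h =
        ∫ ω, estimationError (maCoeff p a) ε h k n ω ^ 2 ∂μ := by
    intro n hn
    obtain ⟨hhk, hW, -⟩ := hB n ((le_max_right _ _).trans hn)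
    obtain ⟨h1, h2⟩ := integral_sq_directError_maProcess hε hb hK2 hdec hhk
      (hdetn n ((le_max_left _ _).trans hn)) hθ' hW
    have h3 : (fun ω => directError (maProcess (maCoeff p a) ε) h k θ n ω ^ 2) =ᵐ[μ]
        fun ω => directError x h k θ n ω ^ 2 := by
      filter_upwards [hall] with ω hω
      rw [directError_congr hω]
    refine ⟨h1.congr h3, ?_⟩
    rw [mspeDirect, ← integral_congr_ae h3, h2, sigmaSq, add_sub_cancel_left]
  refine ⟨eventually_atTop.2 ⟨max n₁ n₂, fun n hn => (hmain n hn).1⟩, ?_⟩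
  refine Asymptotics.IsBigO.of_bound (4 * B + |f₂ μ x p a σ h k| * (2 * (h + k))) ?_
  filter_upwards [eventually_ge_atTop (max (max n₁ n₂) (2 * (h + k)))] with n hn
  have hn1 := (le_max_left _ _).trans hn
  obtain ⟨-, -, h1⟩ := hB n ((le_max_right _ _).trans hn1)
  rw [← hf] at h1
  rw [(hmain n hn1).2, Real.norm_eq_abs, Real.norm_of_nonneg (Real.rpow_nonneg n.cast_nonneg _),
    Real.rpow_neg n.cast_nonneg, ← Real.sqrt_eq_rpow]
  exact abs_rescaled_sub_le hB0 rfl hk1 ((le_max_right _ _).trans hn) h1
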